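/- Let $\mathbb{F}$ be a finite field or an algebraic number field, presented over its prime field $k$ ($k=\mathbb{Z}/p$ or $\mathbb{Q}$) as $k[x]/(f)$, so that an element of $\mathbb{F}$ is written as its coordinate vector over $k$ with respect to $1,x,\dots,x^{\deg f-1}$, with integers in binary and rationals as pairs numerator/denominator in lowest terms. All objects are written as words over a fixed finite alphabet, and polynomial time refers to Turing machines. An algebraic circuit over $\mathbb{F}$ is a directed acyclic graph, listed in a topological order with its last gate as output, whose gates are variables, constants of $\mathbb{F}$, binary products, linear combinations (of any fan-in, with coefficients in $\mathbb{F}$), and inversions; an inversion is allowed only if its argument depends on no variable (syntactically) and has a nonzero value. $\mathrm{PIT}_{\mathbb{F}}$ is the set of (encodings of) such circuits that compute the zero polynomial. A finite system $F_1,\dots,F_m$ of polynomials in variables $x_0,x_1,\dots$ over $\mathbb{F}$ is given by listing, for each polynomial, its terms (coefficient, and variables with exponents in binary). Variety Emptiness over $\mathbb{F}$ is the set of (encodings of) such systems that have no common zero over the algebraic closure $\overline{\mathbb{F}}$. An $\mathrm{IPS}_{\mathbb{F}}$ proof that $F_1,\dots,F_m$ has no common zero consists of the system itself together with an algebraic circuit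 over $\mathbb{F}$ computing a polynomial $C(\overline{x},y_1,\dots,y_m)$ such that $C(\overline{x},F_1(\overline{x}),\dots,F_m(\overline{x}))=1$ and $C\in\langle y_1,\dots,y_m\rangle$. Its size is its total bit-size, i.e. the length of its encoding. A Cook–Reckhow proof system for a language $L$ is a polynomial-time computable function $P$ on words whose image is exactly $L$; a $P$-proof of $x$ is a word $\pi$ with $P(\pi)=x$. It p-simulates a proof system $Q$ for $L$ if there is a polynomial $q$ such that for every $x\in L$ the length of a shortest $P$-proof of $x$ is at most $q$ of the length of a shortest $Q$-proof of $x$. Then there exists a Cook–Reckhow proof system for Variety Emptiness over $\mathbb{F}$ that p-simulates $\mathrm{IPS}_{\mathbb{F}}$ if and only if $\mathrm{PIT}_{\mathbb{F}}\in\mathsf{NP}$. -/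

import Mathlib

/-! ## Polynomial time, NP, proof systems

Polynomial time is Mathlib's `Turing.TM2ComputableInPolyTime`: a multi-stack Turing machine with
finitely many states that halts with the output within polynomially many steps. -/

/-- `f : Γ* → Γ*` is computable in polynomial time. -/
def PolyTimeFun {Γ : Type} (f : List Γ → List Γ) : Prop :=
  Nonempty (Turing.TM2ComputableInPolyTime (fun w : List Γ => w) (fun w : List Γ => w) f)

/-- The word `x # w` presented to a verifier, where `#` (that is, `none`) is a new letter. -/
def encPair {Γ : Type} (a : List Γ × List Γ) : List (Option Γ) :=
  a.1.map some ++ none :: a.2.map some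

/-- `L` is in NP: membership has witnesses of polynomial length that can be checked in
polynomial time. -/
def InNP {Γ : Type} (L : Set (List Γ)) : Prop :=
  ∃ (V : List Γ × List Γ → Bool) (p : Polynomial ℕ),
    Nonempty (Turing.TM2ComputableInPolyTime encPair Computability.encodeBool V) ∧
    ∀ x, x ∈ L ↔ ∃ w : List Γ, w.length ≤ p.eval x.length ∧ V (x, w) = true

/-- A Cook–Reckhow proof system for `L`: a polynomial-time function with image exactly `L`. -/
def IsCookReckhow {Γ : Type} (P : List Γ → List Γ) (L : Set (List Γ)) : Prop :=
  PolyTimeFun P ∧ Set.range P = L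

/-- The length of a shortest proof of `x`, where `Proves π x` says that `π` is a proof of `x`;
it is `⊤` if there is no proof. -/
noncomputable def proofLen {Γ : Type} (Proves : List Γ → List Γ → Prop) (x : List Γ) : ℕ∞ :=
  ⨅ π : {π : List Γ // Proves π x}, (π.1.length : ℕ∞)

/-- `P` p-simulates `Q` for `L`: shortest `P`-proofs of the members of `L` are at most
polynomially longer than shortest `Q`-proofs. -/
def PSimulates {Γ : Type} (P Q : List Γ → List Γ → Prop) (L : Set (List Γ)) : Prop :=
  ∃ p : Polynomial ℕ, ∀ x ∈ L, ∀ n : ℕ, proofLen Q x = n → proofLen P x ≤ (p.eval n : ℕ)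

/-! ## Words over a fixed finite alphabet -/

/-- The alphabet: two bits and two brackets. -/
inductive Letter
  | b0 | b1 | lp | rp
  deriving DecidableEq

instance : Fintype Letter :=
  ⟨{Letter.b0, Letter.b1, Letter.lp, Letter.rp}, fun x => by cases x <;> simp⟩

def encBit (b : Bool) : Letter := if b then Letter.b1 else Letter.b0

/-- A natural number in binary (least significant bit first), between brackets. -/
def encNat (n : ℕ) : List Letter := Letter.lp :: (n.bits.map encBit ++ [Letter.rp])

/-- An integer as a sign bit followed by its absolute value in binary, between brackets. -/
def encInt (z : ℤ) : List Letter :=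
  Letter.lp :: encBit (decide (z < 0)) :: (z.natAbs.bits.map encBit ++ [Letter.rp])

/-- A rational number as a pair of integers, numerator and (positive) denominator. -/
def encRat (q : ℚ) : List Letter := encInt q.num ++ encNat q.den

/-- A list, between brackets, of items encoded by `enc`. -/
def encList {α : Type*} (enc : α → List Letter) (l : List α) : List Letter :=
  Letter.lp :: (l.flatMap enc ++ [Letter.rp])

/-! ## Fields -/

/-- A presentation of `F` over its prime field `k` (either `ℤ/p` or `ℚ`) as `k[x]/f(x)`:
the choice of a generator whose powers `1, θ, …, θ ^ (deg f - 1)` form a `k`-basis of `F`. -/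
inductive FieldPresentation (F : Type*) [Field F]
  | finite (p : ℕ) [Fact p.Prime] [Algebra (ZMod p) F] (pb : PowerBasis (ZMod p) F)
  | numberField [CharZero F] (pb : PowerBasis ℚ F)

/-- An element of `F` is written as its coordinate vector over the prime field. -/
noncomputable def FieldPresentation.encElem {F : Type*} [Field F] :
    FieldPresentation F → F → List Letter
  | @FieldPresentation.finite _ _ _ _ _ pb, a => encList encNat (List.ofFn fun i => (pb.basis.repr a i).val)
  | @FieldPresentation.numberField _ _ _ pb, a => encList encRat (List.ofFn fun i => pb.basis.repr a i)

/-! ## Algebraic circuits -/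

/-- A gate; the arguments of a gate are given by their positions in the list of all gates. -/
inductive Gate (V F : Type*)
  | var (v : V)
  | const (c : F)
  | mul (j k : ℕ)
  | inv (j : ℕ)
  | lin (l : List (F × ℕ))

/-- A circuit: a directed acyclic graph, given by the list of its gates in a topological order.
The last gate is the output gate. -/
abbrev Circuit (V F : Type*) := List (Gate V F)

namespace Gate

variable {V F : Type*} [Field F]

/-- The positions of the gates that feed into a gate. -/
def args : Gate V F → List ℕ
  | var _ => []
  | const _ => []
  | mul j k => [j, k]
  | inv j => [j]
  | lin l => l.map Prod.snd

/-- Whether the gate is syntactically constant, given this information for the preceding gates. -/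
def synConst (prev : List Bool) : Gate V F → Bool
  | var _ => false
  | const _ => true
  | mul j k => prev.getD j false && prev.getD k false
  | inv j => prev.getD j false
  | lin l => l.all fun t => prev.getD t.2 false

/-- The polynomial computed at the gate, given the ones computed at the preceding gates.
The argument of an inversion gate in a valid circuit is a nonzero constant polynomial. -/
noncomputable def poly (prev : List (MvPolynomial V F)) : Gate V F → MvPolynomial V F
  | var v => MvPolynomial.X v
  | const c => MvPolynomial.C c
  | mul j k => prev.getD j 0 * prev.getD k 0
  | inv j => MvPolynomial.C (MvPolynomial.constantCoeff (prev.getD j 0))⁻¹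
  | lin l => (l.map fun t => MvPolynomial.C t.1 * prev.getD t.2 0).sum

/-- The encoding of a gate: its type followed by its data. -/
def enc (encV : V → List Letter) (encF : F → List Letter) : Gate V F → List Letter
  | var v => encNat 0 ++ encV v
  | const c => encNat 1 ++ encF c
  | mul j k => encNat 2 ++ encNat j ++ encNat k
  | inv j => encNat 3 ++ encNat j
  | lin l => encNat 4 ++ encList (fun t : F × ℕ => encF t.1 ++ encNat t.2) l

end Gate

namespace Circuit

variable {V F : Type*} [Field F]

/-- For each gate, whether it is syntactically constant, i.e. no variable has a path to it. -/
def synConsts (gs : Circuit V F) : List Bool :=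
  gs.foldl (fun acc g => acc ++ [g.synConst acc]) []

/-- The polynomials computed at the gates. -/
noncomputable def polys (gs : Circuit V F) : List (MvPolynomial V F) :=
  gs.foldl (fun acc g => acc ++ [g.poly acc]) []

/-- Arguments of gates precede them, and inversion is applied only to syntactically constant
gates with nonzero value. -/
def Valid (gs : Circuit V F) : Prop :=
  ∀ (i : ℕ) (g : Gate V F), gs[i]? = some g →
    (∀ j ∈ g.args, j < i) ∧
    (∀ j, g = Gate.inv j → gs.synConsts.getD j false = true ∧ gs.polys.getD j 0 ≠ 0)

/-- `gs` is a (nonempty, valid) circuit whose output gate computes `f`. -/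
def Computes (gs : Circuit V F) (f : MvPolynomial V F) : Prop :=
  gs.Valid ∧ gs.polys.getLast? = some f

/-- The encoding of a circuit as a word; its length is (within a factor of two,
for the four-letter alphabet) the total bit-size of the circuit, including all constants. -/
def enc (encV : V → List Letter) (encF : F → List Letter) (gs : Circuit V F) : List Letter :=
  encList (Gate.enc encV encF) gs

end Circuit

/-- Polynomial identity testing over `F`: circuits that compute the zero polynomial. -/
def PIT {F : Type*} [Field F] (pres : FieldPresentation F) : Set (List Letter) :=
  {w | ∃ c : Circuit ℕ F, w = c.enc encNat pres.encElem ∧ c.Computes 0}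

/-! ## Systems of polynomial equations -/

/-- A polynomial given by a list of terms; a term is a coefficient together with a list of pairs
of (the index of) a variable and an exponent. -/
abbrev SparsePoly (F : Type*) := List (F × List (ℕ × ℕ))

/-- The polynomial `∑ c * ∏ x_i ^ e`. -/
noncomputable def SparsePoly.toPoly {F : Type*} [Field F] (f : SparsePoly F) :
    MvPolynomial ℕ F :=
  (f.map fun t => MvPolynomial.C t.1 * (t.2.map fun m => MvPolynomial.X m.1 ^ m.2).prod).sum

/-- The encoding of a polynomial, with variable indices and exponents in binary. -/
def SparsePoly.enc {F : Type*} (encF : F → List Letter) (f : SparsePoly F) : List Letter :=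
  encList (fun t : F × List (ℕ × ℕ) =>
    encF t.1 ++ encList (fun m : ℕ × ℕ => encNat m.1 ++ encNat m.2) t.2) f

/-- The encoding of a finite system of polynomials. -/
def encSystem {F : Type*} (encF : F → List Letter) (S : List (SparsePoly F)) : List Letter :=
  encList (SparsePoly.enc encF) S

/-- Variety Emptiness over `F`: systems without a common zero over the algebraic closure. -/
def VarietyEmptiness {F : Type*} [Field F] (pres : FieldPresentation F) : Set (List Letter) :=
  {w | ∃ S : List (SparsePoly F), w = encSystem pres.encElem S ∧
    ¬ ∃ a : ℕ → AlgebraicClosure F, ∀ f ∈ S, MvPolynomial.aeval a f.toPoly = 0}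

/-! ## The Ideal Proof System -/

/-- `C(x, y)` is an IPS certificate that `G` lies in the ideal generated by `Fs 0, …, Fs (m-1)`:
`C(x, Fs(x)) = G(x)`, and `C` lies in the ideal generated by the placeholder variables `y`.
The variables `x` are indexed by `ℕ`, the variables `y` by `Fin m`. -/
def IsIPSCertificate {F : Type*} [Field F] {m : ℕ} (Fs : Fin m → MvPolynomial ℕ F)
    (G : MvPolynomial ℕ F) (C : MvPolynomial (ℕ ⊕ Fin m) F) : Prop :=
  MvPolynomial.aeval (Sum.elim MvPolynomial.X Fs) C = G ∧
  C ∈ Ideal.span (Set.range fun j : Fin m =>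
    (MvPolynomial.X (Sum.inr j) : MvPolynomial (ℕ ⊕ Fin m) F))

/-- The encoding of the variables of a certificate. -/
def encIPSVar {m : ℕ} : ℕ ⊕ Fin m → List Letter
  | .inl i => encNat 0 ++ encNat i
  | .inr j => encNat 1 ++ encNat j

/-- `π` is an IPS proof for the word `x`: `x` encodes a system of polynomials, and `π` consists of
this system and a circuit that computes an IPS certificate of `1` from it. -/
def IPSProves {F : Type*} [Field F] (pres : FieldPresentation F) (π x : List Letter) : Prop :=
  ∃ (S : List (SparsePoly F)) (c : Circuit (ℕ ⊕ Fin S.length) F)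
    (C : MvPolynomial (ℕ ⊕ Fin S.length) F),
    x = encSystem pres.encElem S ∧
    π = encSystem pres.encElem S ++ c.enc encIPSVar pres.encElem ∧
    c.Computes C ∧
    IsIPSCertificate (fun j => (S.get j).toPoly) 1 C

/-! Two translations between identity tests and systems of equations carry the theorem. Neither does
any arithmetic in `F`: coefficients are copied as words, and the only field elements a machine has
to produce are the fixed words for 1 and -1.

From a simulation to PIT in NP. A circuit `c` becomes `circuitSystem`: a variable `z_i` and an
equation for each gate, and an output equation `∏ z_j · (1 - w · z_last) = 0`, where `j` runs over
the arguments of inversions. The gate values at any input solve the gate equations, and the output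
equation can be solved as well if an inversion argument vanishes or the output is nonzero. So a
syntactically correct circuit whose system has no solution is valid and computes zero
(`computes_zero_of_system`). Conversely, if `c` computes zero, its system has a short IPS
certificate (`exists_certificate`). It is built from polynomials `Z_i(x, y)` that equal the gate
polynomials at `y = 0` and the variables `z_i` at `y = F`. For most gates, `Z_i` is the gate applied
to the `Z` of its arguments, minus `y_i`; inversions of a constant `a` need an explicit formula. If
`P` is the product of the `Z_j` over the arguments of inversions and `u` is its inverse at `y = 0`,
then `1 + u (y_last + w Z_last P - P)` is a certificate. Hence a proof of this system in the
simulating proof system is a short witness for the circuit (`inNP_PIT_of_simulates`); checking it is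
sound because such a proof system proves only members of Variety Emptiness.

From PIT in NP to a proof system. A certificate `C` is characterized by the identities `C(x, F) = 1`
and `C(x, 0) = 0`. A proof therefore consists of a system, a circuit, the position of its output and
witnesses for two instances of PIT. Both place the circuit on top of a circuit that computes the
polynomials of the system; in the second instance zeros are presented in place of these polynomials.
At a common zero of the system the two would have equal gate values, so one gate would be both 1 and
0 (`not_exists_zero_of_tests`). IPS proofs yield such proofs of polynomial length (`computes_test`,
`exists_proofSystem_proof`), and by the Nullstellensatz every member of Variety Emptiness has an IPS
proof, so the image is the whole language.

That a word occurring as a coefficient encodes an element of `F` is never tested. It is inferred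
from membership of the constructed word in Variety Emptiness or PIT, since the construction keeps
all coefficients.

Polynomial time is handled by the predicate `PT`: structured stack programs on binary trees, closed
under composition, pairing, case distinction and iteration with bounded growth. `PT.oracle` permits
calls of a given machine, and `PT.tm2` compiles a program to a Turing machine. -/

section

open Turing

/-! ## Structured stack programs -/

/-- Binary trees, the universal data type of stack programs. -/
inductive BinTree
  | leaf
  | node (l r : BinTree)

/-- The word of a tree in prefix notation. -/
def BinTree.word : BinTree → List Bool
  | leaf => [false]
  | node l r => true :: (l.word ++ r.word)

/-- The alphabets of the input and output stacks, and a machine that programs may call. -/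
structure StackEnv where
  Γi : Type
  Γo : Type
  M : FinTM2

/-- The stacks of a program besides those of the callable machine. -/
inductive StackReg
  | main | tmp1 | tmp2 | cnt | inp | out
  deriving DecidableEq

instance : Fintype StackReg :=
  ⟨{.main, .tmp1, .tmp2, .cnt, .inp, .out}, fun x => by cases x <;> simp⟩

namespace StackEnv

variable (E : StackEnv)

abbrev K := StackReg ⊕ E.M.K

abbrev RegΓ : StackReg → Type
  | .main => Bool
  | .tmp1 => Bool
  | .tmp2 => Bool
  | .cnt => Bool
  | .inp => E.Γi
  | .out => E.Γo

abbrev Γ : E.K → Type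
  | .inl k => E.RegΓ k
  | .inr k => E.M.Γ k

abbrev State := ∀ k : E.K, List (E.Γ k)

abbrev σ := Bool × E.M.σ

variable {E}

/-- A state from the contents of its own stacks and of the stacks of the callable machine. -/
def join (r : ∀ k, List (E.RegΓ k)) (s : ∀ k, List (E.M.Γ k)) : E.State
  | .inl k => r k
  | .inr k => s k

theorem update_join_inl (r : ∀ k, List (E.RegΓ k)) (s : ∀ k, List (E.M.Γ k)) (k : StackReg)
    (x : List (E.RegΓ k)) :
    Function.update (join r s) (.inl k) x = join (Function.update r k x) s := by
  funext k'
  rcases k' with k' | k'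
  · by_cases h : k' = k
    · subst h; simp [join]
    · have h' : (Sum.inl k' : E.K) ≠ Sum.inl k := by simpa using h
      rw [Function.update_of_ne h']; simp [join, Function.update_of_ne h]
  · rw [Function.update_of_ne (by simp)]; rfl

theorem update_join_inr (r : ∀ k, List (E.RegΓ k)) (s : ∀ k, List (E.M.Γ k)) (k : E.M.K)
    (x : List (E.M.Γ k)) :
    Function.update (join r s) (.inr k) x = join r (Function.update s k x) := by
  funext k'
  rcases k' with k' | k'
  · rw [Function.update_of_ne (by simp)]; rfl
  · by_cases h : k' = k
    · subst h; simp [join]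
    · have h' : (Sum.inr k' : E.K) ≠ Sum.inr k := by simpa using h
      rw [Function.update_of_ne h']; simp [join, Function.update_of_ne h]

end StackEnv

/-- Structured programs on the stacks of `E`. -/
inductive StackProg (E : StackEnv)
  | skip
  | push (k : E.K) (a : E.Γ k)
  | pop (k : E.K)
  | seq (p q : StackProg E)
  | ite (k : E.K) (f : Option (E.Γ k) → Bool) (p q : StackProg E)
  | loop (k : E.K) (f : Option (E.Γ k) → Bool) (p : StackProg E)
  | call

/-- `n` steps of a machine lead from `c` to `d`. -/
def TM2Steps {K : Type} [DecidableEq K] {Γ : K → Type} {Λ σ : Type} (m : Λ → TM2.Stmt Γ Λ σ)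
    (n : ℕ) (c d : TM2.Cfg Γ Λ σ) : Prop :=
  (flip bind (TM2.step m))^[n] (some c) = some d

namespace TM2Steps

variable {K : Type} [DecidableEq K] {Γ : K → Type} {Λ σ : Type} {m : Λ → TM2.Stmt Γ Λ σ}

theorem trans {n₁ n₂ : ℕ} {c d e : TM2.Cfg Γ Λ σ} (h₁ : TM2Steps m n₁ c d)
    (h₂ : TM2Steps m n₂ d e) : TM2Steps m (n₁ + n₂) c e := by
  unfold TM2Steps at *
  rw [add_comm, Function.iterate_add_apply, h₁, h₂]

theorem single {l : Λ} {v : σ} {S : ∀ k, List (Γ k)} {d : TM2.Cfg Γ Λ σ}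
    (h : TM2.stepAux (m l) v S = d) : TM2Steps m 1 ⟨some l, v, S⟩ d := by
  subst h; rfl

end TM2Steps

namespace StackProg

variable {E : StackEnv}

/-- `p` leads from `S` to `S'` in `t` steps. -/
inductive Run : StackProg E → E.State → E.State → ℕ → Prop
  | skip {S} : Run skip S S 1
  | push {S} {k : E.K} {a : E.Γ k} : Run (push k a) S (Function.update S k (a :: S k)) 1
  | pop {S} {k : E.K} : Run (pop k) S (Function.update S k (S k).tail) 1
  | seq {p q S S' S'' t t'} : Run p S S' t → Run q S' S'' t' → Run (seq p q) S S'' (t + t')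
  | ite_true {k f p q S S' t} : f (S k).head? = true → Run p S S' t → Run (ite k f p q) S S' (1 + t)
  | ite_false {k f p q S S' t} : f (S k).head? = false → Run q S S' t →
      Run (ite k f p q) S S' (1 + t)
  | loop_false {k f p S} : f (S k).head? = false → Run (loop k f p) S S 1
  | loop_true {k f p S S' S'' t t'} : f (S k).head? = true → Run p S S' t →
      Run (loop k f p) S' S'' t' → Run (loop k f p) S S'' (1 + t + t')
  -- A halting configuration that counts as an output has the initial internal state again, so
  -- requiring this state before and after allows repeated calls.
  | call {r s s' t} : TM2Steps E.M.m t ⟨some E.M.main, E.M.initialState, s⟩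
      ⟨none, E.M.initialState, s'⟩ → Run call (StackEnv.join r s) (StackEnv.join r s') t

/-- The control positions of a program. -/
def Pos : StackProg E → Type
  | skip => Unit
  | push _ _ => Unit
  | pop _ => Unit
  | seq p q => p.Pos ⊕ q.Pos
  | ite _ _ p q => Unit ⊕ (p.Pos ⊕ q.Pos)
  | loop _ _ p => Unit ⊕ p.Pos
  | call => E.M.Λ

instance posFintype : (p : StackProg E) → Fintype p.Pos
  | skip => inferInstanceAs (Fintype Unit)
  | push _ _ => inferInstanceAs (Fintype Unit)
  | pop _ => inferInstanceAs (Fintype Unit)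
  | seq p q => @instFintypeSum _ _ (posFintype p) (posFintype q)
  | ite _ _ p q => @instFintypeSum _ _ inferInstance
      (@instFintypeSum _ _ (posFintype p) (posFintype q))
  | loop _ _ p => @instFintypeSum _ _ inferInstance (posFintype p)
  | call => E.M.ΛFin

def entry : (p : StackProg E) → p.Pos
  | skip => ()
  | push _ _ => ()
  | pop _ => ()
  | seq p _ => .inl p.entry
  | ite _ _ _ _ => .inl ()
  | loop _ _ _ => .inl ()
  | call => E.M.main

/-- A statement of the callable machine, acting on the stacks of `E`. -/
def liftStmt {L : Type} (emb : E.M.Λ → L) (exit : L) :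
    TM2.Stmt E.M.Γ E.M.Λ E.M.σ → TM2.Stmt E.Γ L E.σ
  | .push k f q => .push (.inr k) (fun v => f v.2) (liftStmt emb exit q)
  | .peek k f q => .peek (.inr k) (fun v o => (v.1, f v.2 o)) (liftStmt emb exit q)
  | .pop k f q => .pop (.inr k) (fun v o => (v.1, f v.2 o)) (liftStmt emb exit q)
  | .load f q => .load (fun v => (v.1, f v.2)) (liftStmt emb exit q)
  | .branch f q₁ q₂ => .branch (fun v => f v.2) (liftStmt emb exit q₁) (liftStmt emb exit q₂)
  | .goto f => .goto fun v => emb (f v.2)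
  | .halt => .goto fun _ => exit

/-- The statement that tests the top of a stack and jumps. -/
def testStmt {L : Type} (k : E.K) (f : Option (E.Γ k) → Bool) (l₁ l₂ : L) : TM2.Stmt E.Γ L E.σ :=
  .peek k (fun v o => (f o, v.2)) <| .branch Prod.fst
    -- The test bit is reset, so that between instructions the internal state is always `(false,
    -- initialState)`.
    (.load (fun v => (false, v.2)) <| .goto fun _ => l₁)
    (.load (fun v => (false, v.2)) <| .goto fun _ => l₂)

/-- The compiled program. -/
def code {L : Type} : (p : StackProg E) → (p.Pos → L) → L → p.Pos → TM2.Stmt E.Γ L E.σ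
  | skip, _, exit, _ => .goto fun _ => exit
  | push k a, _, exit, _ => .push k (fun _ => a) (.goto fun _ => exit)
  | pop k, _, exit, _ => .pop k (fun v _ => v) (.goto fun _ => exit)
  | seq p q, emb, exit, x => match x with
    | .inl x => p.code (fun y => emb (.inl y)) (emb (.inr q.entry)) x
    | .inr x => q.code (fun y => emb (.inr y)) exit x
  | ite k f p q, emb, exit, x => match x with
    | .inl _ => testStmt k f (emb (.inr (.inl p.entry))) (emb (.inr (.inr q.entry)))
    | .inr (.inl x) => p.code (fun y => emb (.inr (.inl y))) exit x
    | .inr (.inr x) => q.code (fun y => emb (.inr (.inr y))) exit x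
  | loop k f p, emb, exit, x => match x with
    | .inl _ => testStmt k f (emb (.inr p.entry)) exit
    | .inr x => p.code (fun y => emb (.inr y)) (emb (.inl ())) x
  | call, emb, exit, x => liftStmt emb exit (E.M.m x)

/-! ### Correctness of the compilation of stack programs. -/

section Compile

variable {L : Type} {m : L → TM2.Stmt E.Γ L E.σ}

/-- A configuration of the callable machine, seen inside a larger machine. -/
def liftCfg (emb : E.M.Λ → L) (exit : L) (b : Bool) (r : ∀ k, List (E.RegΓ k))
    (c : TM2.Cfg E.M.Γ E.M.Λ E.M.σ) : TM2.Cfg E.Γ L E.σ :=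
  ⟨some (c.l.elim exit emb), (b, c.var), StackEnv.join r c.stk⟩

theorem stepAux_liftStmt (emb : E.M.Λ → L) (exit : L) (b : Bool) (r : ∀ k, List (E.RegΓ k))
    (q : TM2.Stmt E.M.Γ E.M.Λ E.M.σ) : ∀ (v : E.M.σ) (s : ∀ k, List (E.M.Γ k)),
    TM2.stepAux (liftStmt emb exit q) (b, v) (StackEnv.join r s) =
      liftCfg emb exit b r (TM2.stepAux q v s) := by
  induction q with
  | push k f q ih => intro v s; simp only [liftStmt, TM2.stepAux, StackEnv.update_join_inr]; exact ih _ _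
  | peek k f q ih => intro v s; simp only [liftStmt, TM2.stepAux]; exact ih _ _
  | pop k f q ih => intro v s; simp only [liftStmt, TM2.stepAux, StackEnv.update_join_inr]; exact ih _ _
  | load f q ih => intro v s; simp only [liftStmt, TM2.stepAux]; exact ih _ _
  | branch f q₁ q₂ ih₁ ih₂ =>
    intro v s
    simp only [liftStmt, TM2.stepAux]
    cases f v
    · exact ih₂ _ _
    · exact ih₁ _ _
  | goto f => intro v s; rfl
  | halt => intro v s; rfl

theorem iterate_bind_none {α : Type*} (f : α → Option α) (n : ℕ) :
    (flip bind f)^[n] none = none := by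
  induction n with
  | zero => rfl
  | succ n ih => rw [Function.iterate_succ_apply]; exact ih

/-- Halting becomes a jump to `exit`, so the number of steps is unchanged. Inside the machine a
halted configuration has no successor, which excludes it before the last step. -/
theorem lift_steps (emb : E.M.Λ → L) (exit : L) (b : Bool) (r : ∀ k, List (E.RegΓ k))
    (hm : ∀ x, m (emb x) = liftStmt emb exit (E.M.m x)) {d : TM2.Cfg E.M.Γ E.M.Λ E.M.σ}
    (n : ℕ) : ∀ (c : TM2.Cfg E.M.Γ E.M.Λ E.M.σ), TM2Steps E.M.m n c d →
      TM2Steps m n (liftCfg emb exit b r c) (liftCfg emb exit b r d) := by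
  induction n with
  | zero =>
    intro c h
    have : c = d := by simpa [TM2Steps] using h
    subst this; rfl
  | succ n ih =>
    rintro ⟨l, v, s⟩ h
    cases l with
    | none =>
      unfold TM2Steps at h
      rw [Function.iterate_succ_apply] at h
      have : (flip bind (TM2.step E.M.m)) (some ⟨none, v, s⟩) = none := rfl
      rw [this, iterate_bind_none] at h
      cases h
    | some l =>
      unfold TM2Steps at h
      rw [Function.iterate_succ_apply] at h
      have h' := ih (TM2.stepAux (E.M.m l) v s) h
      rw [add_comm]
      refine TM2Steps.trans (TM2Steps.single ?_) h'
      show TM2.stepAux (m (emb l)) (b, v) (StackEnv.join r s) = _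
      rw [hm, stepAux_liftStmt]

theorem testStmt_true {k : E.K} {f : Option (E.Γ k) → Bool} {l₁ l₂ : L} {v : E.M.σ} {S : E.State}
    (h : f (S k).head? = true) :
    TM2.stepAux (testStmt k f l₁ l₂) (false, v) S = ⟨some l₁, (false, v), S⟩ := by
  simp [testStmt, TM2.stepAux, h]

theorem testStmt_false {k : E.K} {f : Option (E.Γ k) → Bool} {l₁ l₂ : L} {v : E.M.σ} {S : E.State}
    (h : f (S k).head? = false) :
    TM2.stepAux (testStmt k f l₁ l₂) (false, v) S = ⟨some l₂, (false, v), S⟩ := by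
  simp [testStmt, TM2.stepAux, h]

/-- A program owns the labels `emb x` and is left only through `exit`. Since `m` is constrained on
these labels alone, the induction passes to a subprogram by restricting `emb` and choosing its exit.
-/
theorem Run.steps {p : StackProg E} {S S' : E.State} {t : ℕ} (h : Run p S S' t) :
    ∀ (emb : p.Pos → L) (exit : L), (∀ x, m (emb x) = p.code emb exit x) →
      TM2Steps m t ⟨some (emb p.entry), (false, E.M.initialState), S⟩
        ⟨some exit, (false, E.M.initialState), S'⟩ := by
  induction h with
  | skip =>
    intro emb exit hm
    refine TM2Steps.single ?_
    rw [hm]; rfl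
  | push =>
    intro emb exit hm
    refine TM2Steps.single ?_
    rw [hm]; rfl
  | pop =>
    intro emb exit hm
    refine TM2Steps.single ?_
    rw [hm]; rfl
  | seq _ _ ih₁ ih₂ =>
    intro emb exit hm
    exact (ih₁ _ _ fun x => hm (.inl x)).trans (ih₂ _ _ fun x => hm (.inr x))
  | ite_true hf _ ih =>
    intro emb exit hm
    refine (TM2Steps.single ?_).trans (ih (fun y => emb (.inr (.inl y))) exit fun x => hm (.inr (.inl x)))
    rw [hm]
    exact testStmt_true hf
  | ite_false hf _ ih =>
    intro emb exit hm
    refine (TM2Steps.single ?_).trans (ih (fun y => emb (.inr (.inr y))) exit fun x => hm (.inr (.inr x)))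
    rw [hm]
    exact testStmt_false hf
  | loop_false hf =>
    intro emb exit hm
    refine TM2Steps.single ?_
    rw [hm]
    exact testStmt_false hf
  | loop_true hf _ _ ih₁ ih₂ =>
    intro emb exit hm
    refine ((TM2Steps.single ?_).trans (ih₁ (fun y => emb (.inr y)) (emb (.inl ()))
      fun x => hm (.inr x))).trans (ih₂ emb exit hm)
    rw [hm]
    exact testStmt_true hf
  | call hs =>
    intro emb exit hm
    exact lift_steps emb exit false _ hm _ _ hs

end Compile

end StackProg

/-! ### Basic programs on trees stored in prefix notation. -/

namespace StackProg

variable {E : StackEnv}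

/-- `p` leads from `S` to `S'` in at most `t` steps. -/
def Runs (p : StackProg E) (S S' : E.State) (t : ℕ) : Prop := ∃ u ≤ t, Run p S S' u

namespace Runs

theorem mono {p : StackProg E} {S S' : E.State} {t t' : ℕ} (h : Runs p S S' t) (ht : t ≤ t') :
    Runs p S S' t' := by
  obtain ⟨u, hu, h⟩ := h
  exact ⟨u, hu.trans ht, h⟩

theorem skip {S : E.State} : Runs StackProg.skip S S 1 := ⟨1, le_rfl, .skip⟩

theorem push {S : E.State} {k : E.K} {a : E.Γ k} :
    Runs (StackProg.push k a) S (Function.update S k (a :: S k)) 1 := ⟨1, le_rfl, .push⟩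

theorem pop {S : E.State} {k : E.K} :
    Runs (StackProg.pop k) S (Function.update S k (S k).tail) 1 := ⟨1, le_rfl, .pop⟩

theorem seq {p q : StackProg E} {S S' S'' : E.State} {t t' : ℕ} (h₁ : Runs p S S' t)
    (h₂ : Runs q S' S'' t') : Runs (StackProg.seq p q) S S'' (t + t') := by
  obtain ⟨u, hu, h⟩ := h₁
  obtain ⟨u', hu', h'⟩ := h₂
  exact ⟨u + u', by omega, .seq h h'⟩

theorem ite_true {k : E.K} {f : Option (E.Γ k) → Bool} {p q : StackProg E} {S S' : E.State} {t : ℕ}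
    (hf : f (S k).head? = true) (h : Runs p S S' t) : Runs (StackProg.ite k f p q) S S' (1 + t) := by
  obtain ⟨u, hu, h⟩ := h
  exact ⟨1 + u, by omega, .ite_true hf h⟩

theorem ite_false {k : E.K} {f : Option (E.Γ k) → Bool} {p q : StackProg E} {S S' : E.State} {t : ℕ}
    (hf : f (S k).head? = false) (h : Runs q S S' t) :
    Runs (StackProg.ite k f p q) S S' (1 + t) := by
  obtain ⟨u, hu, h⟩ := h
  exact ⟨1 + u, by omega, .ite_false hf h⟩

theorem loop_false {k : E.K} {f : Option (E.Γ k) → Bool} {p : StackProg E} {S : E.State}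
    (hf : f (S k).head? = false) : Runs (StackProg.loop k f p) S S 1 := ⟨1, le_rfl, .loop_false hf⟩

theorem loop_true {k : E.K} {f : Option (E.Γ k) → Bool} {p : StackProg E} {S S' S'' : E.State}
    {t t' : ℕ} (hf : f (S k).head? = true) (h₁ : Runs p S S' t)
    (h₂ : Runs (StackProg.loop k f p) S' S'' t') :
    Runs (StackProg.loop k f p) S S'' (1 + t + t') := by
  obtain ⟨u, hu, h⟩ := h₁
  obtain ⟨u', hu', h'⟩ := h₂
  exact ⟨1 + u + u', by omega, .loop_true hf h h'⟩

end Runs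

/-- A program lengthens each of its own stacks by at most one letter per step. -/
theorem Run.length_le {p : StackProg E} {S S' : E.State} {t : ℕ} (h : Run p S S' t)
    (k : StackReg) : (S' (.inl k)).length ≤ (S (.inl k)).length + t := by
  induction h with
  | skip => omega
  | @push S k' a =>
    by_cases hk : (Sum.inl k : E.K) = k'
    · subst hk; simp
    · rw [Function.update_of_ne hk]; omega
  | @pop S k' =>
    by_cases hk : (Sum.inl k : E.K) = k'
    · subst hk; simp; omega
    · rw [Function.update_of_ne hk]; omega
  | seq _ _ ih₁ ih₂ => omega
  | ite_true _ _ ih => omega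
  | ite_false _ _ ih => omega
  | loop_false _ => omega
  | loop_true _ _ _ ih₁ ih₂ => omega
  | call _ => simp [StackEnv.join]

/-- The state with the given contents of the four working stacks and all other stacks empty. -/
def st (m a b c : List Bool) : E.State :=
  StackEnv.join (fun | .main => m | .tmp1 => a | .tmp2 => b | .cnt => c | .inp => [] | .out => [])
    fun _ => []

/-- The state in which all stacks but the main one are empty. -/
abbrev base (m : List Bool) : E.State := st m [] [] []

abbrev pMain (x : Bool) : StackProg E := .push (.inl .main) x
abbrev pTmp1 (x : Bool) : StackProg E := .push (.inl .tmp1) x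
abbrev pTmp2 (x : Bool) : StackProg E := .push (.inl .tmp2) x
abbrev pCnt (x : Bool) : StackProg E := .push (.inl .cnt) x
abbrev popMain : StackProg E := .pop (.inl .main)
abbrev popTmp1 : StackProg E := .pop (.inl .tmp1)
abbrev popTmp2 : StackProg E := .pop (.inl .tmp2)
abbrev popCnt : StackProg E := .pop (.inl .cnt)

theorem st_main (m a b c x : List Bool) :
    Function.update (st m a b c : E.State) (.inl .main) x = st x a b c := by
  rw [st, StackEnv.update_join_inl, st]; congr 1; funext k; cases k <;> rfl

theorem st_tmp1 (m a b c x : List Bool) :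
    Function.update (st m a b c : E.State) (.inl .tmp1) x = st m x b c := by
  rw [st, StackEnv.update_join_inl, st]; congr 1; funext k; cases k <;> rfl

theorem st_tmp2 (m a b c x : List Bool) :
    Function.update (st m a b c : E.State) (.inl .tmp2) x = st m a x c := by
  rw [st, StackEnv.update_join_inl, st]; congr 1; funext k; cases k <;> rfl

theorem st_cnt (m a b c x : List Bool) :
    Function.update (st m a b c : E.State) (.inl .cnt) x = st m a b x := by
  rw [st, StackEnv.update_join_inl, st]; congr 1; funext k; cases k <;> rfl

section Primitive

variable {m a b c : List Bool} {x : Bool}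

theorem runs_pMain : Runs (pMain x : StackProg E) (st m a b c) (st (x :: m) a b c) 1 := by
  have := Runs.push (E := E) (S := st m a b c) (k := .inl .main) (a := x)
  rwa [st_main] at this

theorem runs_pTmp1 : Runs (pTmp1 x : StackProg E) (st m a b c) (st m (x :: a) b c) 1 := by
  have := Runs.push (E := E) (S := st m a b c) (k := .inl .tmp1) (a := x)
  rwa [st_tmp1] at this

theorem runs_pTmp2 : Runs (pTmp2 x : StackProg E) (st m a b c) (st m a (x :: b) c) 1 := by
  have := Runs.push (E := E) (S := st m a b c) (k := .inl .tmp2) (a := x)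
  rwa [st_tmp2] at this

theorem runs_pCnt : Runs (pCnt x : StackProg E) (st m a b c) (st m a b (x :: c)) 1 := by
  have := Runs.push (E := E) (S := st m a b c) (k := .inl .cnt) (a := x)
  rwa [st_cnt] at this

theorem runs_popMain : Runs (popMain : StackProg E) (st (x :: m) a b c) (st m a b c) 1 := by
  have := Runs.pop (E := E) (S := st (x :: m) a b c) (k := .inl .main)
  rwa [st_main] at this

theorem runs_popTmp1 : Runs (popTmp1 : StackProg E) (st m (x :: a) b c) (st m a b c) 1 := by
  have := Runs.pop (E := E) (S := st m (x :: a) b c) (k := .inl .tmp1)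
  rwa [st_tmp1] at this

theorem runs_popTmp2 : Runs (popTmp2 : StackProg E) (st m a (x :: b) c) (st m a b c) 1 := by
  have := Runs.pop (E := E) (S := st m a (x :: b) c) (k := .inl .tmp2)
  rwa [st_tmp2] at this

theorem runs_popCnt : Runs (popCnt : StackProg E) (st m a b (x :: c)) (st m a b c) 1 := by
  have := Runs.pop (E := E) (S := st m a b (x :: c)) (k := .inl .cnt)
  rwa [st_cnt] at this

end Primitive

/-- Whether the top letter is `true`. -/
abbrev topTrue (o : Option Bool) : Bool := o == some true

def moveLoop1 : StackProg E :=
  .loop (.inl .cnt) Option.isSome (.ite (.inl .main) topTrue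
    (.seq popMain (.seq (pTmp1 true) (pCnt true)))
    (.seq popMain (.seq (pTmp1 false) popCnt)))

def moveLoop2 : StackProg E :=
  .loop (.inl .cnt) Option.isSome (.ite (.inl .main) topTrue
    (.seq popMain (.seq (pTmp2 true) (pCnt true)))
    (.seq popMain (.seq (pTmp2 false) popCnt)))

/-- The counter stack holds a letter for each tree still to be read: a node letter replaces one
pending tree by two, a leaf letter completes one. The arbitrary continuation to `S'` lets the
induction chain the two subtrees. -/
theorem runs_moveLoop1 (d : BinTree) : ∀ {r a b c : List Bool} {S' : E.State} {t : ℕ},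
    Runs moveLoop1 (st r (d.word.reverse ++ a) b c) S' t →
    Runs moveLoop1 (st (d.word ++ r) a b (true :: c)) S' (5 * d.word.length + t) := by
  induction d with
  | leaf =>
    intro r a b c S' t h
    refine (Runs.loop_true rfl (Runs.ite_false rfl
      (runs_popMain.seq (runs_pTmp1.seq runs_popCnt))) h).mono ?_
    simp [BinTree.word]
  | node l r ihl ihr =>
    intro r' a b c S' t h
    simp only [BinTree.word, List.cons_append, List.append_assoc, List.reverse_cons,
      List.reverse_append] at h ⊢
    refine (Runs.loop_true rfl (Runs.ite_true rfl
      (runs_popMain.seq (runs_pTmp1.seq runs_pCnt))) (ihl (ihr h))).mono ?_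
    simp; omega

theorem runs_moveLoop2 (d : BinTree) : ∀ {r a b c : List Bool} {S' : E.State} {t : ℕ},
    Runs moveLoop2 (st r a (d.word.reverse ++ b) c) S' t →
    Runs moveLoop2 (st (d.word ++ r) a b (true :: c)) S' (5 * d.word.length + t) := by
  induction d with
  | leaf =>
    intro r a b c S' t h
    refine (Runs.loop_true rfl (Runs.ite_false rfl
      (runs_popMain.seq (runs_pTmp2.seq runs_popCnt))) h).mono ?_
    simp [BinTree.word]
  | node l r ihl ihr =>
    intro r' a b c S' t h
    simp only [BinTree.word, List.cons_append, List.append_assoc, List.reverse_cons,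
      List.reverse_append] at h ⊢
    refine (Runs.loop_true rfl (Runs.ite_true rfl
      (runs_popMain.seq (runs_pTmp2.seq runs_pCnt))) (ihl (ihr h))).mono ?_
    simp; omega

/-- Moves the top value of the main stack to the first auxiliary stack, reversing its word. -/
def move1 : StackProg E := .seq (pCnt true) moveLoop1

/-- Moves the top value of the main stack to the second auxiliary stack, reversing its word. -/
def move2 : StackProg E := .seq (pCnt true) moveLoop2

theorem runs_move1 (d : BinTree) {r a b : List Bool} :
    Runs (move1 : StackProg E) (st (d.word ++ r) a b []) (st r (d.word.reverse ++ a) b [])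
      (5 * d.word.length + 2) :=
  (runs_pCnt.seq (runs_moveLoop1 d (Runs.loop_false rfl))).mono (by omega)

theorem runs_move2 (d : BinTree) {r a b : List Bool} :
    Runs (move2 : StackProg E) (st (d.word ++ r) a b []) (st r a (d.word.reverse ++ b) [])
      (5 * d.word.length + 2) :=
  (runs_pCnt.seq (runs_moveLoop2 d (Runs.loop_false rfl))).mono (by omega)

/-- Moves the first auxiliary stack to the main stack. -/
def back1 : StackProg E :=
  .loop (.inl .tmp1) Option.isSome (.ite (.inl .tmp1) topTrue
    (.seq popTmp1 (pMain true)) (.seq popTmp1 (pMain false)))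

/-- Moves the second auxiliary stack to the main stack. -/
def back2 : StackProg E :=
  .loop (.inl .tmp2) Option.isSome (.ite (.inl .tmp2) topTrue
    (.seq popTmp2 (pMain true)) (.seq popTmp2 (pMain false)))

/-- Moves the second auxiliary stack to the first one. -/
def back21 : StackProg E :=
  .loop (.inl .tmp2) Option.isSome (.ite (.inl .tmp2) topTrue
    (.seq popTmp2 (pTmp1 true)) (.seq popTmp2 (pTmp1 false)))

/-- Moves the first auxiliary stack to the main stack and to the second auxiliary stack. -/
def fork1 : StackProg E :=
  .loop (.inl .tmp1) Option.isSome (.ite (.inl .tmp1) topTrue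
    (.seq popTmp1 (.seq (pMain true) (pTmp2 true)))
    (.seq popTmp1 (.seq (pMain false) (pTmp2 false))))

/-- Empties the first auxiliary stack. -/
def clear1 : StackProg E := .loop (.inl .tmp1) Option.isSome popTmp1

theorem runs_back1 (w : List Bool) : ∀ {m b c : List Bool},
    Runs (back1 : StackProg E) (st m w b c) (st (w.reverse ++ m) [] b c) (4 * w.length + 1) := by
  induction w with
  | nil => intro m b c; exact Runs.loop_false rfl
  | cons x w ih =>
    intro m b c
    cases x
    · refine (Runs.loop_true rfl (Runs.ite_false rfl (runs_popTmp1.seq runs_pMain)) ?_).mono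
        (t := 4 + (4 * w.length + 1)) (by simp; omega)
      show Runs back1 _ _ _
      simpa using ih (m := false :: m)
    · refine (Runs.loop_true rfl (Runs.ite_true rfl (runs_popTmp1.seq runs_pMain)) ?_).mono
        (t := 4 + (4 * w.length + 1)) (by simp; omega)
      show Runs back1 _ _ _
      simpa using ih (m := true :: m)

theorem runs_back2 (w : List Bool) : ∀ {m a c : List Bool},
    Runs (back2 : StackProg E) (st m a w c) (st (w.reverse ++ m) a [] c) (4 * w.length + 1) := by
  induction w with
  | nil => intro m b c; exact Runs.loop_false rfl
  | cons x w ih =>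
    intro m b c
    cases x
    · refine (Runs.loop_true rfl (Runs.ite_false rfl (runs_popTmp2.seq runs_pMain)) ?_).mono
        (t := 4 + (4 * w.length + 1)) (by simp; omega)
      show Runs back2 _ _ _
      simpa using ih (m := false :: m)
    · refine (Runs.loop_true rfl (Runs.ite_true rfl (runs_popTmp2.seq runs_pMain)) ?_).mono
        (t := 4 + (4 * w.length + 1)) (by simp; omega)
      show Runs back2 _ _ _
      simpa using ih (m := true :: m)

theorem runs_back21 (w : List Bool) : ∀ {m a c : List Bool},
    Runs (back21 : StackProg E) (st m a w c) (st m (w.reverse ++ a) [] c) (4 * w.length + 1) := by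
  induction w with
  | nil => intro m b c; exact Runs.loop_false rfl
  | cons x w ih =>
    intro m b c
    cases x
    · refine (Runs.loop_true rfl (Runs.ite_false rfl (runs_popTmp2.seq runs_pTmp1)) ?_).mono
        (t := 4 + (4 * w.length + 1)) (by simp; omega)
      show Runs back21 _ _ _
      simpa using ih (a := false :: b)
    · refine (Runs.loop_true rfl (Runs.ite_true rfl (runs_popTmp2.seq runs_pTmp1)) ?_).mono
        (t := 4 + (4 * w.length + 1)) (by simp; omega)
      show Runs back21 _ _ _
      simpa using ih (a := true :: b)

theorem runs_fork1 (w : List Bool) : ∀ {m b c : List Bool},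
    Runs (fork1 : StackProg E) (st m w b c) (st (w.reverse ++ m) [] (w.reverse ++ b) c)
      (5 * w.length + 1) := by
  induction w with
  | nil => intro m b c; exact Runs.loop_false rfl
  | cons x w ih =>
    intro m b c
    cases x
    · refine (Runs.loop_true rfl (Runs.ite_false rfl
        (runs_popTmp1.seq (runs_pMain.seq runs_pTmp2))) ?_).mono
        (t := 5 + (5 * w.length + 1)) (by simp; omega)
      show Runs fork1 _ _ _
      simpa using ih (m := false :: m) (b := false :: b)
    · refine (Runs.loop_true rfl (Runs.ite_true rfl
        (runs_popTmp1.seq (runs_pMain.seq runs_pTmp2))) ?_).mono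
        (t := 5 + (5 * w.length + 1)) (by simp; omega)
      show Runs fork1 _ _ _
      simpa using ih (m := true :: m) (b := true :: b)

theorem runs_clear1 (w : List Bool) : ∀ {m b c : List Bool},
    Runs (clear1 : StackProg E) (st m w b c) (st m [] b c) (2 * w.length + 1) := by
  induction w with
  | nil => intro m b c; exact Runs.loop_false rfl
  | cons x w ih =>
    intro m b c
    exact (Runs.loop_true rfl runs_popTmp1 ih).mono (by simp; omega)

/-- Duplicates the top value. -/
def dup : StackProg E := .seq move1 (.seq fork1 (.seq back21 back1))

/-- Exchanges the two top values. -/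
def swap : StackProg E := .seq move1 (.seq move2 (.seq back1 back2))

/-- Removes the top value. -/
def drop : StackProg E := .seq move1 clear1

theorem runs_dup (d : BinTree) (r : List Bool) :
    Runs (dup : StackProg E) (base (d.word ++ r)) (base (d.word ++ (d.word ++ r)))
      (18 * d.word.length + 5) := by
  have h1 := runs_move1 (E := E) d (r := r) (a := []) (b := [])
  have h2 := runs_fork1 (E := E) (d.word.reverse ++ []) (m := r) (b := []) (c := [])
  have h3 := runs_back21 (E := E) d.word (m := d.word ++ r) (a := []) (c := [])
  have h4 := runs_back1 (E := E) (d.word.reverse ++ []) (m := d.word ++ r) (b := []) (c := [])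
  simp only [List.append_nil, List.reverse_reverse] at h1 h2 h3 h4
  exact (h1.seq (h2.seq (h3.seq h4))).mono (by simp; omega)

theorem runs_swap (d e : BinTree) (r : List Bool) :
    Runs (swap : StackProg E) (base (d.word ++ (e.word ++ r))) (base (e.word ++ (d.word ++ r)))
      (9 * d.word.length + 9 * e.word.length + 6) := by
  have h1 := runs_move1 (E := E) d (r := e.word ++ r) (a := []) (b := [])
  have h2 := runs_move2 (E := E) e (r := r) (a := d.word.reverse) (b := [])
  have h3 := runs_back1 (E := E) d.word.reverse (m := r) (b := e.word.reverse) (c := [])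
  have h4 := runs_back2 (E := E) e.word.reverse (m := d.word ++ r) (a := []) (c := [])
  simp only [List.append_nil, List.reverse_reverse] at h1 h2 h3 h4
  exact (h1.seq (h2.seq (h3.seq h4))).mono (by simp; omega)

theorem runs_drop (d : BinTree) (r : List Bool) :
    Runs (drop : StackProg E) (base (d.word ++ r)) (base r) (7 * d.word.length + 3) := by
  have h1 := runs_move1 (E := E) d (r := r) (a := []) (b := [])
  have h2 := runs_clear1 (E := E) d.word.reverse (m := r) (b := []) (c := [])
  simp only [List.append_nil] at h1 h2
  exact (h1.seq h2).mono (by simp; omega)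

/-- Pushes a fixed word on the main stack. -/
def pushWord : List Bool → StackProg E
  | [] => .skip
  | x :: w => .seq (pushWord w) (pMain x)

theorem runs_pushWord (w m : List Bool) :
    Runs (pushWord w : StackProg E) (base m) (base (w ++ m)) (w.length + 1) := by
  induction w with
  | nil => exact Runs.skip
  | cons x w ih => exact ih.seq runs_pMain

end StackProg

/-! ## Functions computed by stack programs in polynomial time -/

/-- An encoding of a type by binary trees. -/
class TreeEnc (α : Type) where
  enc : α → BinTree

namespace TreeEnc

/-- The word that represents a value on a stack. -/
def tw {α : Type} [TreeEnc α] (a : α) : List Bool := (enc a).word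

/-- The size of a value. -/
def size {α : Type} [TreeEnc α] (a : α) : ℕ := (tw a).length

instance {α β : Type} [TreeEnc α] [TreeEnc β] : TreeEnc (α × β) :=
  ⟨fun p => .node (enc p.1) (enc p.2)⟩

/-- Lists as iterated pairs. -/
def encTreeList {α : Type} [TreeEnc α] : List α → BinTree
  | [] => .leaf
  | a :: l => .node (enc a) (encTreeList l)

instance {α : Type} [TreeEnc α] : TreeEnc (List α) := ⟨encTreeList⟩

instance {α β : Type} [TreeEnc α] [TreeEnc β] : TreeEnc (α ⊕ β) :=
  ⟨Sum.elim (fun a => .node .leaf (enc a)) (fun b => .node (.node .leaf .leaf) (enc b))⟩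

instance : TreeEnc Unit := ⟨fun _ => .leaf⟩

/-- Unary numerals. -/
def unary : ℕ → BinTree
  | 0 => .leaf
  | n + 1 => .node .leaf (unary n)

end TreeEnc

/-- A finite alphabet with a list of its letters. -/
class FinLetters (Γ : Type) [DecidableEq Γ] where
  letters : List Γ
  mem_letters : ∀ a, a ∈ letters

instance : FinLetters Bool := ⟨[false, true], by simp⟩
instance : FinLetters Letter := ⟨[.b0, .b1, .lp, .rp], fun a => by cases a <;> simp⟩
instance {Γ : Type} [DecidableEq Γ] [FinLetters Γ] : FinLetters (Option Γ) :=
  ⟨none :: (FinLetters.letters (Γ := Γ)).map some, fun a => by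
    cases a <;> simp [FinLetters.mem_letters]⟩

instance (priority := low) {Γ : Type} [DecidableEq Γ] [FinLetters Γ] : TreeEnc Γ :=
  ⟨fun a => TreeEnc.unary (FinLetters.letters.idxOf a)⟩

open TreeEnc StackProg

section

variable {α β : Type} [TreeEnc α] [TreeEnc β]

theorem tw_pair (a : α) (b : β) : tw (a, b) = true :: (tw a ++ tw b) := rfl
theorem tw_cons (a : α) (l : List α) : tw (a :: l) = true :: (tw a ++ tw l) := rfl
theorem tw_inl (a : α) : tw (Sum.inl a : α ⊕ β) = true :: false :: tw a := rfl
theorem tw_inr (b : β) : tw (Sum.inr b : α ⊕ β) = true :: true :: false :: false :: tw b := rfl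

theorem size_pair (a : α) (b : β) : size (a, b) = size a + size b + 1 := by
  simp [size, tw_pair]
theorem size_nil : size ([] : List α) = 1 := rfl
theorem size_cons (a : α) (l : List α) : size (a :: l) = size a + size l + 1 := by
  simp [size, tw_cons]
theorem size_inl (a : α) : size (Sum.inl a : α ⊕ β) = size a + 2 := by simp [size, tw_inl]
theorem size_inr (b : β) : size (Sum.inr b : α ⊕ β) = size b + 4 := by simp [size, tw_inr]
theorem size_pos (a : α) : 0 < size a := by
  unfold size tw; cases TreeEnc.enc a <;> simp [BinTree.word]

end

theorem Polynomial.eval_nat_mono (p : Polynomial ℕ) {m n : ℕ} (h : m ≤ n) : p.eval m ≤ p.eval n := by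
  simp only [Polynomial.eval_eq_sum, Polynomial.sum]
  exact Finset.sum_le_sum fun i _ => Nat.mul_le_mul_left _ (Nat.pow_le_pow_left h i)

/-- `f` is computed in polynomial time by a stack program on the stacks of `E`. -/
structure PT (E : StackEnv) {α β : Type} [TreeEnc α] [TreeEnc β] (f : α → β) : Prop where
  -- The remainder `r` of the stack is arbitrary, so saved data can lie below the argument.
  exists_prog : ∃ (p : StackProg E) (T : Polynomial ℕ), ∀ a r,
    Runs p (base (tw a ++ r)) (base (tw (f a) ++ r)) (T.eval (size a))

namespace PT

variable {E : StackEnv} {α β γ δ : Type} [TreeEnc α] [TreeEnc β] [TreeEnc γ] [TreeEnc δ]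

/-- A program pushes at most one letter per step on the main stack, so the running time bounds the
size of the result. This keeps compositions polynomial. -/
theorem size_le {f : α → β} (hf : PT E f) : ∃ q : Polynomial ℕ, ∀ a, size (f a) ≤ q.eval (size a) := by
  obtain ⟨p, T, h⟩ := hf
  refine ⟨T + .X, fun a => ?_⟩
  obtain ⟨t, ht, h⟩ := h a []
  have := h.length_le .main
  simp only [StackProg.st, StackEnv.join, List.append_nil] at this
  simp only [Polynomial.eval_add, Polynomial.eval_X]
  unfold size at *
  omega

/-- Programs see values only through their trees, so a change of type that preserves the tree costs
nothing. -/
theorem of_enc_eq {f : α → β} (h : ∀ a, TreeEnc.enc (f a) = TreeEnc.enc a) : PT E f := by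
  refine ⟨.skip, 1, fun a r => ?_⟩
  have : tw (f a) = tw a := by unfold tw; rw [h]
  rw [this]
  simpa using Runs.skip

theorem id : PT E (fun a : α => a) := of_enc_eq fun _ => rfl

theorem comp {g : β → γ} {f : α → β} (hg : PT E g) (hf : PT E f) : PT E (fun a => g (f a)) := by
  obtain ⟨q, hq⟩ := hf.size_le
  obtain ⟨p, T, h⟩ := hf
  obtain ⟨p', T', h'⟩ := hg
  refine ⟨.seq p p', T + T'.comp q, fun a r => ?_⟩
  refine ((h a r).seq (h' (f a) r)).mono ?_
  simp only [Polynomial.eval_add, Polynomial.eval_comp]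
  gcongr
  exact Polynomial.eval_nat_mono _ (hq a)

theorem const (b : β) : PT E (fun _ : α => b) := by
  refine ⟨.seq drop (pushWord (tw b)), 7 * .X + .C (size b + 4), fun a r => ?_⟩
  refine ((runs_drop (enc a) r).seq (runs_pushWord (tw b) r)).mono ?_
  simp only [Polynomial.eval_add, Polynomial.eval_mul, Polynomial.eval_X, Polynomial.eval_C,
    Polynomial.eval_ofNat, size, tw]
  omega

theorem pair {f : α → β} {g : α → γ} (hf : PT E f) (hg : PT E g) : PT E (fun a => (f a, g a)) := by
  obtain ⟨q, hq⟩ := hf.size_le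
  obtain ⟨q', hq'⟩ := hg.size_le
  obtain ⟨p, T, h⟩ := hf
  obtain ⟨p', T', h'⟩ := hg
  refine ⟨.seq dup (.seq p (.seq swap (.seq p' (.seq swap (pMain true))))),
    T + T' + 18 * q + 9 * q' + 27 * .X + 18, fun a r => ?_⟩
  have h1 := runs_dup (E := E) (enc a) r
  have h2 := h a (tw a ++ r)
  have h3 := runs_swap (E := E) (enc (f a)) (enc a) r
  have h4 := h' a (tw (f a) ++ r)
  have h5 := runs_swap (E := E) (enc (g a)) (enc (f a)) r
  have h6 := runs_pMain (E := E) (m := tw (f a) ++ (tw (g a) ++ r)) (a := []) (b := []) (c := [])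
    (x := true)
  have := h1.seq (h2.seq (h3.seq (h4.seq (h5.seq h6))))
  rw [tw_pair, List.cons_append, List.append_assoc]
  refine this.mono ?_
  have e1 := hq a
  have e2 := hq' a
  simp only [Polynomial.eval_add, Polynomial.eval_mul, Polynomial.eval_X, Polynomial.eval_ofNat]
  unfold size tw at *
  omega

theorem fst : PT E (fun p : α × β => p.1) := by
  refine ⟨.seq popMain (.seq swap drop), 16 * .X + 20, fun ⟨a, b⟩ r => ?_⟩
  rw [tw_pair, List.cons_append, List.append_assoc]
  refine (runs_popMain.seq ((runs_swap (enc a) (enc b) r).seq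
    (runs_drop (enc b) (tw a ++ r)))).mono ?_
  simp only [Polynomial.eval_add, Polynomial.eval_mul, Polynomial.eval_X, Polynomial.eval_ofNat,
    size_pair]
  unfold size tw
  omega

theorem snd : PT E (fun p : α × β => p.2) := by
  refine ⟨.seq popMain drop, 7 * .X + 20, fun ⟨a, b⟩ r => ?_⟩
  rw [tw_pair, List.cons_append, List.append_assoc]
  refine (runs_popMain.seq (runs_drop (enc a) (tw b ++ r))).mono ?_
  simp only [Polynomial.eval_add, Polynomial.eval_mul, Polynomial.eval_X, Polynomial.eval_ofNat,
    size_pair]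
  unfold size tw
  omega

/-- Case distinction on a list. -/
theorem listCases {f : List α × γ → δ} (hnil : PT E fun c => f ([], c))
    (hcons : PT E fun p : (α × List α) × γ => f (p.1.1 :: p.1.2, p.2)) : PT E f := by
  obtain ⟨p, T, h⟩ := hnil
  obtain ⟨p', T', h'⟩ := hcons
  -- Without the letter of the pair, the top letter is that of the list, which is `true` for a cons
  -- cell. Pushing `true` once more then yields the word of `((a, l), c)` without any copying.
  refine ⟨.seq popMain (.ite (.inl .main) topTrue (.seq (pMain true) p') (.seq popMain p)),
    T + T' + 10, fun ⟨l, c⟩ r => ?_⟩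
  rw [tw_pair, List.cons_append, List.append_assoc]
  cases l with
  | nil =>
    refine (runs_popMain.seq (Runs.ite_false rfl (runs_popMain.seq (h c r)))).mono ?_
    have := Polynomial.eval_nat_mono T (m := size c) (n := size (([] : List α), c))
      (by rw [size_pair]; omega)
    simp only [Polynomial.eval_add, Polynomial.eval_ofNat]
    omega
  | cons a l =>
    have h3 := h' ((a, l), c) r
    simp only [tw_pair, List.cons_append, List.append_assoc] at h3
    simp only [tw_cons, List.cons_append, List.append_assoc]
    refine (runs_popMain.seq (Runs.ite_true rfl (runs_pMain.seq h3))).mono ?_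
    have : size ((a, l), c) = size ((a :: l), c) := by simp [size_pair, size_cons]
    rw [this]
    simp only [Polynomial.eval_add, Polynomial.eval_ofNat]
    omega

/-- Case distinction on a sum. -/
theorem sumCases {f : (α ⊕ β) × γ → δ} (hl : PT E fun p : α × γ => f (.inl p.1, p.2))
    (hr : PT E fun p : β × γ => f (.inr p.1, p.2)) : PT E f := by
  obtain ⟨p, T, h⟩ := hl
  obtain ⟨p', T', h'⟩ := hr
  refine ⟨.seq popMain (.seq popMain (.ite (.inl .main) topTrue
    (.seq popMain (.seq popMain (.seq popMain (.seq (pMain true) p'))))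
    (.seq popMain (.seq (pMain true) p)))),
    T + T' + 10, fun ⟨l, c⟩ r => ?_⟩
  rw [tw_pair, List.cons_append, List.append_assoc]
  cases l with
  | inl a =>
    have h3 := h (a, c) r
    simp only [tw_pair, List.cons_append, List.append_assoc] at h3
    refine (runs_popMain.seq (runs_popMain.seq (Runs.ite_false rfl
      (runs_popMain.seq (runs_pMain.seq h3))))).mono ?_
    have := Polynomial.eval_nat_mono T (m := size (a, c)) (n := size ((Sum.inl a : α ⊕ β), c))
      (by rw [size_pair, size_pair, size_inl]; omega)
    simp only [Polynomial.eval_add, Polynomial.eval_ofNat]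
    omega
  | inr a =>
    have h3 := h' (a, c) r
    simp only [tw_pair, List.cons_append, List.append_assoc] at h3
    refine (runs_popMain.seq (runs_popMain.seq (Runs.ite_true rfl
      (runs_popMain.seq (runs_popMain.seq (runs_popMain.seq (runs_pMain.seq h3))))))).mono ?_
    have := Polynomial.eval_nat_mono T' (m := size (a, c)) (n := size ((Sum.inr a : α ⊕ β), c))
      (by rw [size_pair, size_pair, size_inr]; omega)
    simp only [Polynomial.eval_add, Polynomial.eval_ofNat]
    omega

/-- The letter is a unary numeral, so each case that is passed over costs one test and two pops. -/
theorem unary_cases (ps : List (γ → δ)) (hps : ∀ f ∈ ps, PT E f) :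
    ∃ (p : StackProg E) (T : Polynomial ℕ), ∀ i (hi : i < ps.length) c r,
      Runs p (base ((unary i).word ++ (tw c ++ r))) (base (tw (ps[i] c) ++ r))
        (T.eval (size c)) := by
  induction ps with
  | nil => exact ⟨.skip, 0, fun i hi => by simp at hi⟩
  | cons f ps ih =>
    obtain ⟨p, T, h⟩ := hps f (by simp)
    obtain ⟨p', T', h'⟩ := ih fun g hg => hps g (by simp [hg])
    refine ⟨.ite (.inl .main) topTrue (.seq popMain (.seq popMain p')) (.seq popMain p),
      T + T' + 3, fun i hi c r => ?_⟩
    simp only [Polynomial.eval_add, Polynomial.eval_ofNat]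
    cases i with
    | zero =>
      exact (Runs.ite_false rfl (runs_popMain.seq (h c r))).mono (by omega)
    | succ i =>
      exact (Runs.ite_true rfl (runs_popMain.seq (runs_popMain.seq
        (h' i (by simpa using hi) c r)))).mono (by omega)

/-- Case distinction on a letter of a finite alphabet. -/
theorem finCases {Γ : Type} [DecidableEq Γ] [FinLetters Γ] {f : Γ × γ → δ}
    (h : ∀ a, PT E fun c => f (a, c)) : PT E f := by
  obtain ⟨p, T, hp⟩ := unary_cases (E := E)
    ((FinLetters.letters (Γ := Γ)).map fun a c => f (a, c)) (by
      intro g hg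
      obtain ⟨a, -, rfl⟩ := List.mem_map.1 hg
      exact h a)
  refine ⟨.seq popMain p, T + 1, fun ⟨a, c⟩ r => ?_⟩
  have hi : (FinLetters.letters (Γ := Γ)).idxOf a < (FinLetters.letters (Γ := Γ)).length :=
    List.idxOf_lt_length_of_mem (FinLetters.mem_letters a)
  have h1 := hp ((FinLetters.letters (Γ := Γ)).idxOf a) (by simpa using hi) c r
  simp only [List.getElem_map, List.getElem_idxOf] at h1
  rw [tw_pair, List.cons_append, List.append_assoc]
  refine (runs_popMain.seq h1).mono ?_
  have := Polynomial.eval_nat_mono T (m := size c) (n := size (a, c)) (by rw [size_pair]; omega)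
  simp only [Polynomial.eval_add, Polynomial.eval_one]
  omega

/-! ### Iteration along lists. -/

theorem size_le_list_append (l l' : List α) : size (l ++ l') + 1 = size l + size l' := by
  induction l with
  | nil => simp [size_nil]; omega
  | cons a l ih => simp only [List.cons_append, size_cons]; omega

theorem length_lt_size (l : List α) : l.length < size l := by
  induction l with
  | nil => simp [size_nil]
  | cons a l ih => simp only [List.length_cons, size_cons]; omega

/-- Iteration along a list, with a polynomial bound on the size of the intermediate results. -/
theorem foldl_aux {step : γ → β → α → β}
    (hstep : PT E fun p : (γ × β) × α => step p.1.1 p.1.2 p.2) :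
    ∃ (p : StackProg E) (T : Polynomial ℕ), ∀ (B : ℕ) (l : List α) c b r,
      (∀ l', l' <+: l → size (l'.foldl (step c) b) ≤ B) →
      Runs p (base (tw (l, (c, b)) ++ r)) (base (tw (([] : List α), (c, l.foldl (step c) b)) ++ r))
        (T.eval (size l + size c + B)) := by
  -- The body has to be a total function, although the loop runs it on nonempty lists only.
  have hbody : PT E fun p : List α × (γ × β) =>
      (match p.1 with | [] => p | a :: l => (l, (p.2.1, step p.2.1 p.2.2 a)) : List α × (γ × β)) := by
    apply listCases
    · exact (const []).pair id
    · refine (snd.comp fst).pair ((fst.comp snd).pair (hstep.comp (snd.pair (fst.comp fst))))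
  obtain ⟨p, T, hp⟩ := hbody
  -- The loop has to see the first letter of the remaining list, so the letter of the surrounding
  -- pair is kept off the stack and restored only for the body.
  refine ⟨.seq popMain (.seq (.loop (.inl .main) topTrue (.seq (pMain true) (.seq p popMain)))
    (pMain true)), (.X + 1) * (T.comp (.X + 2) + 3) + 3, fun B l c b r hB => ?_⟩
  have key : ∀ (l : List α) (b : β) (n : ℕ), (∀ l', l' <+: l → size (l'.foldl (step c) b) ≤ B) →
      size l + size c + B ≤ n →
      Runs (.loop (.inl .main) topTrue (.seq (pMain true) (.seq p popMain)))
        (base (tw l ++ (tw (c, b) ++ r)))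
        (base (tw ([] : List α) ++ (tw (c, l.foldl (step c) b) ++ r)))
        (l.length * (T.eval (n + 2) + 3) + 1) := by
    intro l
    induction l with
    | nil => intro b n _ _; exact (Runs.loop_false rfl).mono (by simp)
    | cons a l ih =>
      intro b n hB hn
      have h1 : Runs p (base (true :: (tw (a :: l) ++ (tw (c, b) ++ r))))
          (base (true :: (tw l ++ (tw (c, step c b a) ++ r))))
          (T.eval (size (a :: l, (c, b)))) := by
        have := hp (a :: l, (c, b)) r
        dsimp only at this
        rwa [tw_pair (a :: l), tw_pair l, List.cons_append, List.append_assoc, List.cons_append,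
          List.append_assoc] at this
      have h2 := ih (step c b a) n (fun l' hl' => hB (a :: l') (by simpa using hl'))
        (by rw [size_cons] at hn; omega)
      have hb : size b ≤ B := hB [] (List.nil_prefix)
      have hs : size (a :: l, (c, b)) ≤ n + 2 := by
        rw [size_pair, size_pair]; omega
      have h3 := Polynomial.eval_nat_mono T hs
      have h0 : topTrue (((base (tw (a :: l) ++ (tw (c, b) ++ r)) : E.State)
        (.inl .main)).head?) = true := rfl
      have h4 := Runs.loop_true (k := .inl .main) (f := topTrue) h0 (runs_pMain.seq (h1.seq runs_popMain)) h2
      refine h4.mono ?_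
      simp only [List.length_cons, add_mul]
      omega
  rw [tw_pair, List.cons_append, List.append_assoc]
  refine (runs_popMain.seq ((key l b _ hB le_rfl).seq runs_pMain)).mono ?_
  have hl := length_lt_size l
  simp only [Polynomial.eval_add, Polynomial.eval_mul, Polynomial.eval_comp, Polynomial.eval_X,
    Polynomial.eval_ofNat, Polynomial.eval_one]
  set A := Polynomial.eval (size l + size c + B + 2) T + 3
  have : l.length * A ≤ (size l + size c + B + 1) * A := Nat.mul_le_mul_right _ (by omega)
  omega

/-- A polynomial-time step alone would not do: iterating it could square the size each time. Hence
the bound on all intermediate results. -/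
theorem foldl {l : γ → List α} {init : γ → β} {step : γ → β → α → β} (hl : PT E l)
    (hinit : PT E init) (hstep : PT E fun p : (γ × β) × α => step p.1.1 p.1.2 p.2)
    (q : Polynomial ℕ)
    (hq : ∀ c l', l' <+: l c → size (l'.foldl (step c) (init c)) ≤ q.eval (size c)) :
    PT E fun c => (l c).foldl (step c) (init c) := by
  obtain ⟨p, T, hp⟩ := foldl_aux hstep
  obtain ⟨ql, hql⟩ := hl.size_le
  have hpre : PT E fun c => (l c, (c, init c)) := hl.pair (id.pair hinit)
  obtain ⟨p₀, T₀, h₀⟩ := hpre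
  have hloop : PT E fun c => (([] : List α), (c, (l c).foldl (step c) (init c))) := by
    refine ⟨.seq p₀ p, T₀ + T.comp (ql + .X + q), fun c r => ?_⟩
    refine ((h₀ c r).seq (hp _ _ _ _ r (hq c))).mono ?_
    simp only [Polynomial.eval_add, Polynomial.eval_comp, Polynomial.eval_X]
    gcongr
    apply Polynomial.eval_nat_mono
    have := hql c
    omega
  exact (snd.comp snd).comp hloop

/-- Iteration along a list where each step adds a polynomially bounded amount of data. -/
theorem foldl_of_growth {l : γ → List α} {init : γ → β} {step : γ → β → α → β} (hl : PT E l)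
    (hinit : PT E init) (hstep : PT E fun p : (γ × β) × α => step p.1.1 p.1.2 p.2)
    (q : Polynomial ℕ)
    (hq : ∀ c b, ∀ a ∈ l c, size (step c b a) ≤ size b + q.eval (size c)) :
    PT E fun c => (l c).foldl (step c) (init c) := by
  obtain ⟨ql, hql⟩ := hl.size_le
  obtain ⟨qi, hqi⟩ := hinit.size_le
  refine foldl hl hinit hstep (qi + ql * q) fun c l' hl' => ?_
  have key : ∀ (l' : List α) (b : β), (∀ a ∈ l', a ∈ l c) →
      size (l'.foldl (step c) b) ≤ size b + l'.length * q.eval (size c) := by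
    intro l'
    induction l' with
    | nil => intro b _; simp
    | cons a l' ih =>
      intro b hl'
      have h1 := ih (step c b a) fun x hx => hl' x (by simp [hx])
      have h2 := hq c b a (hl' a (by simp))
      simp only [List.foldl_cons, List.length_cons, add_mul]
      omega
  have h1 := key l' (init c) fun a ha => hl'.subset ha
  have h2 : l'.length * q.eval (size c) ≤ ql.eval (size c) * q.eval (size c) := by
    have := hl'.length_le
    have := length_lt_size (l c)
    have := hql c
    gcongr
    omega
  have := hqi c
  simp only [Polynomial.eval_add, Polynomial.eval_mul]
  omega

end PT

theorem size_le_of_mem {α : Type} [TreeEnc α] {l : List α} {a : α} (h : a ∈ l) :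
    size a ≤ size l := by
  induction l with
  | nil => simp at h
  | cons b l ih =>
    rw [size_cons]
    rcases List.mem_cons.1 h with rfl | h
    · omega
    · have := ih h; omega

theorem PT.reverse {E : StackEnv} {α γ : Type} [TreeEnc α] [TreeEnc γ] {f : γ → List α}
    (hf : PT E f) : PT E fun c => (f c).reverse := by
  suffices h : PT E fun l : List α => l.reverse from h.comp hf
  have : PT E fun l : List α => l.foldl (fun acc a => a :: acc) [] := by
    refine foldl_of_growth (step := fun _ acc a => a :: acc) id (const []) ?_ (.X + 1) ?_
    · exact (of_enc_eq (f := fun p : α × List α => p.1 :: p.2) fun _ => rfl).comp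
        (snd.pair (snd.comp fst))
    · intro c b a ha
      have := size_le_of_mem ha
      simp only [size_cons, Polynomial.eval_add, Polynomial.eval_X, Polynomial.eval_one]
      omega
  simpa using this

theorem size_letter_le {Γ : Type} [DecidableEq Γ] [FinLetters Γ] (a : Γ) :
    size a ≤ 2 * (FinLetters.letters (Γ := Γ)).length + 1 := by
  have h : ∀ n, (unary n).word.length = 2 * n + 1 := by
    intro n
    induction n with
    | zero => rfl
    | succ n ih => simp [unary, BinTree.word, ih]; omega
  have h2 := List.idxOf_lt_length_of_mem (FinLetters.mem_letters a)
  have h3 : size a = 2 * (FinLetters.letters.idxOf a) + 1 := h _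
  omega

theorem size_word_le {Γ : Type} [DecidableEq Γ] [FinLetters Γ] (w : List Γ) :
    size w ≤ w.length * (2 * (FinLetters.letters (Γ := Γ)).length + 2) + 1 := by
  induction w with
  | nil => simp [size_nil]
  | cons a w ih =>
    have := size_letter_le a
    rw [size_cons, List.length_cons, add_mul]
    omega

/-! ### Transfer between words on a stack and lists on the main stack. -/

namespace StackProg

variable {E : StackEnv} {Γ : Type} [DecidableEq Γ] [FinLetters Γ]

/-- A state with new contents of the stack `k` and of the main stack. -/
def set2 (S : E.State) (k : E.K) (w : List (E.Γ k)) (m : List Bool) : E.State :=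
  Function.update (Function.update S k w) (.inl .main) m

section

variable {S : E.State} {k : E.K} {w : List (E.Γ k)} {m : List Bool}

theorem set2_main : set2 S k w m (.inl .main) = m := by simp [set2]

theorem set2_self (hk : k ≠ .inl .main) : set2 S k w m k = w := by
  unfold set2
  rw [Function.update_of_ne hk, Function.update_self]

theorem update_set2_main (m' : List Bool) :
    Function.update (set2 S k w m) (.inl .main) m' = set2 S k w m' := by
  simp [set2]

theorem update_set2_self (hk : k ≠ .inl .main) (w' : List (E.Γ k)) :
    Function.update (set2 S k w m) k w' = set2 S k w' m := by
  unfold set2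
  rw [Function.update_comm hk.symm, Function.update_idem]

theorem runs_set2_pMain {x : Bool} : Runs (pMain x) (set2 S k w m) (set2 S k w (x :: m)) 1 := by
  have := Runs.push (S := set2 S k w m) (k := .inl .main) (a := x)
  rwa [update_set2_main, set2_main] at this

theorem runs_set2_popMain {x : Bool} : Runs popMain (set2 S k w (x :: m)) (set2 S k w m) 1 := by
  have := Runs.pop (S := set2 S k w (x :: m)) (k := .inl .main)
  rwa [update_set2_main, set2_main] at this

theorem runs_set2_push (hk : k ≠ .inl .main) {x : E.Γ k} :
    Runs (.push k x) (set2 S k w m) (set2 S k (x :: w) m) 1 := by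
  have := Runs.push (S := set2 S k w m) (k := k) (a := x)
  rwa [update_set2_self hk, set2_self hk] at this

theorem runs_set2_pop (hk : k ≠ .inl .main) {x : E.Γ k} :
    Runs (.pop k) (set2 S k (x :: w) m) (set2 S k w m) 1 := by
  have := Runs.pop (S := set2 S k (x :: w) m) (k := k)
  rwa [update_set2_self hk, set2_self hk] at this

theorem runs_set2_pushWord (u : List Bool) :
    Runs (pushWord u) (set2 S k w m) (set2 S k w (u ++ m)) (u.length + 1) := by
  induction u with
  | nil => exact Runs.skip
  | cons x u ih => exact ih.seq runs_set2_pMain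

end

/-- Moves one letter from the stack `k` to the list on top of the main stack. -/
def loadCase (k : E.K) (e : E.Γ k ≃ Γ) : List Γ → StackProg E
  | [] => .skip
  | a :: as => .ite k (fun o => decide (o.map e = some a))
      (.seq (.pop k) (pushWord (true :: tw a))) (loadCase k e as)

/-- Moves the stack `k` to the main stack, as a reversed list. -/
def load (k : E.K) (e : E.Γ k ≃ Γ) : StackProg E :=
  .seq (pMain false) (.loop k Option.isSome (loadCase k e FinLetters.letters))

/-- Moves one letter from the main stack to the stack `k`. -/
def storeCase (k : E.K) (e : E.Γ k ≃ Γ) : List Γ → StackProg E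
  | [] => .skip
  | a :: as => .ite (.inl .main) topTrue (.seq popMain (.seq popMain (storeCase k e as)))
      (.seq popMain (.push k (e.symm a)))

/-- Moves the list on top of the main stack to the stack `k`, reversing it. -/
def store (k : E.K) (e : E.Γ k ≃ Γ) : StackProg E :=
  .seq (.loop (.inl .main) topTrue (.seq popMain (storeCase k e FinLetters.letters))) popMain

set_option linter.unusedSectionVars false

variable {S : E.State} {k : E.K} (e : E.Γ k ≃ Γ)

theorem runs_loadCase (hk : k ≠ .inl .main) (x : E.Γ k) (w : List (E.Γ k)) (m : List Bool) (L : List Γ) (hL : e x ∈ L) :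
    Runs (loadCase k e L) (set2 S k (x :: w) m) (set2 S k w (true :: (tw (e x) ++ m)))
      (L.length + size (e x) + 3) := by
  induction L with
  | nil => simp at hL
  | cons a as ih =>
    by_cases ha : e x = a
    · subst ha
      have h1 := (runs_set2_pop (S := S) hk (x := x) (w := w) (m := m)).seq
        (runs_set2_pushWord (true :: tw (e x)))
      refine (Runs.ite_true ?_ h1).mono ?_
      · rw [set2_self hk]; simp
      · simp [size]; omega
    · have h1 := ih (by
        rcases List.mem_cons.1 hL with h | h
        · exact absurd h ha
        · exact h)
      refine (Runs.ite_false ?_ h1).mono ?_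
      · rw [set2_self hk]; simp [ha]
      · simp; omega

theorem runs_load (hk : k ≠ .inl .main) (w : List (E.Γ k)) (r : List Bool) :
    Runs (load k e) (set2 S k w r) (set2 S k [] (tw (w.map e).reverse ++ r))
      (w.length * (3 * (FinLetters.letters (Γ := Γ)).length + 10) + 2) := by
  have key : ∀ (w : List (E.Γ k)) (acc : List Γ),
      Runs (.loop k Option.isSome (loadCase k e FinLetters.letters)) (set2 S k w (tw acc ++ r))
        (set2 S k [] (tw ((w.map e).reverse ++ acc) ++ r))
        (w.length * (3 * (FinLetters.letters (Γ := Γ)).length + 10) + 1) := by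
    intro w
    induction w with
    | nil => intro acc; exact (Runs.loop_false (by rw [set2_self hk]; rfl)).mono (by simp)
    | cons x w ih =>
      intro acc
      have h1 := runs_loadCase (S := S) e hk x w (tw acc ++ r) _ (FinLetters.mem_letters (e x))
      have h2 := ih (e x :: acc)
      rw [tw_cons, List.cons_append, List.append_assoc] at h2
      have h3 := Runs.loop_true (k := k) (f := Option.isSome) (by rw [set2_self hk]; rfl) h1 h2
      have h4 := size_letter_le (e x)
      simp only [List.map_cons, List.reverse_cons, List.append_assoc, List.cons_append,
        List.nil_append]
      refine h3.mono ?_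
      rw [List.length_cons, add_mul]
      omega
  have := runs_set2_pMain.seq (key w [])
  rw [List.append_nil] at this
  exact this.mono (by omega)

theorem runs_storeCase (hk : k ≠ .inl .main) (w : List (E.Γ k)) (m : List Bool) (L : List Γ) : ∀ i (hi : i < L.length),
    Runs (storeCase k e L) (set2 S k w ((unary i).word ++ m)) (set2 S k (e.symm L[i] :: w) m)
      (3 * L.length + 3) := by
  induction L with
  | nil => intro i hi; simp at hi
  | cons a as ih =>
    intro i hi
    cases i with
    | zero =>
      refine (Runs.ite_false ?_ (runs_set2_popMain.seq (runs_set2_push hk))).mono (by omega)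
      rw [set2_main]; rfl
    | succ i =>
      have h1 := ih i (by simpa using hi)
      refine (Runs.ite_true ?_ (runs_set2_popMain.seq (runs_set2_popMain.seq h1))).mono
        (by simp; omega)
      rw [set2_main]; rfl

theorem runs_store (hk : k ≠ .inl .main) (l : List Γ) (r : List Bool) :
    Runs (store k e) (set2 S k [] (tw l ++ r)) (set2 S k (l.reverse.map e.symm) r)
      (l.length * (3 * (FinLetters.letters (Γ := Γ)).length + 10) + 2) := by
  have key : ∀ (l : List Γ) (w : List (E.Γ k)),
      Runs (.loop (.inl .main) topTrue (.seq popMain (storeCase k e FinLetters.letters)))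
        (set2 S k w (tw l ++ r)) (set2 S k (l.reverse.map e.symm ++ w) (false :: r))
        (l.length * (3 * (FinLetters.letters (Γ := Γ)).length + 10) + 1) := by
    intro l
    induction l with
    | nil => intro w; exact (Runs.loop_false (by rw [set2_main]; rfl)).mono (by simp)
    | cons a l ih =>
      intro w
      have h1 := runs_storeCase (S := S) e hk w (tw l ++ r) _ _
        (List.idxOf_lt_length_of_mem (FinLetters.mem_letters a))
      simp only [List.getElem_idxOf] at h1
      have h2 := ih (e.symm a :: w)
      rw [tw_cons, List.cons_append, List.append_assoc]
      have h3 := Runs.loop_true (k := .inl .main) (f := topTrue)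
        (S := set2 S k w (true :: (tw a ++ (tw l ++ r)))) (by rw [set2_main]; rfl)
        (runs_set2_popMain.seq h1) h2
      simp only [List.reverse_cons, List.map_append, List.map_cons, List.map_nil,
        List.append_assoc, List.cons_append, List.nil_append]
      refine h3.mono ?_
      rw [List.length_cons, add_mul]
      omega
  have := (key l []).seq runs_set2_popMain
  rw [List.append_nil] at this
  exact this.mono (by omega)

end StackProg

/-! ### Calls of a given machine, and compilation to a Turing machine. -/

theorem initList_stk (tm : FinTM2) (w : List (tm.Γ tm.k₀)) :
    (initList tm w).stk = Function.update (fun _ => []) tm.k₀ w := by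
  funext k
  unfold initList
  by_cases h : k = tm.k₀
  · subst h; simp
  · simp [h]

theorem haltList_stk (tm : FinTM2) (w : List (tm.Γ tm.k₁)) :
    (haltList tm w).stk = Function.update (fun _ => []) tm.k₁ w := by
  funext k
  unfold haltList
  by_cases h : k = tm.k₁
  · subst h; simp
  · simp [h]

theorem TM2Steps.of_outputs {tm : FinTM2} {l : List (tm.Γ tm.k₀)} {l' : List (tm.Γ tm.k₁)} {n : ℕ}
    (h : TM2OutputsInTime tm l (some l') n) : ∃ t ≤ n, TM2Steps tm.m t
      ⟨some tm.main, tm.initialState, Function.update (fun _ => []) tm.k₀ l⟩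
      ⟨none, tm.initialState, Function.update (fun _ => []) tm.k₁ l'⟩ := by
  refine ⟨h.steps, h.steps_le_m, ?_⟩
  have := h.evals_in_steps
  rw [← initList_stk, ← haltList_stk]
  exact this

/-- The number of letters pushed by a statement. -/
def pushCount {K : Type} {Γ : K → Type} {Λ σ : Type} : TM2.Stmt Γ Λ σ → ℕ
  | .push _ _ q => pushCount q + 1
  | .peek _ _ q => pushCount q
  | .pop _ _ q => pushCount q
  | .load _ q => pushCount q
  | .branch _ q₁ q₂ => pushCount q₁ + pushCount q₂
  | .goto _ => 0
  | .halt => 0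

theorem stepAux_length_le {K : Type} [DecidableEq K] {Γ : K → Type} {Λ σ : Type} (k : K)
    (q : TM2.Stmt Γ Λ σ) : ∀ (v : σ) (S : ∀ k, List (Γ k)),
    ((TM2.stepAux q v S).stk k).length ≤ (S k).length + pushCount q := by
  induction q with
  | push k' f q ih =>
    intro v S
    refine (ih _ _).trans ?_
    by_cases h : k = k'
    · subst h; simp only [pushCount, Function.update_self, List.length_cons]; omega
    · simp only [pushCount, Function.update_of_ne h]; omega
  | peek k' f q ih => intro v S; exact ih _ _
  | pop k' f q ih =>
    intro v S
    refine (ih _ _).trans ?_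
    by_cases h : k = k'
    · subst h; simp only [pushCount, Function.update_self, List.length_tail]; omega
    · simp only [pushCount, Function.update_of_ne h]; omega
  | load f q ih => intro v S; exact ih _ _
  | branch f q₁ q₂ ih₁ ih₂ =>
    intro v S
    have h₁ := ih₁ v S
    have h₂ := ih₂ v S
    simp only [TM2.stepAux, pushCount]
    cases f v
    · simp only [cond_false]; omega
    · simp only [cond_true]; omega
  | goto f => intro v S; simp [pushCount]
  | halt => intro v S; simp [pushCount]

/-- Bounds the output of a called machine by its running time, so that reading the output back takes
polynomial time. -/
theorem TM2Steps.length_le {K : Type} [DecidableEq K] {Γ : K → Type} {Λ σ : Type}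
    {m : Λ → TM2.Stmt Γ Λ σ} {c : ℕ} (hc : ∀ l, pushCount (m l) ≤ c) (k : K)
    {d' : TM2.Cfg Γ Λ σ} (n : ℕ) : ∀ d : TM2.Cfg Γ Λ σ, TM2Steps m n d d' →
    (d'.stk k).length ≤ (d.stk k).length + n * c := by
  induction n with
  | zero =>
    intro d h
    have : d = d' := by simpa [TM2Steps] using h
    subst this; simp
  | succ n ih =>
    rintro ⟨l, v, S⟩ h
    unfold TM2Steps at h
    rw [Function.iterate_succ_apply] at h
    cases l with
    | none =>
      have : (flip bind (TM2.step m)) (some ⟨none, v, S⟩) = none := rfl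
      rw [this, iterate_bind_none] at h
      cases h
    | some l =>
      have h1 := ih (TM2.stepAux (m l) v S) h
      have h2 := stepAux_length_le k (m l) v S
      have h3 := hc l
      rw [add_mul]
      dsimp only at *
      omega

/-- The contents of the own stacks of a program when only the main one is in use. -/
def mainOnly (E : StackEnv) (m : List Bool) : ∀ k, List (E.RegΓ k)
  | .main => m | .tmp1 => [] | .tmp2 => [] | .cnt => [] | .inp => [] | .out => []

section Oracle

variable {E : StackEnv} {Γ₀ Γ₁ : Type} [DecidableEq Γ₀] [FinLetters Γ₀] [DecidableEq Γ₁]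
  [FinLetters Γ₁]

theorem set2_base_inr (k : E.M.K) (w : List (E.M.Γ k)) (m : List Bool) :
    set2 (base [] : E.State) (.inr k) w m =
      StackEnv.join (mainOnly E m) (Function.update (fun _ => []) k w) := by
  unfold set2 base st
  rw [StackEnv.update_join_inr, StackEnv.update_join_inl]
  congr 1
  funext k; cases k <;> rfl

theorem set2_base_inr_nil (k : E.M.K) (m : List Bool) :
    set2 (base [] : E.State) (.inr k) [] m = base m := by
  rw [set2_base_inr, base, st]
  have : Function.update (fun k : E.M.K => ([] : List (E.M.Γ k))) k [] = fun _ => [] :=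
    Function.update_eq_self k _
  rw [this]
  congr 1

/-- The argument is moved to the input stack of the machine, the machine is called, and its output
stack is moved back. All stacks of the machine are empty again afterwards. -/
theorem PT.oracle {α β α' : Type} [TreeEnc α'] {ea : α → List Γ₀} {eb : β → List Γ₁} {f : α → β}
    (hin : E.M.Γ E.M.k₀ ≃ Γ₀) (hout : E.M.Γ E.M.k₁ ≃ Γ₁) (time : Polynomial ℕ)
    (hf : ∀ a, TM2OutputsInTime E.M ((ea a).map hin.invFun) (some ((eb (f a)).map hout.invFun))
      (time.eval (ea a).length))
    {g : α' → α} (hg : PT E fun a => ea (g a)) : PT E fun a => eb (f (g a)) := by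
  -- Moving a word between stacks reverses it, both on the way in and on the way out.
  suffices h : PT E fun a => (eb (f (g a))).reverse by
    simpa using h.reverse
  obtain ⟨p, T, hp⟩ := hg.reverse
  obtain ⟨q, hq⟩ := hg.size_le
  have hlen : ∀ a, (ea (g a)).length ≤ q.eval (size a) := fun a =>
    (PT.length_lt_size _).le.trans (hq a)
  -- There are finitely many labels, so the number of letters pushed in one step is bounded.
  obtain ⟨c, hc⟩ : ∃ c, ∀ l, pushCount (E.M.m l) ≤ c := by
    let := E.M.ΛFin
    exact ⟨Finset.univ.sup fun l => pushCount (E.M.m l), fun l =>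
      Finset.le_sup (f := fun l => pushCount (E.M.m l)) (Finset.mem_univ l)⟩
  have hf' : ∀ a, ∃ t ≤ (time.comp q).eval (size a), TM2Steps E.M.m t
      ⟨some E.M.main, E.M.initialState,
        Function.update (fun _ => []) E.M.k₀ ((ea (g a)).map hin.symm)⟩
      ⟨none, E.M.initialState,
        Function.update (fun _ => []) E.M.k₁ ((eb (f (g a))).map hout.symm)⟩ := by
    intro a
    obtain ⟨t, ht, h⟩ := TM2Steps.of_outputs (hf (g a))
    refine ⟨t, ht.trans ?_, h⟩
    rw [Polynomial.eval_comp]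
    exact Polynomial.eval_nat_mono _ (hlen a)
  have hout_len : ∀ a, (eb (f (g a))).length ≤ (q + time.comp q * .C c).eval (size a) := by
    intro a
    obtain ⟨t, ht, h⟩ := hf' a
    have h1 := TM2Steps.length_le hc E.M.k₁ t _ h
    have h2 : (Function.update (fun _ => []) E.M.k₀ ((ea (g a)).map hin.symm) E.M.k₁ :
        List (E.M.Γ E.M.k₁)).length ≤ (ea (g a)).length := by
      by_cases hk : E.M.k₁ = E.M.k₀
      · rw [hk]; simp
      · rw [Function.update_of_ne hk]; simp
    simp only [Function.update_self, List.length_map] at h1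
    simp only [Polynomial.eval_add, Polynomial.eval_mul, Polynomial.eval_C]
    have h3 := hlen a
    have h4 := Nat.mul_le_mul_right c ht
    omega
  let C₀ := 3 * (FinLetters.letters (Γ := Γ₀)).length + 10
  let C₁ := 3 * (FinLetters.letters (Γ := Γ₁)).length + 10
  refine ⟨.seq p (.seq (store (.inr E.M.k₀) hin) (.seq .call (load (.inr E.M.k₁) hout))),
    T + (q * .C C₀ + 2) + time.comp q + ((q + time.comp q * .C c) * .C C₁ + 2), fun a r => ?_⟩
  have h1 := hp a r
  have h2 := runs_store (S := (base [] : E.State)) (k := .inr E.M.k₀) hin (by simp)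
    (ea (g a)).reverse r
  obtain ⟨t, ht, h3⟩ := hf' a
  have h3' : Runs (.call : StackProg E)
    (set2 (base [] : E.State) (.inr E.M.k₀) ((ea (g a)).map hin.symm) r)
    (set2 (base [] : E.State) (.inr E.M.k₁) ((eb (f (g a))).map hout.symm) r) t := by
    rw [set2_base_inr, set2_base_inr]
    exact ⟨t, le_rfl, .call h3⟩
  have h4 := runs_load (S := (base [] : E.State)) (k := .inr E.M.k₁) hout (by simp)
    ((eb (f (g a))).map hout.symm) r
  rw [set2_base_inr_nil] at h2 h4
  rw [List.reverse_reverse] at h2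
  have e : ((eb (f (g a))).map hout.symm).map hout = eb (f (g a)) := by
    rw [List.map_map]; simp
  rw [e] at h4
  refine (h1.seq (h2.seq (h3'.seq h4))).mono ?_
  have l1 := Nat.mul_le_mul_right C₀ (hlen a)
  have l2 := Nat.mul_le_mul_right C₁ (hout_len a)
  simp only [List.length_reverse, List.length_map, Polynomial.eval_add, Polynomial.eval_mul,
    Polynomial.eval_C, Polynomial.eval_ofNat] at *
  change _ + ((ea (g a)).length * C₀ + 2 + (t + ((eb (f (g a))).length * C₁ + 2))) ≤ _
  omega

/-- A function on words computed by a stack program is computed by a Turing machine. -/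
theorem PT.tm2 {M : FinTM2} {α β : Type} {ea : α → List Γ₀} {eb : β → List Γ₁} {f : α → β}
    {g : List Γ₀ → List Γ₁} (hg : PT ⟨Γ₀, Γ₁, M⟩ g) (h : ∀ a, g (ea a) = eb (f a)) :
    Nonempty (TM2ComputableInPolyTime ea eb f) := by
  -- Loading the input and storing the output each reverse the word, which these two reversals undo.
  have hg' : PT ⟨Γ₀, Γ₁, M⟩ fun l : List Γ₀ => (g l.reverse).reverse :=
    (hg.comp (PT.reverse PT.id)).reverse
  obtain ⟨q, hq⟩ := hg'.size_le
  obtain ⟨p, T, hp⟩ := hg'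
  let E : StackEnv := ⟨Γ₀, Γ₁, M⟩
  let kin : E.K := .inl .inp
  let kout : E.K := .inl .out
  let P : StackProg E := .seq (load kin (Equiv.refl Γ₀)) (.seq p (store kout (Equiv.refl Γ₁)))
  let : Fintype Γ₀ := ⟨FinLetters.letters.toFinset, fun a => by simp [FinLetters.mem_letters]⟩
  let := M.kFin
  let := M.σFin
  let tm : FinTM2 :=
    { K := E.K
      k₀ := kin
      k₁ := kout
      Γ := E.Γ
      -- The additional label `none` is the exit of the program; there the machine halts.
      Λ := Option P.Pos
      main := some P.entry
      σ := E.σ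
      initialState := (false, M.initialState)
      Γk₀Fin := inferInstanceAs (Fintype Γ₀)
      m := fun l => l.elim .halt (P.code some none) }
  let C₀ := 3 * (FinLetters.letters (Γ := Γ₀)).length + 10
  let C₁ := 3 * (FinLetters.letters (Γ := Γ₁)).length + 10
  let D : Polynomial ℕ := .X * .C (2 * (FinLetters.letters (Γ := Γ₀)).length + 2) + 1
  have hD : ∀ w : List Γ₀, size w.reverse ≤ D.eval w.length := fun w => by
    have := size_word_le w.reverse
    simpa [D] using this
  have hbase : ∀ m, (base m : E.State) = StackEnv.join (mainOnly E m) (fun _ => []) := by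
    intro m
    unfold base st
    congr 1
  have e2 : ∀ m, set2 (base [] : E.State) kin [] m = base m := by
    intro m
    unfold set2; rw [hbase, hbase]
    funext k
    rcases k with k | k
    · cases k <;> rfl
    · rfl
  have e3 : ∀ m, set2 (base [] : E.State) kout [] m = base m := by
    intro m
    unfold set2; rw [hbase, hbase]
    funext k
    rcases k with k | k
    · cases k <;> rfl
    · rfl
  have e4 : ∀ w : List Γ₀, (initList tm w).stk = set2 (base [] : E.State) kin w [] := by
    intro w
    rw [initList_stk]
    unfold set2; rw [hbase]
    funext k
    rcases k with k | k
    · cases k <;> rfl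
    · rfl
  have e5 : ∀ w : List Γ₁, (haltList tm w).stk = set2 (base [] : E.State) kout w [] := by
    intro w
    rw [haltList_stk]
    unfold set2; rw [hbase]
    funext k
    rcases k with k | k
    · cases k <;> rfl
    · rfl
  have hrun : ∀ w : List Γ₀, Runs P (set2 (base [] : E.State) kin w [])
      (set2 (base [] : E.State) kout (g w) [])
      ((.X * .C C₀ + 2 + T.comp D + (q.comp D * .C C₁ + 2) : Polynomial ℕ).eval w.length) := by
    intro w
    have h1 := runs_load (S := (base [] : E.State)) (k := kin) (Equiv.refl Γ₀) (by simp [kin]) w []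
    have h2 := hp w.reverse []
    have h3 := runs_store (S := (base [] : E.State)) (k := kout) (Equiv.refl Γ₁) (by simp [kout])
      (g w).reverse []
    have el : List.map (Equiv.refl Γ₀) w = w := by simp
    have el' : List.map (Equiv.refl Γ₁).symm (g w) = g w := by simp
    rw [e2, el] at h1
    rw [e3, List.reverse_reverse, el'] at h3
    rw [List.reverse_reverse] at h2
    refine (h1.seq (h2.seq h3)).mono ?_
    have l1 := Polynomial.eval_nat_mono T (hD w)
    have l2 : (g w).reverse.length ≤ q.eval (D.eval w.length) := by
      have := hq w.reverse
      rw [List.reverse_reverse] at this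
      exact ((PT.length_lt_size _).le.trans this).trans (Polynomial.eval_nat_mono q (hD w))
    have l3 := Nat.mul_le_mul_right C₁ l2
    simp only [Polynomial.eval_add, Polynomial.eval_mul, Polynomial.eval_C, Polynomial.eval_ofNat,
      Polynomial.eval_X, Polynomial.eval_comp]
    change w.length * C₀ + 2 + (_ + ((g w).reverse.length * C₁ + 2)) ≤ _
    omega
  refine ⟨⟨⟨tm, Equiv.refl _, Equiv.refl _⟩,
    (.X * .C C₀ + 2 + T.comp D + (q.comp D * .C C₁ + 2)) + 1, fun a => ?_⟩⟩
  have hx : ∃ t ≤ ((.X * .C C₀ + 2 + T.comp D + (q.comp D * .C C₁ + 2)) + 1 :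
      Polynomial ℕ).eval (ea a).length, (flip bind tm.step)^[t]
      (some (initList tm (List.map (Equiv.refl (tm.Γ tm.k₀)).invFun (ea a)))) =
      some (haltList tm (List.map (Equiv.refl (tm.Γ tm.k₁)).invFun (eb (f a)))) := by
    obtain ⟨t, ht, hr⟩ := hrun (ea a)
    have h1 := hr.steps (m := tm.m) some none fun x => rfl
    have h2 : TM2Steps tm.m 1 ⟨some none, (false, M.initialState),
      set2 (base [] : E.State) kout (g (ea a)) []⟩ ⟨none, (false, M.initialState),
      set2 (base [] : E.State) kout (g (ea a)) []⟩ := TM2Steps.single rfl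
    refine ⟨t + 1, ?_, ?_⟩
    · rw [Polynomial.eval_add, Polynomial.eval_one]; omega
    · have h3 := h1.trans h2
      have i1 : initList tm (List.map (Equiv.refl (tm.Γ tm.k₀)).invFun (ea a)) =
          ⟨some (some P.entry), (false, M.initialState), set2 (base [] : E.State) kin (ea a) []⟩ := by
        have : List.map (Equiv.refl (tm.Γ tm.k₀)).invFun (ea a) = ea a := List.map_id _
        rw [this, ← e4]; rfl
      have i2 : haltList tm (List.map (Equiv.refl (tm.Γ tm.k₁)).invFun (eb (f a))) =
          ⟨none, (false, M.initialState), set2 (base [] : E.State) kout (g (ea a)) []⟩ := by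
        have : List.map (Equiv.refl (tm.Γ tm.k₁)).invFun (eb (f a)) = eb (f a) := List.map_id _
        rw [this, h, ← e5]; rfl
      rw [i1, i2]
      exact h3
  exact ⟨⟨Classical.choose hx, (Classical.choose_spec hx).2⟩, (Classical.choose_spec hx).1⟩

end Oracle

/-! ### Lists, Booleans and equality tests in polynomial time. -/

namespace PT

variable {E : StackEnv} {α β γ δ : Type} [TreeEnc α] [TreeEnc β] [TreeEnc γ] [TreeEnc δ]

theorem of_enc {f g : α → β} (hg : PT E g) (h : ∀ a, TreeEnc.enc (f a) = TreeEnc.enc (g a)) :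
    PT E f := by
  obtain ⟨p, T, hp⟩ := hg
  refine ⟨p, T, fun a r => ?_⟩
  have : tw (f a) = tw (g a) := by unfold tw; rw [h]
  rw [this]
  exact hp a r

theorem congr {f g : α → β} (hg : PT E g) (h : ∀ a, f a = g a) : PT E f :=
  of_enc hg fun a => by rw [h]

theorem p1 {f : α → β × γ} (hf : PT E f) : PT E fun a => (f a).1 := fst.comp hf

theorem p2 {f : α → β × γ} (hf : PT E f) : PT E fun a => (f a).2 := snd.comp hf

/-- Substitution into a function of two arguments. -/
theorem comp₂ {g : α → β → γ} (hg : PT E fun p : α × β => g p.1 p.2) {f₁ : δ → α} {f₂ : δ → β}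
    (h₁ : PT E f₁) (h₂ : PT E f₂) : PT E fun d => g (f₁ d) (f₂ d) :=
  hg.comp (h₁.pair h₂)

theorem cons {f : α → β} {g : α → List β} (hf : PT E f) (hg : PT E g) :
    PT E fun a => f a :: g a :=
  (of_enc_eq (f := fun p : β × List β => p.1 :: p.2) fun _ => rfl).comp (hf.pair hg)

theorem listMatch {l : α → List β} {f : α → γ} {g : α → β → List β → γ} (hl : PT E l)
    (hf : PT E f) (hg : PT E fun p : α × β × List β => g p.1 p.2.1 p.2.2) :
    PT E fun a => (match l a with | [] => f a | b :: t => g a b t : γ) := by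
  have : PT E fun p : List β × α => (match p.1 with | [] => f p.2 | b :: t => g p.2 b t : γ) :=
    listCases hf (hg.comp (snd.pair fst))
  exact this.comp (hl.pair id)

theorem finFun {Γ : Type} [DecidableEq Γ] [FinLetters Γ] (f : Γ → β) : PT E f := by
  have : PT E fun p : Γ × Unit => f p.1 := finCases fun a => const (f a)
  exact this.comp (id.pair (const ()))

theorem cond {c : α → Bool} {f g : α → β} (hc : PT E c) (hf : PT E f) (hg : PT E g) :
    PT E fun a => bif c a then f a else g a := by
  have : PT E fun p : Bool × α => bif p.1 then f p.2 else g p.2 :=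
    finCases fun b => by cases b <;> assumption
  exact this.comp (hc.pair id)

theorem ite {c : α → Prop} [DecidablePred c] {f g : α → β} (hc : PT E fun a => decide (c a))
    (hf : PT E f) (hg : PT E g) : PT E fun a => if c a then f a else g a :=
  (cond hc hf hg).congr fun a => by by_cases h : c a <;> simp [h]

theorem and {f g : α → Bool} (hf : PT E f) (hg : PT E g) : PT E fun a => f a && g a :=
  (cond hf hg (const false)).congr fun a => by cases f a <;> rfl

theorem not {f : α → Bool} (hf : PT E f) : PT E fun a => !f a := (finFun _).comp hf

theorem isEmpty {l : α → List β} (hl : PT E l) : PT E fun a => (l a).isEmpty :=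
  (listMatch hl (const true) (const false)).congr fun a => by cases l a <;> rfl

theorem tail {l : α → List β} (hl : PT E l) : PT E fun a => (l a).tail :=
  (listMatch hl (const []) (g := fun _ _ t => t) snd.p2).congr fun a => by
    cases l a <;> rfl

theorem headD {l : α → List β} (d : β) (hl : PT E l) : PT E fun a => (l a).headD d :=
  (listMatch hl (const d) (g := fun _ b _ => b) snd.p1).congr fun a => by
    cases l a <;> rfl

theorem append {f g : α → List β} (hf : PT E f) (hg : PT E g) : PT E fun a => f a ++ g a := by
  have h : PT E fun a => (f a).reverse.foldl (fun acc x => x :: acc) (g a) := by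
    obtain ⟨q, hq⟩ := hf.size_le
    refine foldl_of_growth (step := fun _ acc x => x :: acc) hf.reverse hg
      (cons snd fst.p2) (q + 1) fun a b x hx => ?_
    have h1 := size_le_of_mem (List.mem_reverse.1 hx)
    have h2 := hq a
    simp only [size_cons, Polynomial.eval_add, Polynomial.eval_one]
    omega
  exact h.congr fun a => by simp

theorem map {l : α → List β} {g : α → β → γ} (hl : PT E l)
    (hg : PT E fun p : α × β => g p.1 p.2) : PT E fun a => (l a).map (g a) := by
  have h : PT E fun a => (l a).foldl (fun acc x => g a x :: acc) [] := by
    obtain ⟨q, hq⟩ := hl.size_le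
    obtain ⟨q', hq'⟩ := hg.size_le
    refine foldl_of_growth (step := fun a acc x => g a x :: acc) hl (const [])
      (cons (comp₂ hg fst.p1 snd) fst.p2) (q'.comp (.X + q + 1) + 1)
      fun a b x hx => ?_
    have h1 := size_le_of_mem hx
    have h2 := hq a
    have h3 := hq' (a, x)
    have h4 := Polynomial.eval_nat_mono q' (m := size (a, x)) (n := size a + q.eval (size a) + 1)
      (by rw [size_pair]; omega)
    simp only [size_cons, Polynomial.eval_add, Polynomial.eval_one, Polynomial.eval_comp,
      Polynomial.eval_X] at *
    omega
  exact h.reverse.congr fun a => by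
    have : ∀ (l : List β) acc, l.foldl (fun acc x => g a x :: acc) acc =
        (l.map (g a)).reverse ++ acc := by
      intro l
      induction l with
      | nil => intro acc; rfl
      | cons x l ih => intro acc; simp [ih]
    rw [this]; simp

theorem flatMap {l : α → List β} {g : α → β → List γ} (hl : PT E l)
    (hg : PT E fun p : α × β => g p.1 p.2) : PT E fun a => (l a).flatMap (g a) := by
  have h : PT E fun a => (l a).foldl (fun acc x => acc ++ g a x) [] := by
    obtain ⟨q, hq⟩ := hl.size_le
    obtain ⟨q', hq'⟩ := hg.size_le
    refine foldl_of_growth (step := fun a acc x => acc ++ g a x) hl (const [])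
      (append fst.p2 (comp₂ hg fst.p1 snd)) (q'.comp (.X + q + 1))
      fun a b x hx => ?_
    have h1 := size_le_of_mem hx
    have h2 := hq a
    have h3 := hq' (a, x)
    have h4 := Polynomial.eval_nat_mono q' (m := size (a, x)) (n := size a + q.eval (size a) + 1)
      (by rw [size_pair]; omega)
    have h5 := size_le_list_append b (g a x)
    simp only [Polynomial.eval_add, Polynomial.eval_one, Polynomial.eval_comp,
      Polynomial.eval_X] at *
    omega
  exact h.congr fun a => by
    have : ∀ (l : List β) acc, l.foldl (fun acc x => acc ++ g a x) acc =
        acc ++ l.flatMap (g a) := by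
      intro l
      induction l with
      | nil => intro acc; simp
      | cons x l ih => intro acc; simp [ih]
    rw [this]; simp

theorem size_bool_le (b : Bool) : 1 ≤ size b ∧ size b ≤ 3 := by cases b <;> decide

theorem all {l : α → List β} {g : α → β → Bool} (hl : PT E l)
    (hg : PT E fun p : α × β => g p.1 p.2) : PT E fun a => (l a).all (g a) := by
  have h : PT E fun a => (l a).foldl (fun b x => b && g a x) true := by
    refine foldl_of_growth (step := fun a b x => b && g a x) hl (const true)
      (fst.p2.and (comp₂ hg fst.p1 snd)) 3 fun a b x _ => ?_
    have := size_bool_le (b && g a x)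
    simp only [Polynomial.eval_ofNat]
    omega
  exact h.congr fun a => by
    have : ∀ (l : List β) b, l.foldl (fun b x => b && g a x) b = (b && l.all (g a)) := by
      intro l
      induction l with
      | nil => intro b; simp
      | cons x l ih => intro b; simp [ih, Bool.and_assoc]
    rw [this]; simp

theorem any {l : α → List β} {g : α → β → Bool} (hl : PT E l)
    (hg : PT E fun p : α × β => g p.1 p.2) : PT E fun a => (l a).any (g a) :=
  (all (g := fun a b => !g a b) hl hg.not).not.congr fun a => by
    rw [List.not_all_eq_any_not]; simp

theorem listEq [DecidableEq β] (h : PT E fun p : β × β => decide (p.1 = p.2))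
    {f g : α → List β} (hf : PT E f) (hg : PT E g) : PT E fun a => decide (f a = g a) := by
  suffices h : PT E fun p : List β × List β => decide (p.1 = p.2) from h.comp (hf.pair hg)
  -- The state is the unread part of the second list and whether all entries have agreed so far. The
  -- lists are equal if the flag survives and nothing is left over.
  let step : List β × Bool → β → List β × Bool := fun s a =>
    match s.1 with
    | [] => ([], false)
    | b :: r => (r, s.2 && decide (a = b))
  have hs : PT E fun p : List β × List β => p.1.foldl step (p.2, true) := by
    have hstep : PT E fun p : ((List β × List β) × (List β × Bool)) × β => step p.1.2 p.2 :=
      listMatch fst.p2.p1 (const ([], false)) (g := fun p b r => (r, p.1.2.2 && decide (p.2 = b)))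
        (snd.p2.pair (fst.p1.p2.p2.and (comp₂ (g := fun a b => decide (a = b)) h fst.p2 snd.p1)))
    refine foldl_of_growth (step := fun _ s a => step s a) fst (snd.pair (const true))
      hstep 3 fun p s a _ => ?_
    obtain ⟨l, b⟩ := s
    cases l with
    | nil =>
      simp only [step, size_pair, Polynomial.eval_ofNat]
      have := size_bool_le b
      have := size_bool_le false
      omega
    | cons x l =>
      simp only [step, size_pair, size_cons, Polynomial.eval_ofNat]
      have := size_bool_le b
      have := size_bool_le (b && decide (a = x))
      omega
  refine (hs.p2.and (isEmpty hs.p1)).congr fun ⟨l, l'⟩ => ?_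
  have key : ∀ (l l' : List β) b, ((l.foldl step (l', b)).2 && (l.foldl step (l', b)).1.isEmpty) =
      (b && decide (l = l')) := by
    intro l
    induction l with
    | nil => intro l' b; cases l' <;> simp
    | cons x l ih =>
      intro l' b
      cases l' with
      | nil =>
        rw [List.foldl_cons]
        simp only [step]
        rw [ih]; simp
      | cons y l' =>
        rw [List.foldl_cons]
        simp only [step]
        rw [ih, Bool.and_assoc]; simp
  simp only [key, Bool.true_and]

theorem letterEq {Γ : Type} [DecidableEq Γ] [FinLetters Γ] {f g : α → Γ} (hf : PT E f)
    (hg : PT E g) : PT E fun a => decide (f a = g a) := by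
  have : PT E fun p : Γ × Γ => decide (p.1 = p.2) := finCases fun a => finFun _
  exact this.comp (hf.pair hg)

theorem wordEq {Γ : Type} [DecidableEq Γ] [FinLetters Γ] {f g : α → List Γ} (hf : PT E f)
    (hg : PT E g) : PT E fun a => decide (f a = g a) :=
  listEq (letterEq fst snd) hf hg

end PT

/-! ### Natural numbers in binary -/

instance : TreeEnc ℕ := ⟨fun n => TreeEnc.enc n.bits⟩

/-- The number with the given binary digits, least significant first. -/
def ofBits (l : List Bool) : ℕ := l.foldr Nat.bit 0

theorem ofBits_bits (n : ℕ) : ofBits n.bits = n := by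
  induction n using Nat.binaryRec' with
  | zero => simp [ofBits]
  | bit b n h ih =>
    rw [Nat.bits_append_bit n b h]
    change Nat.bit b (ofBits n.bits) = _
    rw [ih]

/-- Addition of one to a binary numeral. -/
def incBits : List Bool → List Bool
  | [] => [true]
  | false :: l => true :: l
  | true :: l => false :: incBits l

theorem bits_bit_of_ne {b : Bool} {n : ℕ} (h : Nat.bit b n ≠ 0) :
    (Nat.bit b n).bits = b :: n.bits := by
  apply Nat.bits_append_bit
  rintro rfl
  cases b
  · simp at h
  · rfl

theorem bits_succ (n : ℕ) : (n + 1).bits = incBits n.bits := by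
  induction n using Nat.binaryRec' with
  | zero => simp [incBits]
  | bit b n h ih =>
    rw [Nat.bits_append_bit n b h]
    cases b
    · have : Nat.bit false n + 1 = Nat.bit true n := by simp [Nat.bit]
      rw [this, bits_bit_of_ne (by simp)]; rfl
    · have : Nat.bit true n + 1 = Nat.bit false (n + 1) := by simp [Nat.bit]; omega
      rw [this, bits_bit_of_ne (by simp [Nat.bit]), ih]; rfl

theorem bits_length_le (n : ℕ) : n.bits.length ≤ n := by
  rw [Nat.size_eq_bits_len, Nat.size_le]
  exact Nat.lt_two_pow_self

theorem size_nat_le (n : ℕ) : size n ≤ 4 * n + 1 := by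
  have h : ∀ l : List Bool, size l ≤ 4 * l.length + 1 := by
    intro l
    induction l with
    | nil => simp [size_nil]
    | cons b l ih =>
      have := PT.size_bool_le b
      rw [size_cons, List.length_cons]; omega
  have h1 := h n.bits
  have h2 := bits_length_le n
  have h3 : size n = size n.bits := rfl
  omega

namespace PT

variable {E : StackEnv} {α β γ δ : Type} [TreeEnc α] [TreeEnc β] [TreeEnc γ] [TreeEnc δ]

theorem bits {f : α → ℕ} (hf : PT E f) : PT E fun a => (f a).bits :=
  (of_enc_eq (f := Nat.bits) fun _ => rfl).comp hf

theorem natEq {f g : α → ℕ} (hf : PT E f) (hg : PT E g) : PT E fun a => decide (f a = g a) :=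
  (wordEq hf.bits hg.bits).congr fun a => by
    have : f a = g a ↔ (f a).bits = (g a).bits :=
      ⟨fun h => by rw [h], fun h => by rw [← ofBits_bits (f a), h, ofBits_bits]⟩
    simp [this]

theorem incBits {f : α → List Bool} (hf : PT E f) : PT E fun a => incBits (f a) := by
  suffices h : PT E fun l : List Bool => _root_.incBits l from h.comp hf
  -- The state consists of the carry and the digits written so far, in reverse.
  let step : Bool × List Bool → Bool → Bool × List Bool := fun s b => (s.1 && b, xor s.1 b :: s.2)
  have hxor : PT E fun p : Bool × Bool => xor p.1 p.2 := finCases fun _ => finFun _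
  have hstep : PT E fun p : (List Bool × (Bool × List Bool)) × Bool => step p.1.2 p.2 :=
    (and fst.p2.p1 snd).pair (cons (comp₂ hxor fst.p2.p1 snd) fst.p2.p2)
  have hs : PT E fun l : List Bool => l.foldl step (true, []) := by
    refine foldl_of_growth (step := fun _ s a => step s a) id (const (true, [])) hstep 10
      fun l s a _ => ?_
    obtain ⟨b, r⟩ := s
    simp only [step, size_pair, size_cons, Polynomial.eval_ofNat]
    have := size_bool_le b
    have := size_bool_le (b && a)
    have := size_bool_le (xor b a)
    omega
  refine (hs.p2.reverse.append (cond hs.p1 (const [true]) (const []))).congr fun l => ?_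
  have key : ∀ (l : List Bool) (acc : List Bool),
      (l.foldl step (true, acc)).2.reverse ++
        (bif (l.foldl step (true, acc)).1 then [true] else []) =
        acc.reverse ++ _root_.incBits l ∧
      (l.foldl step (false, acc)).2.reverse ++
        (bif (l.foldl step (false, acc)).1 then [true] else []) = acc.reverse ++ l := by
    intro l
    induction l with
    | nil => intro acc; simp [_root_.incBits]
    | cons b l ih =>
      intro acc
      cases b
      · simp [step, ih, _root_.incBits]
      · simp [step, ih, _root_.incBits]
  rw [(key l []).1]; rfl

/-- A number is computable if its binary digits are. -/
theorem nat_of_bits {f : α → ℕ} {g : α → List Bool} (hg : PT E g) (h : ∀ a, (f a).bits = g a) :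
    PT E f := by
  have : PT E fun a => (f a).bits := hg.congr h
  obtain ⟨p, T, hp⟩ := this
  exact ⟨p, T, hp⟩

theorem succ {f : α → ℕ} (hf : PT E f) : PT E fun a => f a + 1 :=
  nat_of_bits hf.bits.incBits fun a => bits_succ (f a)

theorem bit (b : Bool) {f : α → ℕ} (hf : PT E f) : PT E fun a => Nat.bit b (f a) := by
  have h : PT E fun a => bif !b && (f a).bits.isEmpty then [] else b :: (f a).bits :=
    cond ((const (!b)).and hf.bits.isEmpty) (const []) (cons (const b) hf.bits)
  refine nat_of_bits h fun a => ?_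
  by_cases h0 : f a = 0
  · cases b <;> simp [h0]
  · have : (f a).bits.isEmpty = false := by
      rw [List.isEmpty_eq_false_iff]
      exact fun h => h0 (by rw [← ofBits_bits (f a), h]; rfl)
    have h1 : Nat.bit b (f a) ≠ 0 := by simp [h0]
    rw [bits_bit_of_ne h1]
    rw [this]; simp

theorem ofBits {f : α → List Bool} (hf : PT E f) : PT E fun a => ofBits (f a) := by
  suffices h : PT E fun l : List Bool => _root_.ofBits l from h.comp hf
  -- Starting from the most significant digit, a zero in front of nothing is dropped, because
  -- `Nat.bits` has no leading zeros.
  let step : List Bool → Bool → List Bool := fun s b => bif !b && s.isEmpty then [] else b :: s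
  have hstep : PT E fun p : (List Bool × List Bool) × Bool => step p.1.2 p.2 :=
    cond (snd.not.and fst.p2.isEmpty) (const []) (cons snd fst.p2)
  have h : PT E fun l : List Bool => l.reverse.foldl step [] := by
    refine foldl_of_growth (step := fun _ s a => step s a) (reverse id) (const []) hstep 4
      fun l s b _ => ?_
    have h1 := size_bool_le b
    have h2 := size_pos s
    simp only [step, Polynomial.eval_ofNat]
    cases !b && s.isEmpty
    · simp only [cond_false, size_cons]; omega
    · simp only [cond_true, size_nil]; omega
  refine nat_of_bits h fun l => ?_
  rw [List.foldl_reverse]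
  induction l with
  | nil => simp [_root_.ofBits]
  | cons b l ih =>
    rw [List.foldr_cons, ← ih]
    change (Nat.bit b (_root_.ofBits l)).bits = _
    set n := _root_.ofBits l
    by_cases h0 : n = 0
    · cases b <;> simp [h0, step]
    · have : n.bits.isEmpty = false := by
        rw [List.isEmpty_eq_false_iff]
        exact fun h => h0 (by rw [← ofBits_bits n, h]; rfl)
      have h1 : Nat.bit b n ≠ 0 := by simp [h0]
      rw [bits_bit_of_ne h1]
      simp only [step, this]; simp

/-- Numbering the entries of a list. -/
theorem zipIdx {f : α → List β} (hf : PT E f) : PT E fun a => (f a).zipIdx := by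
  suffices h : PT E fun l : List β => l.zipIdx from h.comp hf
  let step : ℕ × List (β × ℕ) → β → ℕ × List (β × ℕ) := fun s b => (s.1 + 1, (b, s.1) :: s.2)
  have hstep : PT E fun p : (List β × (ℕ × List (β × ℕ))) × β => step p.1.2 p.2 :=
    (fst.p2.p1.succ).pair (cons (snd.pair fst.p2.p1) fst.p2.p2)
  have key : ∀ (l : List β) (n : ℕ) (acc : List (β × ℕ)),
      l.foldl step (n, acc) = (n + l.length, (l.zipIdx n).reverse ++ acc) := by
    intro l
    induction l with
    | nil => intro n acc; simp
    | cons b l ih =>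
      intro n acc
      rw [List.foldl_cons]
      simp only [step]
      rw [ih]
      simp only [List.length_cons, List.zipIdx_cons, List.reverse_cons, List.append_assoc,
        List.cons_append, List.nil_append]
      congr 1
      omega
  -- A step copies the counter, whose size is bounded only in the states that really occur. So
  -- `foldl_of_growth`, which asks for a bound in all states, does not apply.
  have hsz : ∀ (l : List β) (n : ℕ) (acc : List (β × ℕ)),
      size (l.foldl step (n, acc)).2 ≤ size acc + size l + l.length * (4 * (n + l.length) + 3) := by
    intro l
    induction l with
    | nil => intro n acc; simp
    | cons b l ih =>
      intro n acc
      rw [List.foldl_cons]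
      change size (l.foldl step (n + 1, (b, n) :: acc)).2 ≤ _
      have h1 := ih (n + 1) ((b, n) :: acc)
      have h2 := size_nat_le n
      have h3 : 4 * (n + 1 + l.length) + 3 = 4 * (n + (l.length + 1)) + 3 := by omega
      rw [size_cons, size_pair, h3] at h1
      rw [List.length_cons, size_cons, add_mul]
      omega
  have h : PT E fun l : List β => l.foldl step (0, []) := by
    refine foldl (step := fun _ s a => step s a) id (const (0, [])) hstep
      (4 * .X + (.X + .X * (4 * .X + 3)) + 4) fun l l' hl' => ?_
    have h1 := hsz l' 0 []
    have h2 : (l'.foldl step (0, [])).1 = l'.length := by rw [key]; simp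
    have h3 : size (l'.foldl step (0, [])) = size (l'.foldl step (0, [])).1 +
      size (l'.foldl step (0, [])).2 + 1 := size_pair _ _
    rw [h3, h2]
    have h4 := size_nat_le l'.length
    have h5 : l'.length ≤ size l := hl'.length_le.trans (length_lt_size l).le
    obtain ⟨t, rfl⟩ := hl'
    have h6 := size_le_list_append l' t
    have h7 := size_pos t
    simp only [Polynomial.eval_add, Polynomial.eval_mul, Polynomial.eval_X, Polynomial.eval_ofNat]
    set s := size (l' ++ t)
    have h8 : l'.length * (4 * (0 + l'.length) + 3) ≤ s * (4 * s + 3) :=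
      Nat.mul_le_mul h5 (by omega)
    rw [size_nil] at h1
    omega
  refine h.p2.reverse.congr fun l => ?_
  rw [key]; simp

end PT

/-! ## Parsing words -/

abbrev LWord := List Letter

/-- Whether a word closes `d + 1` brackets, the last one with its last letter. -/
def closes : ℕ → LWord → Bool
  | _, [] => false
  | d, .lp :: w => closes (d + 1) w
  | 0, .rp :: w => w.isEmpty
  | d + 1, .rp :: w => closes d w
  | d, .b0 :: w => closes d w
  | d, .b1 :: w => closes d w

/-- Whether a word is a single bracketed expression. -/
def isItem : LWord → Bool
  | .lp :: w => closes 0 w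
  | _ => false

/-- Whether a word can be inserted within brackets. -/
def Bal (u : LWord) : Prop := ∀ d w, closes d (u ++ w) = closes d w

theorem Bal.nil : Bal [] := fun _ _ => rfl

theorem Bal.append {u v : LWord} (hu : Bal u) (hv : Bal v) : Bal (u ++ v) := fun d w => by
  rw [List.append_assoc, hu, hv]

theorem Bal.bits (l : List Bool) : Bal (l.map encBit) := by
  induction l with
  | nil => exact Bal.nil
  | cons b l ih =>
    intro d w
    have := ih d w
    cases b <;> cases d <;> simpa [encBit, closes] using this

theorem Bal.flatMap {α : Type*} {f : α → LWord} {l : List α} (h : ∀ a ∈ l, Bal (f a)) :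
    Bal (l.flatMap f) := by
  induction l with
  | nil => exact Bal.nil
  | cons a l ih =>
    rw [List.flatMap_cons]
    exact (h a (by simp)).append (ih fun b hb => h b (by simp [hb]))

theorem isItem_bracket {u : LWord} (hu : Bal u) : isItem (Letter.lp :: (u ++ [Letter.rp])) = true := by
  simp only [isItem]
  rw [hu]
  rfl

/-- `closes d` starts with `d + 1` open brackets. Of the `d + e + 2` open ones, `w` closes `d + 1`
and leaves `e + 1` to `v`. -/
theorem closes_append {w v : LWord} (e : ℕ) : ∀ {d : ℕ}, closes d w = true →
    closes (d + 1 + e) (w ++ v) = closes e v := by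
  induction w with
  | nil => intro d h; simp [closes] at h
  | cons a w ih =>
    intro d h
    cases a with
    | b0 =>
      have h' : closes d w = true := by cases d <;> simpa [closes] using h
      have : closes (d + 1 + e) (Letter.b0 :: w ++ v) = closes (d + 1 + e) (w ++ v) := by
        cases hd : d + 1 + e <;> rfl
      rw [this, ih h']
    | b1 =>
      have h' : closes d w = true := by cases d <;> simpa [closes] using h
      have : closes (d + 1 + e) (Letter.b1 :: w ++ v) = closes (d + 1 + e) (w ++ v) := by
        cases hd : d + 1 + e <;> rfl
      rw [this, ih h']
    | lp =>
      have h' : closes (d + 1) w = true := by cases d <;> simpa [closes] using h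
      have := ih h'
      have e1 : d + 1 + 1 + e = (d + 1 + e) + 1 := by omega
      rw [e1] at this
      rw [← this]
      cases hd : d + 1 + e <;> rfl
    | rp =>
      cases d with
      | zero =>
        have : w = [] := by simpa [closes] using h
        subst this
        have e1 : 0 + 1 + e = e + 1 := by omega
        rw [e1]; rfl
      | succ d =>
        have := ih (d := d) h
        have e1 : d + 1 + 1 + e = (d + 1 + e) + 1 := by omega
        rw [e1, ← this]; rfl

theorem Bal.of_isItem {w : LWord} (h : isItem w = true) : Bal w := by
  match w, h with
  | .lp :: w, h =>
    intro d v
    have := closes_append (v := v) d (d := 0) h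
    rw [← this, zero_add, add_comm 1 d]
    cases d <;> rfl

theorem isItem_encNat (n : ℕ) : isItem (encNat n) = true := isItem_bracket (Bal.bits _)

theorem isItem_encInt (z : ℤ) : isItem (encInt z) = true := by
  have : encInt z = Letter.lp :: (((decide (z < 0)) :: z.natAbs.bits).map encBit ++ [Letter.rp]) := by
    simp [encInt]
  rw [this]
  exact isItem_bracket (Bal.bits _)

theorem isItem_encList {α : Type*} {f : α → LWord} {l : List α} (h : ∀ a ∈ l, Bal (f a)) :
    isItem (encList f l) = true := isItem_bracket (Bal.flatMap h)

theorem isItem_encElem {F : Type*} [Field F] (pres : FieldPresentation F) (a : F) :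
    isItem (pres.encElem a) = true := by
  cases pres with
  | finite p pb => exact isItem_encList fun n _ => Bal.of_isItem (isItem_encNat n)
  | numberField pb =>
    exact isItem_encList fun q _ =>
      (Bal.of_isItem (isItem_encInt _)).append (Bal.of_isItem (isItem_encNat _))

/-- One step of splitting a word into bracketed expressions; the state consists of the depth,
the letters of the current expression and the expressions found so far. -/
def splitStep (s : List Unit × (LWord × List LWord)) : Letter → List Unit × (LWord × List LWord)
  | .lp => (() :: s.1, .lp :: s.2.1, s.2.2)
  | .rp => match s.1.tail with
    | [] => ([], [], (Letter.rp :: s.2.1).reverse :: s.2.2)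
    | u :: d => (u :: d, .rp :: s.2.1, s.2.2)
  | a => (s.1, a :: s.2.1, s.2.2)

/-- The bracketed expressions whose concatenation is the given word. -/
def splitItems (w : LWord) : List LWord := (w.foldl splitStep ([], [], [])).2.2.reverse

theorem foldl_splitStep_closes {w : LWord} : ∀ {d : ℕ}, closes d w = true → ∀ cur done,
    w.foldl splitStep (List.replicate (d + 1) (), cur, done) =
      ([], [], (w.reverse ++ cur).reverse :: done) := by
  induction w with
  | nil => intro d h; simp [closes] at h
  | cons a w ih =>
    intro d h cur done
    cases a with
    | b0 =>
      have h' : closes d w = true := by cases d <;> simpa [closes] using h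
      simp [splitStep, ih h']
    | b1 =>
      have h' : closes d w = true := by cases d <;> simpa [closes] using h
      simp [splitStep, ih h']
    | lp =>
      have h' : closes (d + 1) w = true := by cases d <;> simpa [closes] using h
      have := ih h' (.lp :: cur) done
      rw [List.foldl_cons]
      simp only [splitStep]
      rw [List.replicate_succ] at this
      rw [this]; simp
    | rp =>
      cases d with
      | zero =>
        have : w = [] := by simpa [closes] using h
        subst this
        simp [splitStep]
      | succ d =>
        have := ih (d := d) h (.rp :: cur) done
        rw [List.foldl_cons]
        simp only [splitStep, List.replicate_succ, List.tail_cons]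
        rw [List.replicate_succ] at this
        rw [this]; simp

/-- Bracketed expressions are self-delimiting: each ends where its depth first returns to zero. All
unique readability below rests on this. -/
theorem splitItems_flatten {l : List LWord} (h : ∀ w ∈ l, isItem w = true) :
    splitItems l.flatten = l := by
  have key : ∀ (l : List LWord) done, (∀ w ∈ l, isItem w = true) →
      l.flatten.foldl splitStep ([], [], done) = ([], [], l.reverse ++ done) := by
    intro l
    induction l with
    | nil => intro done _; rfl
    | cons w l ih =>
      intro done h
      have hw := h w (by simp)
      match w, hw with
      | .lp :: w, hw =>
        have h1 := foldl_splitStep_closes (d := 0) hw [.lp] done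
        rw [List.flatten_cons, List.foldl_append, List.foldl_cons]
        simp only [splitStep]
        simp only [zero_add, List.replicate_one] at h1
        rw [h1, ih _ fun v hv => h v (by simp [hv])]
        simp
  unfold splitItems
  rw [key l [] h]; simp

/-- The contents of a bracketed expression. -/
def unbracket (w : LWord) : LWord := w.tail.reverse.tail.reverse

theorem unbracket_bracket (u : LWord) : unbracket (Letter.lp :: (u ++ [Letter.rp])) = u := by
  simp [unbracket]

theorem splitItems_inner_encList {α : Type*} {f : α → LWord} {l : List α}
    (h : ∀ a ∈ l, isItem (f a) = true) : splitItems (unbracket (encList f l)) = l.map f := by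
  unfold encList
  rw [unbracket_bracket, List.flatMap_def, splitItems_flatten]
  simpa using h

/-- A list in pairs. -/
def pairUp {α : Type*} : List α → List (α × α)
  | a :: b :: l => (a, b) :: pairUp l
  | _ => []

theorem splitItems_inner_encList_pair {α : Type*} {f g : α → LWord} {l : List α}
    (hf : ∀ a ∈ l, isItem (f a) = true) (hg : ∀ a ∈ l, isItem (g a) = true) :
    pairUp (splitItems (unbracket (encList (fun a => f a ++ g a) l))) =
      l.map fun a => (f a, g a) := by
  unfold encList
  rw [unbracket_bracket]
  have h1 : (l.flatMap fun a => f a ++ g a) = (l.flatMap fun a => [f a, g a]).flatten := by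
    induction l with
    | nil => rfl
    | cons a l ih =>
      rw [List.flatMap_cons, ih (fun b hb => hf b (by simp [hb])) fun b hb => hg b (by simp [hb])]
      simp
  rw [h1, splitItems_flatten]
  · clear h1 hf hg
    induction l with
    | nil => rfl
    | cons a l ih => simpa [pairUp] using ih
  · intro w hw
    obtain ⟨a, ha, hw⟩ := List.mem_flatMap.1 hw
    rcases List.mem_cons.1 hw with rfl | hw
    · exact hf a ha
    · rw [List.mem_singleton.1 hw]; exact hg a ha

/-- The number written by the digits among the letters of a word. -/
def decNat (w : LWord) : ℕ :=
  ofBits (w.flatMap fun | .b0 => [false] | .b1 => [true] | _ => [])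

theorem decNat_encNat (n : ℕ) : decNat (encNat n) = n := by
  unfold decNat encNat
  rw [List.flatMap_cons, List.flatMap_append, List.flatMap_map]
  have : (n.bits.flatMap fun a => match encBit a with
      | .b0 => [false] | .b1 => [true] | _ => []) = n.bits := by
    induction n.bits with
    | nil => rfl
    | cons b l ih => rw [List.flatMap_cons, ih]; cases b <;> rfl
  simp only [List.nil_append, List.flatMap_nil, List.flatMap_cons, List.append_nil, this]
  exact ofBits_bits n

theorem encNat_injective : Function.Injective encNat := fun m n h => by
  rw [← decNat_encNat m, h, decNat_encNat]

/-! ### Systems -/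

/-- With `φ` the encoding of field elements, this gives the system that machines handle:
coefficients are words which are never interpreted. -/
def SparsePoly.mapF {F G : Type*} (φ : F → G) (f : SparsePoly F) : SparsePoly G :=
  f.map fun t => (φ t.1, t.2)

def parseMono (w : LWord) : List (ℕ × ℕ) :=
  (pairUp (splitItems (unbracket w))).map fun p => (decNat p.1, decNat p.2)

def parsePoly (w : LWord) : SparsePoly LWord :=
  (pairUp (splitItems (unbracket w))).map fun p => (p.1, parseMono p.2)

def parseSystem (w : LWord) : List (SparsePoly LWord) := (splitItems (unbracket w)).map parsePoly

/-- The encoding of a polynomial whose coefficients are given as words. -/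
abbrev encRawPoly (f : SparsePoly LWord) : LWord := f.enc fun w => w

abbrev encRawSystem (S : List (SparsePoly LWord)) : LWord := encSystem (fun w => w) S

/-- For unique parsing a coefficient need only be a bracketed expression; whether it encodes a field
element is not tested. -/
def rawSystemOk (S : List (SparsePoly LWord)) : Bool := S.all fun f => f.all fun t => isItem t.1

abbrev encMono (m : List (ℕ × ℕ)) : LWord := encList (fun m : ℕ × ℕ => encNat m.1 ++ encNat m.2) m

theorem isItem_encMono (m : List (ℕ × ℕ)) : isItem (encMono m) = true :=
  isItem_encList fun _ _ => (Bal.of_isItem (isItem_encNat _)).append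
    (Bal.of_isItem (isItem_encNat _))

theorem parseMono_encMono (m : List (ℕ × ℕ)) : parseMono (encMono m) = m := by
  unfold parseMono encMono
  rw [splitItems_inner_encList_pair (fun _ _ => isItem_encNat _) fun _ _ => isItem_encNat _]
  simp [Function.comp_def, decNat_encNat]

theorem isItem_encRawPoly {f : SparsePoly LWord} (h : ∀ t ∈ f, isItem t.1 = true) :
    isItem (encRawPoly f) = true :=
  isItem_encList fun t ht => (Bal.of_isItem (h t ht)).append (Bal.of_isItem (isItem_encMono _))

theorem parsePoly_enc {f : SparsePoly LWord} (h : ∀ t ∈ f, isItem t.1 = true) :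
    parsePoly (encRawPoly f) = f := by
  unfold parsePoly encRawPoly SparsePoly.enc
  rw [splitItems_inner_encList_pair (f := fun t : LWord × List (ℕ × ℕ) => t.1)
    (g := fun t => encMono t.2) h fun _ _ => isItem_encMono _]
  simp [Function.comp_def, parseMono_encMono]

theorem parseSystem_enc {S : List (SparsePoly LWord)} (h : rawSystemOk S = true) :
    parseSystem (encRawSystem S) = S := by
  have h' : ∀ f ∈ S, ∀ t ∈ f, isItem t.1 = true := by
    simpa [rawSystemOk] using h
  unfold parseSystem encRawSystem encSystem
  rw [splitItems_inner_encList fun f hf => isItem_encRawPoly (h' f hf), List.map_map]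
  conv_rhs => rw [← List.map_id S]
  exact List.map_congr_left fun f hf => parsePoly_enc (h' f hf)

theorem encRawSystem_injective {S S' : List (SparsePoly LWord)} (h : rawSystemOk S = true)
    (h' : rawSystemOk S' = true) (hS : encRawSystem S = encRawSystem S') : S = S' := by
  rw [← parseSystem_enc h, hS, parseSystem_enc h']

theorem encSystem_eq_raw {F : Type*} (φ : F → LWord) (S : List (SparsePoly F)) :
    encSystem φ S = encRawSystem (S.map (SparsePoly.mapF φ)) := by
  have : SparsePoly.enc φ = fun f => encRawPoly (SparsePoly.mapF φ f) := funext fun f => by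
    simp [encRawPoly, encList, SparsePoly.enc, SparsePoly.mapF, List.flatMap_map]
  simp only [encRawSystem, encSystem, encList, List.flatMap_map, this]

theorem rawSystemOk_map {F : Type*} {φ : F → LWord} (hφ : ∀ a, isItem (φ a) = true)
    (S : List (SparsePoly F)) : rawSystemOk (S.map (SparsePoly.mapF φ)) = true := by
  simp [rawSystemOk, SparsePoly.mapF, hφ]

/-! ### Circuits -/

namespace Gate

variable {V F G : Type*}

def mapF (φ : F → G) : Gate V F → Gate V G
  | var v => var v
  | const c => const (φ c)
  | mul j k => mul j k
  | inv j => inv j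
  | lin l => lin (l.map fun t => (φ t.1, t.2))

/-- The constants that occur in a gate. -/
def coefs : Gate V F → List F
  | const c => [c]
  | lin l => l.map Prod.fst
  | _ => []

theorem coefs_mapF (φ : F → G) (g : Gate V F) : (g.mapF φ).coefs = g.coefs.map φ := by
  cases g <;> simp [mapF, coefs]

end Gate

abbrev RawGate := Gate ℕ LWord

abbrev encRawLin (l : List (LWord × ℕ)) : LWord := encList (fun t : LWord × ℕ => t.1 ++ encNat t.2) l

/-- The bracketed expressions that make up the encoding of a gate. -/
def gateItems : RawGate → List LWord
  | .var v => [encNat 0, encNat v]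
  | .const c => [encNat 1, c]
  | .mul j k => [encNat 2, encNat j, encNat k]
  | .inv j => [encNat 3, encNat j]
  | .lin l => [encNat 4, encRawLin l]

abbrev encRawGate (g : RawGate) : LWord := g.enc encNat fun w => w

theorem flatten_gateItems (g : RawGate) : (gateItems g).flatten = encRawGate g := by
  cases g <;> simp [gateItems, encRawGate, Gate.enc]

def rawGateOk (g : RawGate) : Bool := g.coefs.all isItem

theorem isItem_of_mem_gateItems {g : RawGate} (h : rawGateOk g = true) :
    ∀ w ∈ gateItems g, isItem w = true := by
  cases g with
  | lin l =>
    have h' : ∀ t ∈ l, isItem t.1 = true := by simpa [rawGateOk, Gate.coefs] using h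
    simp only [gateItems, List.mem_cons, List.not_mem_nil, or_false, forall_eq_or_imp, forall_eq,
      isItem_encNat, true_and]
    exact isItem_encList fun t ht => (Bal.of_isItem (h' _ ht)).append
      (Bal.of_isItem (isItem_encNat _))
  | const c =>
    have h' : isItem c = true := by simpa [rawGateOk, Gate.coefs] using h
    simp [gateItems, isItem_encNat, h']
  | _ => simp [gateItems, isItem_encNat]

/-- One step of grouping expressions into gates; the state consists of the expressions of the
current gate and the groups found so far. -/
def groupStep (s : List LWord × List (List LWord)) (w : LWord) : List LWord × List (List LWord) :=
  match s.1 with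
  | [] => ([w], s.2)
  -- Products, the gates of type 2, are the only ones written with three expressions; all others
  -- have two.
  | t :: r => if (decide (t = encNat 2) && r.isEmpty) = true then (t :: w :: r, s.2)
      else ([], ((s.1 ++ [w])) :: s.2)

def groupGates (l : List LWord) : List (List LWord) := (l.foldl groupStep ([], [])).2.reverse

theorem groupStep_gateItems (g : RawGate) (done : List (List LWord)) :
    (gateItems g).foldl groupStep ([], done) = ([], gateItems g :: done) := by
  have hne : ∀ n, n ≠ 2 → encNat n ≠ encNat 2 := fun n hn h => hn (encNat_injective h)
  cases g <;> simp [gateItems, groupStep, hne]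

theorem groupGates_flatMap (c : List RawGate) :
    groupGates (c.flatMap gateItems) = c.map gateItems := by
  have key : ∀ (c : List RawGate) done, (c.flatMap gateItems).foldl groupStep ([], done) =
      ([], (c.map gateItems).reverse ++ done) := by
    intro c
    induction c with
    | nil => intro done; rfl
    | cons g c ih =>
      intro done
      rw [List.flatMap_cons, List.foldl_append, groupStep_gateItems, ih]
      simp
  unfold groupGates
  rw [key]; simp

def parseLin (w : LWord) : List (LWord × ℕ) :=
  (pairUp (splitItems (unbracket w))).map fun p => (p.1, decNat p.2)

theorem parseLin_enc {l : List (LWord × ℕ)} (h : ∀ t ∈ l, isItem t.1 = true) :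
    parseLin (encRawLin l) = l := by
  unfold parseLin encRawLin
  rw [splitItems_inner_encList_pair h fun _ _ => isItem_encNat _]
  simp [Function.comp_def, decNat_encNat]

/-- The gate made up of the given expressions. -/
def toGate (l : List LWord) : RawGate :=
  let t := l.headD []
  let a := l.tail.headD []
  if t = encNat 0 then .var (decNat a)
  else if t = encNat 1 then .const a
  else if t = encNat 2 then .mul (decNat a) (decNat (l.tail.tail.headD []))
  else if t = encNat 3 then .inv (decNat a)
  else .lin (parseLin a)

theorem toGate_gateItems {g : RawGate} (h : rawGateOk g = true) : toGate (gateItems g) = g := by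
  have hne : ∀ m n, encNat m = encNat n ↔ m = n := fun m n =>
    ⟨fun h => encNat_injective h, fun h => by rw [h]⟩
  cases g with
  | lin l =>
    have h' : ∀ t ∈ l, isItem t.1 = true := by
      simpa [rawGateOk, Gate.coefs] using h
    simp [toGate, gateItems, hne, parseLin_enc h']
  | _ => simp [toGate, gateItems, hne, decNat_encNat]

def parseCircuit (w : LWord) : Circuit ℕ LWord := (groupGates (splitItems (unbracket w))).map toGate

abbrev encRawCircuit (c : Circuit ℕ LWord) : LWord := c.enc encNat fun w => w

def rawCircuitOk (c : Circuit ℕ LWord) : Bool := c.all rawGateOk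

theorem parseCircuit_enc {c : Circuit ℕ LWord} (h : rawCircuitOk c = true) :
    parseCircuit (encRawCircuit c) = c := by
  have h' : ∀ g ∈ c, rawGateOk g = true := by simpa [rawCircuitOk] using h
  have e : c.flatMap encRawGate = (c.flatMap gateItems).flatten := by
    rw [List.flatMap_def, List.flatMap_def, List.flatten_flatten, List.map_map]
    congr 1
    exact List.map_congr_left fun g _ => (flatten_gateItems g).symm
  unfold parseCircuit encRawCircuit Circuit.enc encList
  rw [unbracket_bracket, e, splitItems_flatten, groupGates_flatMap, List.map_map]
  · conv_rhs => rw [← List.map_id c]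
    exact List.map_congr_left fun g hg => toGate_gateItems (h' g hg)
  · intro w hw
    obtain ⟨g, hg, hw⟩ := List.mem_flatMap.1 hw
    exact isItem_of_mem_gateItems (h' g hg) w hw

theorem encRawCircuit_injective {c c' : Circuit ℕ LWord} (h : rawCircuitOk c = true)
    (h' : rawCircuitOk c' = true) (hc : encRawCircuit c = encRawCircuit c') : c = c' := by
  rw [← parseCircuit_enc h, hc, parseCircuit_enc h']

theorem Gate.enc_eq_raw {F : Type*} (φ : F → LWord) (g : Gate ℕ F) :
    g.enc encNat φ = encRawGate (g.mapF φ) := by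
  cases g <;> simp [Gate.enc, encRawGate, Gate.mapF, encList, List.flatMap_map]

theorem Circuit.enc_eq_raw {F : Type*} (φ : F → LWord) (c : Circuit ℕ F) :
    c.enc encNat φ = encRawCircuit (c.map (Gate.mapF φ)) := by
  have : Gate.enc encNat φ = fun g => encRawGate (g.mapF φ) := funext (Gate.enc_eq_raw φ)
  simp only [Circuit.enc, encRawCircuit, encList, List.flatMap_map, this]

theorem rawCircuitOk_map {F : Type*} {φ : F → LWord} (hφ : ∀ a, isItem (φ a) = true)
    (c : Circuit ℕ F) : rawCircuitOk (c.map (Gate.mapF φ)) = true := by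
  simp [rawCircuitOk, rawGateOk, Gate.coefs_mapF, hφ]

/-! ### Parsing and writing of systems and circuits in polynomial time. -/

theorem size_reverse {α : Type} [TreeEnc α] (l : List α) : size l.reverse = size l := by
  induction l with
  | nil => rfl
  | cons a l ih =>
    have := PT.size_le_list_append l.reverse [a]
    rw [List.reverse_cons]
    simp only [size_cons, size_nil] at *
    omega

theorem size_Letter_le (a : Letter) : size a ≤ 9 := size_letter_le a

/-- The sum that represents a gate as data. -/
def gateSum : RawGate → ℕ ⊕ (LWord ⊕ ((ℕ × ℕ) ⊕ (ℕ ⊕ List (LWord × ℕ))))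
  | .var v => .inl v
  | .const c => .inr (.inl c)
  | .mul j k => .inr (.inr (.inl (j, k)))
  | .inv j => .inr (.inr (.inr (.inl j)))
  | .lin l => .inr (.inr (.inr (.inr l)))

def sumGate : ℕ ⊕ (LWord ⊕ ((ℕ × ℕ) ⊕ (ℕ ⊕ List (LWord × ℕ)))) → RawGate
  | .inl v => .var v
  | .inr (.inl c) => .const c
  | .inr (.inr (.inl p)) => .mul p.1 p.2
  | .inr (.inr (.inr (.inl j))) => .inv j
  | .inr (.inr (.inr (.inr l))) => .lin l

theorem sumGate_gateSum (g : RawGate) : sumGate (gateSum g) = g := by cases g <;> rfl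

theorem gateSum_sumGate (s) : gateSum (sumGate s) = s := by
  rcases s with _ | _ | _ | _ | _ <;> rfl

instance : TreeEnc RawGate := ⟨fun g => TreeEnc.enc (gateSum g)⟩

namespace PT

variable {E : StackEnv} {α β γ δ : Type} [TreeEnc α] [TreeEnc β] [TreeEnc γ] [TreeEnc δ]

theorem inl {f : α → β} (hf : PT E f) : PT E fun a => (Sum.inl (f a) : β ⊕ γ) := by
  have h : PT E fun a => (false, f a) := (const false).pair hf
  obtain ⟨p, T, hp⟩ := h
  exact ⟨p, T, hp⟩

theorem inr {f : α → γ} (hf : PT E f) : PT E fun a => (Sum.inr (f a) : β ⊕ γ) := by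
  have h : PT E fun a => (true, f a) := (const true).pair hf
  obtain ⟨p, T, hp⟩ := h
  exact ⟨p, T, hp⟩

theorem ofSumGate {f : α → _} (hf : PT E f) : PT E fun a => sumGate (f a) :=
  (of_enc_eq fun s => by
    show TreeEnc.enc (gateSum (sumGate s)) = _
    rw [gateSum_sumGate]).comp hf

theorem gateVar {f : α → ℕ} (hf : PT E f) : PT E fun a => (Gate.var (f a) : RawGate) :=
  hf.inl.ofSumGate

theorem gateConst {f : α → LWord} (hf : PT E f) : PT E fun a => (Gate.const (f a) : RawGate) :=
  hf.inl.inr.ofSumGate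

theorem gateMul {f g : α → ℕ} (hf : PT E f) (hg : PT E g) :
    PT E fun a => (Gate.mul (f a) (g a) : RawGate) :=
  (hf.pair hg).inl.inr.inr.ofSumGate

theorem gateInv {f : α → ℕ} (hf : PT E f) : PT E fun a => (Gate.inv (f a) : RawGate) :=
  hf.inl.inr.inr.inr.ofSumGate

theorem gateLin {f : α → List (LWord × ℕ)} (hf : PT E f) :
    PT E fun a => (Gate.lin (f a) : RawGate) :=
  hf.inr.inr.inr.inr.ofSumGate

/-- Case distinction on a gate. -/
theorem gateCases {f : RawGate × γ → δ}
    (hvar : PT E fun p : ℕ × γ => f (.var p.1, p.2))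
    (hconst : PT E fun p : LWord × γ => f (.const p.1, p.2))
    (hmul : PT E fun p : (ℕ × ℕ) × γ => f (.mul p.1.1 p.1.2, p.2))
    (hinv : PT E fun p : ℕ × γ => f (.inv p.1, p.2))
    (hlin : PT E fun p : List (LWord × ℕ) × γ => f (.lin p.1, p.2)) : PT E f := by
  have h : PT E fun p : (ℕ ⊕ (LWord ⊕ ((ℕ × ℕ) ⊕ (ℕ ⊕ List (LWord × ℕ))))) × γ =>
      f (sumGate p.1, p.2) :=
    sumCases hvar (sumCases hconst (sumCases hmul (sumCases hinv hlin)))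
  have hg : PT E gateSum := of_enc_eq fun _ => rfl
  have h2 : PT E fun p : RawGate × γ => f (sumGate (gateSum p.1), p.2) :=
    h.comp ((hg.comp fst).pair snd)
  simpa only [sumGate_gateSum] using h2

theorem encNat {f : α → ℕ} (hf : PT E f) : PT E fun a => encNat (f a) :=
  cons (const _) (append (map (g := fun _ => encBit) hf.bits ((finFun _).comp snd))
    (const [Letter.rp]))

theorem encList {l : α → List β} {g : α → β → LWord} (hl : PT E l)
    (hg : PT E fun p : α × β => g p.1 p.2) : PT E fun a => encList (g a) (l a) :=
  cons (const _) (append (flatMap hl hg) (const [Letter.rp]))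

theorem isItem {f : α → LWord} (hf : PT E f) : PT E fun a => isItem (f a) := by
  suffices h : PT E fun w : LWord => _root_.isItem w from h.comp hf
  -- The state consists of the depth in unary, whether the outermost bracket has been closed, and
  -- whether nothing has come after that.
  let step : Letter → List Unit × (Bool × Bool) → List Unit × (Bool × Bool) := fun a s =>
    bif s.2.1 then (s.1, true, false) else
      match a with
      | .lp => (() :: s.1, s.2)
      | .rp => match s.1 with
        | [] => ([], true, s.2.2)
        | _ :: d => (d, s.2)
      | _ => s
  have hstep : PT E fun p : Letter × (List Unit × (Bool × Bool)) => step p.1 p.2 := by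
    refine finCases fun a => ?_
    cases a
    · exact cond snd.p1 (fst.pair (const (true, false))) id
    · exact cond snd.p1 (fst.pair (const (true, false))) id
    · exact cond snd.p1 (fst.pair (const (true, false))) ((cons (const ()) fst).pair snd)
    · refine cond snd.p1 (fst.pair (const (true, false))) ?_
      exact (listMatch (g := fun (s : List Unit × (Bool × Bool)) _ d => (d, s.2)) fst
        ((const []).pair ((const true).pair snd.p2)) (snd.p2.pair fst.p2)).congr
        fun ⟨d, _⟩ => by cases d <;> rfl
  have hs : PT E fun w : LWord => w.foldl (fun s a => step a s) ([], false, true) := by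
    refine foldl_of_growth (step := fun _ s a => step a s) id (const ([], false, true))
      (comp₂ (g := step) hstep snd fst.p2) 20 fun w s a _ => ?_
    obtain ⟨d, b, c⟩ := s
    have hb := size_bool_le b
    have hc := size_bool_le c
    have ht : size true = 3 := rfl
    have hf : size false = 1 := rfl
    have hu : size () = 1 := rfl
    cases b
    · cases a
      · simp [step]
      · simp [step]
      · simp only [step, cond_false, size_pair, size_cons, Polynomial.eval_ofNat]
        omega
      · cases d with
        | nil =>
          simp only [step, cond_false, size_pair, size_nil, Polynomial.eval_ofNat]
          omega
        | cons u d =>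
          simp only [step, cond_false, size_pair, size_cons, Polynomial.eval_ofNat]
          omega
    · simp only [step, cond_true, size_pair, Polynomial.eval_ofNat]
      omega
  have h2 : PT E fun w : LWord => (w.tail.foldl (fun s a => step a s) ([], false, true)) :=
    hs.comp (tail id)
  refine ((letterEq (headD Letter.rp id) (const Letter.lp)).and (h2.p2.p1.and h2.p2.p2)).congr
    fun w => ?_
  have fin : ∀ (w : LWord) d b, w.foldl (fun s a => step a s) (d, true, b) =
      (d, true, b && w.isEmpty) := by
    intro w
    induction w with
    | nil => intro d b; simp
    | cons a w ih => intro d b; simp [step, ih]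
  have key : ∀ (w : LWord) (d : List Unit),
      ((w.foldl (fun s a => step a s) (d, false, true)).2.1 &&
        (w.foldl (fun s a => step a s) (d, false, true)).2.2) = closes d.length w := by
    intro w
    induction w with
    | nil => intro d; simp [closes]
    | cons a w ih =>
      intro d
      rw [List.foldl_cons]
      cases a with
      | b0 => simp only [step, cond_false]; rw [ih]; cases d <;> rfl
      | b1 => simp only [step, cond_false]; rw [ih]; cases d <;> rfl
      | lp => simp only [step, cond_false]; rw [ih]; cases d <;> rfl
      | rp =>
        cases d with
        | nil => simp only [step, cond_false]; rw [fin]; simp [closes]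
        | cons u d => simp only [step, cond_false]; rw [ih]; rfl
  cases w with
  | nil => rfl
  | cons a w =>
    rw [List.tail_cons, key]
    cases a <;> simp [_root_.isItem]

theorem splitItems {f : α → LWord} (hf : PT E f) : PT E fun a => splitItems (f a) := by
  suffices h : PT E fun w : LWord => _root_.splitItems w from h.comp hf
  have hstep : PT E fun p : Letter × (List Unit × (LWord × List LWord)) => splitStep p.2 p.1 := by
    refine finCases fun a => ?_
    cases a
    · exact fst.pair ((cons (const _) snd.p1).pair snd.p2)
    · exact fst.pair ((cons (const _) snd.p1).pair snd.p2)
    · exact (cons (const ()) fst).pair ((cons (const _) snd.p1).pair snd.p2)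
    · refine (listMatch (g := fun (s : List Unit × (LWord × List LWord)) u d =>
        (u :: d, Letter.rp :: s.2.1, s.2.2)) (tail fst)
        ((const []).pair ((const []).pair (cons (reverse (cons (const .rp) snd.p1)) snd.p2)))
        ((cons snd.p1 snd.p2).pair ((cons (const _) fst.p2.p1).pair fst.p2.p2))).congr
        fun ⟨d, _⟩ => ?_
      rcases d with _ | ⟨u, _ | ⟨v, d⟩⟩ <;> rfl
  have hs : PT E fun w : LWord => w.foldl splitStep ([], [], []) := by
    refine foldl_of_growth (step := fun _ => splitStep) id (const _)
      (comp₂ (g := fun a s => splitStep s a) hstep snd fst.p2) 20 fun w s a _ => ?_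
    obtain ⟨d, cur, done⟩ := s
    have hu : size () = 1 := rfl
    have ha := size_Letter_le a
    cases a
    · simp only [splitStep, size_pair, size_cons, Polynomial.eval_ofNat]; omega
    · simp only [splitStep, size_pair, size_cons, Polynomial.eval_ofNat]; omega
    · simp only [splitStep, size_pair, size_cons, Polynomial.eval_ofNat]; omega
    · simp only [splitStep]
      rcases d with _ | ⟨u, _ | ⟨v, d⟩⟩
      · simp only [List.tail_nil, size_pair, size_cons, size_nil, size_reverse,
          Polynomial.eval_ofNat]
        omega
      · simp only [List.tail_cons, size_pair, size_cons, size_nil, size_reverse,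
          Polynomial.eval_ofNat]
        omega
      · simp only [List.tail_cons, size_pair, size_cons, Polynomial.eval_ofNat]
        omega
  exact hs.p2.p2.reverse

theorem unbracket {f : α → LWord} (hf : PT E f) : PT E fun a => unbracket (f a) :=
  hf.tail.reverse.tail.reverse

theorem pairUp {f : α → List β} (hf : PT E f) : PT E fun a => pairUp (f a) := by
  suffices h : PT E fun l : List β => _root_.pairUp l from h.comp hf
  let step : List β × List (β × β) → β → List β × List (β × β) := fun s a =>
    match s.1 with
    | [] => ([a], s.2)
    | b :: _ => ([], (b, a) :: s.2)
  have hstep : PT E fun p : (List β × (List β × List (β × β))) × β => step p.1.2 p.2 :=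
    listMatch (f := fun p => ([p.2], p.1.2.2)) (g := fun p b _ => ([], (b, p.2) :: p.1.2.2)) fst.p2.p1
      ((cons snd (const [])).pair fst.p2.p2)
      ((const []).pair (cons (snd.p1.pair fst.p2) fst.p1.p2.p2))
  have hs : PT E fun l : List β => l.foldl step ([], []) := by
    refine foldl_of_growth (step := fun _ => step) id (const _) hstep (.X + 10) fun l s a ha => ?_
    have h1 := size_le_of_mem ha
    obtain ⟨p, acc⟩ := s
    cases p with
    | nil =>
      simp only [step, size_pair, size_cons, size_nil, Polynomial.eval_ofNat, Polynomial.eval_add,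
        Polynomial.eval_X]
      omega
    | cons b p =>
      simp only [step, size_pair, size_cons, size_nil, Polynomial.eval_ofNat, Polynomial.eval_add,
        Polynomial.eval_X]
      omega
  refine hs.p2.reverse.congr fun l => ?_
  have key : ∀ (n : ℕ) (l : List β), l.length ≤ n → ∀ acc,
      (l.foldl step ([], acc)).2.reverse = acc.reverse ++ _root_.pairUp l := by
    intro n
    induction n with
    | zero =>
      intro l hl acc
      have : l = [] := List.length_eq_zero_iff.1 (by omega)
      subst this; simp [_root_.pairUp]
    | succ n ih =>
      intro l hl acc
      rcases l with _ | ⟨a, _ | ⟨b, l⟩⟩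
      · simp [_root_.pairUp]
      · simp [_root_.pairUp, step]
      · simp only [List.foldl_cons, step]
        rw [ih l (by simp at hl; omega)]
        simp [_root_.pairUp]
  rw [key l.length l le_rfl]; simp

theorem decNat {f : α → LWord} (hf : PT E f) : PT E fun a => decNat (f a) :=
  ofBits (flatMap hf ((finFun fun a : Letter =>
    (match a with | .b0 => [false] | .b1 => [true] | _ => [] : List Bool)).comp snd))

theorem parseMono {f : α → LWord} (hf : PT E f) : PT E fun a => parseMono (f a) :=
  map (g := fun _ (p : LWord × LWord) => (_root_.decNat p.1, _root_.decNat p.2)) hf.unbracket.splitItems.pairUp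
    (snd.p1.decNat.pair snd.p2.decNat)

theorem parsePoly {f : α → LWord} (hf : PT E f) : PT E fun a => parsePoly (f a) :=
  map (g := fun _ (p : LWord × LWord) => (p.1, _root_.parseMono p.2)) hf.unbracket.splitItems.pairUp
    (snd.p1.pair snd.p2.parseMono)

theorem parseSystem {f : α → LWord} (hf : PT E f) : PT E fun a => parseSystem (f a) :=
  map (g := fun _ p => _root_.parsePoly p) hf.unbracket.splitItems snd.parsePoly

theorem parseLin {f : α → LWord} (hf : PT E f) : PT E fun a => parseLin (f a) :=
  map (g := fun _ (p : LWord × LWord) => (p.1, _root_.decNat p.2)) hf.unbracket.splitItems.pairUp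
    (snd.p1.pair snd.p2.decNat)

theorem groupGates {f : α → List LWord} (hf : PT E f) : PT E fun a => groupGates (f a) := by
  suffices h : PT E fun l : List LWord => _root_.groupGates l from h.comp hf
  have hstep : PT E fun p : (List LWord × (List LWord × List (List LWord))) × LWord =>
      groupStep p.1.2 p.2 := by
    refine (listMatch (f := fun p : (List LWord × (List LWord × List (List LWord))) × LWord =>
        ([p.2], p.1.2.2)) (g := fun p t r => if (decide (t = _root_.encNat 2) && r.isEmpty) = true
        then (t :: p.2 :: r, p.1.2.2) else ([], (p.1.2.1 ++ [p.2]) :: p.1.2.2)) fst.p2.p1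
      ((cons snd (const [])).pair fst.p2.p2) ?_).congr
      fun ⟨⟨_, ⟨d, _⟩⟩, _⟩ => by cases d <;> rfl
    refine (cond ((wordEq snd.p1 (const (_root_.encNat 2))).and snd.p2.isEmpty)
      ((cons snd.p1 (cons fst.p2 snd.p2)).pair fst.p1.p2.p2)
      ((const []).pair (cons (append fst.p1.p2.p1 (cons fst.p2 (const []))) fst.p1.p2.p2))).congr
      fun p => ?_
    cases (decide (p.2.1 = _root_.encNat 2) && p.2.2.isEmpty) <;> rfl
  have hs : PT E fun l : List LWord => l.foldl groupStep ([], []) := by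
    refine foldl_of_growth (step := fun _ => groupStep) id (const _) hstep (.X + 10)
      fun l s a ha => ?_
    have h1 := size_le_of_mem ha
    obtain ⟨p, acc⟩ := s
    simp only [Polynomial.eval_ofNat, Polynomial.eval_add, Polynomial.eval_X]
    cases p with
    | nil =>
      simp only [groupStep, size_pair, size_cons, size_nil]
      omega
    | cons t r =>
      simp only [groupStep]
      split
      · simp only [size_pair, size_cons]; omega
      · have := size_le_list_append (t :: r) [a]
        simp only [size_pair, size_cons, size_nil] at *
        omega
  exact hs.p2.reverse

theorem toGate {f : α → List LWord} (hf : PT E f) : PT E fun a => toGate (f a) := by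
  suffices h : PT E fun l : List LWord => _root_.toGate l from h.comp hf
  have ha : PT E fun l : List LWord => l.tail.headD [] := headD [] (tail id)
  have ht : PT E fun l : List LWord => l.headD [] := headD [] id
  exact ite (wordEq ht (const _)) ha.decNat.gateVar (ite (wordEq ht (const _)) ha.gateConst
    (ite (wordEq ht (const _)) (gateMul ha.decNat (headD [] (tail (tail id))).decNat)
      (ite (wordEq ht (const _)) ha.decNat.gateInv ha.parseLin.gateLin)))

theorem parseCircuit {f : α → LWord} (hf : PT E f) : PT E fun a => parseCircuit (f a) :=
  map (g := fun _ p => _root_.toGate p) hf.unbracket.splitItems.groupGates snd.toGate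

theorem encRawPoly {f : α → SparsePoly LWord} (hf : PT E f) : PT E fun a => encRawPoly (f a) :=
  encList (g := fun _ (t : LWord × List (ℕ × ℕ)) => t.1 ++ encMono t.2) hf (append snd.p1
    (encList (g := fun _ (m : ℕ × ℕ) => _root_.encNat m.1 ++ _root_.encNat m.2) snd.p2
      (append snd.p1.encNat snd.p2.encNat)))

theorem encRawSystem {f : α → List (SparsePoly LWord)} (hf : PT E f) :
    PT E fun a => encRawSystem (f a) :=
  encList (g := fun _ p => _root_.encRawPoly p) hf snd.encRawPoly

theorem encRawGate {f : α → RawGate} (hf : PT E f) : PT E fun a => encRawGate (f a) := by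
  have h : PT E fun p : RawGate × Unit => _root_.encRawGate p.1 := by
    refine gateCases ?_ ?_ ?_ ?_ ?_
    · exact append (const _) fst.encNat
    · exact append (const _) fst
    · exact append (append (const _) fst.p1.encNat) fst.p2.encNat
    · exact append (const _) fst.encNat
    · exact append (const _) (encList (g := fun _ (t : LWord × ℕ) => t.1 ++ _root_.encNat t.2) fst
        (append snd.p1 snd.p2.encNat))
  exact h.comp (hf.pair (const ()))

theorem encRawCircuit {f : α → Circuit ℕ LWord} (hf : PT E f) : PT E fun a => encRawCircuit (f a) :=
  encList (g := fun _ p => _root_.encRawGate p) hf snd.encRawGate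

theorem rawSystemOk {f : α → List (SparsePoly LWord)} (hf : PT E f) :
    PT E fun a => rawSystemOk (f a) :=
  all (g := fun _ (p : SparsePoly LWord) => p.all fun t => _root_.isItem t.1) hf
    (all (g := fun _ (t : LWord × List (ℕ × ℕ)) => _root_.isItem t.1) snd snd.p1.isItem)

theorem rawCircuitOk {f : α → Circuit ℕ LWord} (hf : PT E f) : PT E fun a => rawCircuitOk (f a) := by
  have h : PT E fun p : RawGate × Unit => p.1.coefs := by
    refine gateCases (const []) (cons fst (const [])) (const []) (const []) ?_
    exact map (g := fun _ => Prod.fst) fst snd.p1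
  have h2 : PT E fun g : RawGate => g.coefs := h.comp (id.pair (const ()))
  exact all (g := fun _ (g : RawGate) => g.coefs.all _root_.isItem) hf
    (all (g := fun _ => _root_.isItem) (h2.comp snd) snd.isItem)

end PT

/-! ## Circuits -/

/-- The values at the gates of a list, computed one after the other. -/
def scanGates {G R : Type*} (step : List R → G → R) (c : List G) : List R :=
  c.foldl (fun acc g => acc ++ [step acc g]) []

section ScanGates

variable {G R : Type*} (step : List R → G → R)

theorem scanGates_concat (c : List G) (g : G) :
    scanGates step (c ++ [g]) = scanGates step c ++ [step (scanGates step c) g] := by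
  simp [scanGates]

theorem length_scanGates (c : List G) : (scanGates step c).length = c.length := by
  induction c using List.reverseRecOn with
  | nil => rfl
  | append_singleton c g ih => simp [scanGates_concat, ih]

theorem scanGates_prefix (c d : List G) : scanGates step c <+: scanGates step (c ++ d) := by
  induction d using List.reverseRecOn with
  | nil => simp
  | append_singleton d g ih =>
    rw [← List.append_assoc, scanGates_concat]
    exact ih.trans (List.prefix_append _ _)

theorem getD_scanGates_append (c d : List G) {i : ℕ} (hi : i < c.length) (x : R) :
    (scanGates step (c ++ d)).getD i x = (scanGates step c).getD i x := by
  obtain ⟨e, he⟩ := scanGates_prefix step c d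
  rw [← he, List.getD_append _ _ _ _ (by rwa [length_scanGates])]

theorem getD_scanGates_concat (c : List G) (g : G) (x : R) :
    (scanGates step (c ++ [g])).getD c.length x = step (scanGates step c) g := by
  rw [scanGates_concat, List.getD_append_right _ _ _ _ (by rw [length_scanGates])]
  simp [length_scanGates]

end ScanGates

namespace Circuit

variable {V F : Type*}

theorem synConsts_concat (c : Circuit V F) (g : Gate V F) :
    synConsts (c ++ [g]) = synConsts c ++ [g.synConst (synConsts c)] :=
  scanGates_concat (fun acc (g : Gate V F) => g.synConst acc) c g

theorem length_synConsts (c : Circuit V F) : (synConsts c).length = c.length :=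
  length_scanGates (fun acc (g : Gate V F) => g.synConst acc) c

theorem getD_synConsts_append (c d : Circuit V F) {i : ℕ} (hi : i < c.length) :
    (synConsts (c ++ d)).getD i false = (synConsts c).getD i false :=
  getD_scanGates_append (fun acc (g : Gate V F) => g.synConst acc) c d hi false

theorem getD_synConsts_concat (c : Circuit V F) (g : Gate V F) :
    (synConsts (c ++ [g])).getD c.length false = g.synConst (synConsts c) :=
  getD_scanGates_concat (fun acc (g : Gate V F) => g.synConst acc) c g false

theorem lt_length_of_synConsts {c : Circuit V F} {i : ℕ} (h : (synConsts c).getD i false = true) :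
    i < c.length := by
  by_contra hi
  rw [List.getD_eq_default _ _ (by rw [length_synConsts]; omega)] at h
  simp at h

variable [Field F]

theorem polys_concat (c : Circuit V F) (g : Gate V F) :
    polys (c ++ [g]) = polys c ++ [g.poly (polys c)] :=
  scanGates_concat (fun acc (g : Gate V F) => g.poly acc) c g

theorem length_polys (c : Circuit V F) : (polys c).length = c.length :=
  length_scanGates (fun acc (g : Gate V F) => g.poly acc) c

theorem getD_polys_append (c d : Circuit V F) {i : ℕ} (hi : i < c.length) :
    (polys (c ++ d)).getD i 0 = (polys c).getD i 0 :=
  getD_scanGates_append (fun acc (g : Gate V F) => g.poly acc) c d hi 0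

theorem getD_polys_concat (c : Circuit V F) (g : Gate V F) :
    (polys (c ++ [g])).getD c.length 0 = g.poly (polys c) :=
  getD_scanGates_concat (fun acc (g : Gate V F) => g.poly acc) c g 0

/-- The conditions on a gate at the end of a circuit. -/
def GateValid (c : Circuit V F) (g : Gate V F) : Prop :=
  (∀ j ∈ g.args, j < c.length) ∧
    ∀ j, g = Gate.inv j → (synConsts c).getD j false = true ∧ (polys c).getD j 0 ≠ 0

theorem valid_nil : Valid ([] : Circuit V F) := fun i g h => by simp at h

/-- The conditions on a gate concern earlier positions only, and these are unaffected by further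
gates. This makes induction on the last gate the standard argument about circuits. -/
theorem valid_concat {c : Circuit V F} {g : Gate V F} :
    Valid (c ++ [g]) ↔ Valid c ∧ GateValid c g := by
  constructor
  · intro h
    refine ⟨fun i g' hg' => ?_, ?_⟩
    · have hi : i < c.length := (List.getElem?_eq_some_iff.1 hg').1
      have := h i g' (by rw [List.getElem?_append_left hi, hg'])
      refine ⟨this.1, fun j hj => ?_⟩
      have hji : j < i := this.1 j (by subst hj; simp [Gate.args])
      have := this.2 j hj
      rwa [getD_synConsts_append _ _ (hji.trans hi), getD_polys_append _ _ (hji.trans hi)] at this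
    · have := h c.length g (by simp)
      refine ⟨this.1, fun j hj => ?_⟩
      have hji : j < c.length := this.1 j (by subst hj; simp [Gate.args])
      have := this.2 j hj
      rwa [getD_synConsts_append _ _ hji, getD_polys_append _ _ hji] at this
  · rintro ⟨h, hg⟩ i g' hg'
    rcases lt_or_ge i c.length with hi | hi
    · rw [List.getElem?_append_left hi] at hg'
      refine ⟨(h i g' hg').1, fun j hj => ?_⟩
      have hji : j < i := (h i g' hg').1 j (by subst hj; simp [Gate.args])
      rw [getD_synConsts_append _ _ (hji.trans hi), getD_polys_append _ _ (hji.trans hi)]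
      exact (h i g' hg').2 j hj
    · have hi' : i = c.length := by
        have := (List.getElem?_eq_some_iff.1 hg').1
        simp at this; omega
      subst hi'
      simp only [List.getElem?_concat_length, Option.some.injEq] at hg'
      subst hg'
      refine ⟨hg.1, fun j hj => ?_⟩
      have hji : j < c.length := hg.1 j (by subst hj; simp [Gate.args])
      rw [getD_synConsts_append _ _ hji, getD_polys_append _ _ hji]
      exact hg.2 j hj

/-- A syntactically constant gate computes a constant. -/
theorem eq_C_of_synConsts (c : Circuit V F) : ∀ i, (synConsts c).getD i false = true →
    ∃ a : F, (polys c).getD i 0 = MvPolynomial.C a := by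
  induction c using List.reverseRecOn with
  | nil => intro i h; simp [synConsts] at h
  | append_singleton c g ih =>
    intro i h
    rcases lt_or_ge i c.length with hi | hi
    · rw [getD_synConsts_append _ _ hi] at h
      rw [getD_polys_append _ _ hi]
      exact ih i h
    · have hi' : i = c.length := by
        have := lt_length_of_synConsts h
        simp at this; omega
      subst hi'
      rw [getD_synConsts_concat] at h
      rw [getD_polys_concat]
      cases g with
      | var v => simp [Gate.synConst] at h
      | const a => exact ⟨a, rfl⟩
      | mul j k =>
        simp only [Gate.synConst, Bool.and_eq_true] at h
        obtain ⟨a, ha⟩ := ih j h.1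
        obtain ⟨b, hb⟩ := ih k h.2
        exact ⟨a * b, by rw [Gate.poly, ha, hb, map_mul]⟩
      | inv j => exact ⟨_, rfl⟩
      | lin l =>
        simp only [Gate.synConst, List.all_eq_true] at h
        simp only [Gate.poly]
        induction l with
        | nil => exact ⟨0, by simp⟩
        | cons t l ihl =>
          obtain ⟨a, ha⟩ := ih t.2 (h t (by simp))
          obtain ⟨b, hb⟩ := ihl fun s hs => h s (by simp [hs])
          exact ⟨t.1 * a + b, by rw [List.map_cons, List.sum_cons, hb, ha, map_add, map_mul]⟩

theorem computes_iff {c : Circuit V F} {f : MvPolynomial V F} :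
    Computes c f ↔ Valid c ∧ c ≠ [] ∧ (polys c).getD (c.length - 1) 0 = f := by
  unfold Computes
  refine and_congr_right fun _ => ?_
  rcases List.eq_nil_or_concat' c with rfl | ⟨d, g, rfl⟩
  · simp [polys]
  · simp [polys_concat, length_polys]

end Circuit

/-! ### Building circuits -/

section Build

variable {V F : Type*} (encV : V → LWord) (encF : F → LWord)

/-- The weight of a gate, which does not depend on the positions of its arguments. -/
def Gate.weight : Gate V F → ℕ
  | var v => (encV v).length
  | const c => (encF c).length
  | lin l => (l.map fun t => (encF t.1).length + 1).sum
  | _ => 0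

theorem length_encNat_le (n : ℕ) : (encNat n).length ≤ n + 2 := by
  have := bits_length_le n
  simp only [encNat, List.length_cons, List.length_append, List.length_map, List.length_nil]
  omega

theorem length_encList {α : Type*} (f : α → LWord) (l : List α) :
    (encList f l).length = (l.map fun a => (f a).length).sum + 2 := by
  simp [encList, List.length_flatMap]

/-- A position below `N` is written with at most `N + 2` letters. This crude bound suffices for
polynomial size and leaves only the number of gates and their weights to be controlled. -/
theorem Gate.length_enc_le {g : Gate V F} {N : ℕ} (h : ∀ j ∈ g.args, j < N) :
    (g.enc encV encF).length ≤ 10 + (g.weight encV encF + 2) * (N + 3) := by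
  have h0 := length_encNat_le 0
  have h1 := length_encNat_le 1
  have h2 := length_encNat_le 2
  have h3 := length_encNat_le 3
  have h4 := length_encNat_le 4
  cases g with
  | var v => simp only [Gate.enc, Gate.weight, List.length_append]; nlinarith
  | const c => simp only [Gate.enc, Gate.weight, List.length_append]; nlinarith
  | mul j k =>
    have hj := length_encNat_le j
    have hk := length_encNat_le k
    have := h j (by simp [Gate.args])
    have := h k (by simp [Gate.args])
    simp only [Gate.enc, Gate.weight, List.length_append]
    omega
  | inv j =>
    have hj := length_encNat_le j
    have := h j (by simp [Gate.args])
    simp only [Gate.enc, Gate.weight, List.length_append]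
    omega
  | lin l =>
    simp only [Gate.enc, Gate.weight, List.length_append, length_encList]
    have key : (l.map fun t => (encF t.1).length + (encNat t.2).length).sum ≤
        (l.map fun t => (encF t.1).length + 1).sum * (N + 3) := by
      have h' : ∀ t ∈ l, t.2 < N := fun t ht => h t.2 (by
        simp only [Gate.args, List.mem_map]; exact ⟨t, ht, rfl⟩)
      rw [← List.sum_map_mul_right]
      refine List.sum_le_sum fun t ht => ?_
      have := length_encNat_le t.2
      have := h' t ht
      nlinarith
    nlinarith

/-- Some circuit with at most `n` gates of weight at most `W` computes all the given polynomials,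
the marked ones at syntactically constant gates. -/
def Built [Field F] (W n : ℕ) (S : Set (Bool × MvPolynomial V F)) : Prop :=
  ∃ D : Circuit V F, D.Valid ∧ D.length ≤ n ∧ (∀ g ∈ D, g.weight encV encF ≤ W) ∧
    ∀ p ∈ S, ∃ i < D.length, D.polys.getD i 0 = p.2 ∧ (p.1 = true → D.synConsts.getD i false = true)

variable {encV encF} [Field F] {W n m : ℕ} {S S' : Set (Bool × MvPolynomial V F)}

namespace Built

theorem mono (h : Built encV encF W n S) (hn : n ≤ m) (hS : S' ⊆ S) : Built encV encF W m S' := by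
  obtain ⟨D, h1, h2, h3, h4⟩ := h
  exact ⟨D, h1, h2.trans hn, h3, fun p hp => h4 p (hS hp)⟩

theorem empty : Built encV encF W 0 (∅ : Set (Bool × MvPolynomial V F)) :=
  ⟨[], Circuit.valid_nil, le_rfl, by simp, by simp⟩

theorem concat {D : Circuit V F} (h1 : D.Valid) (h2 : D.length ≤ n)
    (h3 : ∀ g ∈ D, g.weight encV encF ≤ W)
    (h4 : ∀ p ∈ S, ∃ i < D.length, D.polys.getD i 0 = p.2 ∧
      (p.1 = true → D.synConsts.getD i false = true)) {g : Gate V F} (hg : D.GateValid g)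
    (hW : g.weight encV encF ≤ W) {b : Bool} {p : MvPolynomial V F} (hp : g.poly D.polys = p)
    (hb : b = true → g.synConst D.synConsts = true) :
    Built encV encF W (n + 1) (insert (b, p) S) := by
  refine ⟨D ++ [g], Circuit.valid_concat.2 ⟨h1, hg⟩, by simpa using h2, fun g' hg' => ?_, ?_⟩
  · rcases List.mem_append.1 hg' with h | h
    · exact h3 g' h
    · rw [List.mem_singleton.1 h]; exact hW
  · rintro q (rfl | hq)
    · exact ⟨D.length, by simp, by rw [Circuit.getD_polys_concat]; exact hp, fun h => by
        rw [Circuit.getD_synConsts_concat]; exact hb h⟩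
    · obtain ⟨i, hi, h5, h6⟩ := h4 q hq
      refine ⟨i, by simp; omega, ?_, ?_⟩
      · rw [Circuit.getD_polys_append _ _ hi]; exact h5
      · rw [Circuit.getD_synConsts_append _ _ hi]; exact h6

theorem var (h : Built encV encF W n S) (v : V) (hW : (encV v).length ≤ W) :
    Built encV encF W (n + 1) (insert (false, MvPolynomial.X v) S) := by
  obtain ⟨D, h1, h2, h3, h4⟩ := h
  exact concat h1 h2 h3 h4 (g := .var v) ⟨by simp [Gate.args], by simp⟩ hW rfl (by simp)

theorem const (h : Built encV encF W n S) (c : F) (hW : (encF c).length ≤ W) :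
    Built encV encF W (n + 1) (insert (true, MvPolynomial.C c) S) := by
  obtain ⟨D, h1, h2, h3, h4⟩ := h
  exact concat h1 h2 h3 h4 (g := .const c) ⟨by simp [Gate.args], by simp⟩ hW rfl
    (by simp [Gate.synConst])

theorem mul (h : Built encV encF W n S) {a b : Bool} {p q : MvPolynomial V F} (hp : (a, p) ∈ S)
    (hq : (b, q) ∈ S) : Built encV encF W (n + 1) (insert (a && b, p * q) S) := by
  obtain ⟨D, h1, h2, h3, h4⟩ := h
  obtain ⟨i, hi, hip, hia⟩ := h4 _ hp
  obtain ⟨j, hj, hjp, hja⟩ := h4 _ hq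
  refine concat h1 h2 h3 h4 (g := .mul i j) ⟨by simp [Gate.args, hi, hj], by simp⟩ (Nat.zero_le _)
    (by rw [Gate.poly, hip, hjp]) fun hab => ?_
  simp only [Bool.and_eq_true] at hab
  rw [Gate.synConst, hia hab.1, hja hab.2]
  rfl

/-- The mark `true` on `p` supplies the syntactic constancy without which the inversion would not be
allowed. -/
theorem inv (h : Built encV encF W n S) {p : MvPolynomial V F} (hp : (true, p) ∈ S) (h0 : p ≠ 0) :
    Built encV encF W (n + 1)
      (insert (true, MvPolynomial.C (MvPolynomial.constantCoeff p)⁻¹) S) := by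
  obtain ⟨D, h1, h2, h3, h4⟩ := h
  obtain ⟨i, hi, hip, hia⟩ := h4 _ hp
  have hip : D.polys.getD i 0 = p := hip
  refine concat h1 h2 h3 h4 (g := .inv i) ⟨by simp [Gate.args, hi], fun j hj => ?_⟩ (Nat.zero_le _)
    (by rw [Gate.poly, hip]) fun _ => hia rfl
  obtain rfl : i = j := by simpa using hj
  exact ⟨hia rfl, hip ▸ h0⟩

theorem lin (h : Built encV encF W n S) (l : List (F × (Bool × MvPolynomial V F)))
    (hl : ∀ t ∈ l, t.2 ∈ S) (hW : (l.map fun t => (encF t.1).length + 1).sum ≤ W) :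
    Built encV encF W (n + 1) (insert (l.all fun t => t.2.1,
      (l.map fun t => MvPolynomial.C t.1 * t.2.2).sum) S) := by
  obtain ⟨D, h1, h2, h3, h4⟩ := h
  choose! f hf1 hf2 hf3 using h4
  refine concat h1 h2 h3 (fun p hp => ⟨f p, hf1 p hp, hf2 p hp, hf3 p hp⟩)
    (g := .lin (l.map fun t => (t.1, f t.2))) ⟨?_, by simp⟩ ?_ ?_ ?_
  · simp only [Gate.args, List.map_map, List.mem_map]
    rintro j ⟨t, ht, rfl⟩
    exact hf1 _ (hl t ht)
  · simpa [Gate.weight, Function.comp_def] using hW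
  · rw [Gate.poly, List.map_map]
    congr 1
    exact List.map_congr_left fun t ht => by rw [Function.comp_apply, hf2 _ (hl t ht)]
  · intro h
    simp only [List.all_eq_true] at h
    simp only [Gate.synConst, List.all_map, List.all_eq_true]
    exact fun t ht => hf3 _ (hl t ht) (h t ht)

/-- A circuit with the given polynomial at its last gate. -/
theorem computes (h : Built encV encF W n S) {b : Bool} {p : MvPolynomial V F} (hp : (b, p) ∈ S)
    (hW : (encF 1).length + 1 ≤ W) : ∃ D : Circuit V F, D.Computes p ∧
      (D.enc encV encF).length ≤ 2 + (n + 1) * (10 + (W + 2) * (n + 4)) := by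
  obtain ⟨D, h1, h2, h3, h4⟩ := h
  obtain ⟨i, hi, hip, -⟩ := h4 _ hp
  -- The output has to be the last gate, so gate `i` is copied there by a linear combination with
  -- the single coefficient 1.
  have hg : D.GateValid (.lin [(1, i)]) := ⟨by simp [Gate.args, hi], by simp⟩
  have hv := Circuit.valid_concat.2 ⟨h1, hg⟩
  refine ⟨_, Circuit.computes_iff.2 ⟨hv, by simp, ?_⟩, ?_⟩
  · have := Circuit.getD_polys_concat D (.lin [(1, i)])
    have hip : D.polys.getD i 0 = p := hip
    simp only [List.length_append, List.length_singleton, Nat.add_sub_cancel]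
    rw [this]
    simp only [Gate.poly, hip, List.map_cons, List.map_nil, List.sum_cons, List.sum_nil, map_one, one_mul,
      add_zero]
  · rw [Circuit.enc, length_encList, add_comm]
    refine Nat.add_le_add_left ?_ 2
    have hb : ∀ k ∈ (D ++ [Gate.lin [(1, i)]]).map fun g : Gate V F => (g.enc encV encF).length,
        k ≤ 10 + (W + 2) * (n + 4) := by
      intro k hk
      obtain ⟨g, hg, rfl⟩ := List.mem_map.1 hk
      obtain ⟨a, ha, hag⟩ := List.getElem_of_mem hg
      have := (hv a g (by rw [List.getElem?_eq_getElem ha, hag])).1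
      have hal : a ≤ n := by simp at ha; omega
      have hw : g.weight encV encF ≤ W := by
        rcases List.mem_append.1 hg with h | h
        · exact h3 g h
        · rw [List.mem_singleton.1 h]; simpa [Gate.weight] using hW
      refine (Gate.length_enc_le encV encF (N := n + 1) fun j hj => ?_).trans ?_
      · have := this j hj; omega
      · have : g.weight encV encF + 2 ≤ W + 2 := by omega
        have := Nat.mul_le_mul_right (n + 4) this
        exact Nat.add_le_add_left this 10
    have := List.sum_le_card_nsmul _ _ hb
    refine this.trans ?_
    simp only [List.length_map, List.length_append, List.length_singleton, smul_eq_mul]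
    exact Nat.mul_le_mul_right _ (by omega)

end Built

variable (encV encF)

/-- With `k` more gates one can compute `p` from `S`. -/
def Adds (W : ℕ) (S : Set (Bool × MvPolynomial V F)) (k : ℕ) (p : MvPolynomial V F) : Prop :=
  ∀ n S', S ⊆ S' → Built encV encF W n S' → Built encV encF W (n + k) (insert (false, p) S')

variable {encV encF}

namespace Adds

variable {k l : ℕ} {p q : MvPolynomial V F}

theorem of_mem {b : Bool} (h : (b, p) ∈ S) : Adds encV encF W S 0 p := fun n S' hS hB => by
  obtain ⟨D, h1, h2, h3, h4⟩ := hB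
  refine ⟨D, h1, h2, h3, ?_⟩
  rintro q (rfl | hq)
  · obtain ⟨i, hi, hip, -⟩ := h4 _ (hS h)
    exact ⟨i, hi, hip, by simp⟩
  · exact h4 q hq

theorem var (v : V) (hW : (encV v).length ≤ W) : Adds encV encF W S 1 (MvPolynomial.X v) :=
  fun _ _ _ hB => hB.var v hW

theorem weaken {b : Bool} (h : Built encV encF W n (insert (b, p) S)) :
    Built encV encF W n (insert (false, p) S) := by
  obtain ⟨D, h1, h2, h3, h4⟩ := h
  refine ⟨D, h1, h2, h3, ?_⟩
  rintro q (rfl | hq)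
  · obtain ⟨i, hi, hip, -⟩ := h4 (b, p) (by simp)
    exact ⟨i, hi, hip, by simp⟩
  · exact h4 q (by simp [hq])

theorem const (c : F) (hW : (encF c).length ≤ W) : Adds encV encF W S 1 (MvPolynomial.C c) :=
  fun _ _ _ hB => weaken (hB.const c hW)

/-- `Adds` quantifies over all larger sets `S'`, which is what permits building the second operand
after the first. -/
theorem binary {r : MvPolynomial V F} (hp : Adds encV encF W S k p) (hq : Adds encV encF W S l q)
    (h : ∀ n S', (false, p) ∈ S' → (false, q) ∈ S' → Built encV encF W n S' →
      Built encV encF W (n + 1) (insert (false, r) S')) : Adds encV encF W S (k + l + 1) r := by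
  intro n S' hS hB
  have h1 := hp n S' hS hB
  have h2 := hq _ _ (hS.trans (Set.subset_insert _ _)) h1
  have h3 := h _ _ (by simp) (by simp) h2
  refine h3.mono (by omega) (Set.insert_subset_insert ?_)
  exact (Set.subset_insert _ _).trans (Set.subset_insert _ _)

theorem mul (hp : Adds encV encF W S k p) (hq : Adds encV encF W S l q) :
    Adds encV encF W S (k + l + 1) (p * q) :=
  hp.binary hq fun _ _ h1 h2 hB => hB.mul h1 h2

theorem add (hp : Adds encV encF W S k p) (hq : Adds encV encF W S l q)
    (hW : 2 * ((encF 1).length + 1) ≤ W) : Adds encV encF W S (k + l + 1) (p + q) :=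
  hp.binary hq fun _ _ h1 h2 hB => by
    have := hB.lin [(1, (false, p)), (1, (false, q))] (by simp [h1, h2]) (by simp; omega)
    simpa using this

theorem sub (hp : Adds encV encF W S k p) (hq : Adds encV encF W S l q)
    (hW : (encF 1).length + (encF (-1)).length + 2 ≤ W) :
    Adds encV encF W S (k + l + 1) (p - q) :=
  hp.binary hq fun _ _ h1 h2 hB => by
    have := hB.lin [(1, (false, p)), (-1, (false, q))] (by simp [h1, h2]) (by simp; omega)
    simpa [sub_eq_add_neg] using this

end Adds

end Build

/-! ### Return from words to field elements, and injectivity of the encodings. -/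

theorem Gate.exists_mapF {V F G : Type*} [Nonempty F] (φ : F → G) {g : Gate V G} (h : ∀ a ∈ g.coefs, ∃ b, a = φ b) :
    ∃ g' : Gate V F, g = g'.mapF φ := by
  cases g with
  | var v => exact ⟨.var v, rfl⟩
  | const c =>
    obtain ⟨b, rfl⟩ := h c (by simp [Gate.coefs])
    exact ⟨.const b, rfl⟩
  | mul j k => exact ⟨.mul j k, rfl⟩
  | inv j => exact ⟨.inv j, rfl⟩
  | lin l =>
    choose! f hf using h
    refine ⟨.lin (l.map fun t => (f t.1, t.2)), ?_⟩
    simp only [Gate.mapF, List.map_map]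
    congr 1
    conv_lhs => rw [← List.map_id l]
    refine List.map_congr_left fun t ht => ?_
    have := hf t.1 (by simp only [Gate.coefs, List.mem_map]; exact ⟨t, ht, rfl⟩)
    exact Prod.ext this rfl

/-- Used with `φ` the encoding of field elements, to recover a circuit over `F` from one whose
constants are known to be encodings. -/
theorem Circuit.exists_mapF {V F G : Type*} [Nonempty F] (φ : F → G) {c : Circuit V G}
    (h : ∀ g ∈ c, ∀ a ∈ g.coefs, ∃ b, a = φ b) : ∃ d : Circuit V F, c = d.map (Gate.mapF φ) := by
  have h' : ∀ g ∈ c, ∃ g' : Gate V F, g = g'.mapF φ := fun g hg => Gate.exists_mapF φ (h g hg)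
  clear h
  induction c with
  | nil => exact ⟨[], rfl⟩
  | cons g c ih =>
    obtain ⟨g', rfl⟩ := h' g (by simp)
    obtain ⟨d, rfl⟩ := ih fun g hg => h' g (by simp [hg])
    exact ⟨g' :: d, rfl⟩

theorem Gate.mapF_injective {V F G : Type*} {φ : F → G} (hφ : Function.Injective φ) :
    Function.Injective (Gate.mapF (V := V) φ) := by
  have hl : Function.Injective (fun t : F × ℕ => (φ t.1, t.2)) := fun s t h => by
    simp only [Prod.mk.injEq] at h
    exact Prod.ext (hφ h.1) h.2
  intro g g' h
  cases g <;> cases g' <;> simp_all [Gate.mapF, hφ.eq_iff, hl.list_map.eq_iff]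

theorem SparsePoly.mapF_injective {F G : Type*} {φ : F → G} (hφ : Function.Injective φ) :
    Function.Injective (SparsePoly.mapF φ) :=
  Function.Injective.list_map fun s t h => by
    simp only [Prod.mk.injEq] at h
    exact Prod.ext (hφ h.1) h.2

theorem encInt_injective : Function.Injective encInt := by
  have hb : Function.Injective encBit := fun a b h => by cases a <;> cases b <;> simp_all [encBit]
  intro a b h
  simp only [encInt, List.cons.injEq, true_and] at h
  have h1 : a < 0 ↔ b < 0 := by simpa using hb h.1
  have h2 := (hb.list_map) ((List.append_left_inj _).1 h.2)
  have h3 : a.natAbs = b.natAbs := by rw [← ofBits_bits a.natAbs, h2, ofBits_bits]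
  omega

theorem encList_injective {α : Type*} {f : α → LWord} (hf : Function.Injective f)
    (h : ∀ a, isItem (f a) = true) : Function.Injective (encList f) := fun l l' hl => by
  have := congrArg (fun w => splitItems (unbracket w)) hl
  simp only [splitItems_inner_encList fun a _ => h a] at this
  exact hf.list_map this

theorem encElem_injective {F : Type*} [Field F] (pres : FieldPresentation F) :
    Function.Injective pres.encElem := by
  cases pres with
  | finite p pb =>
    intro a b h
    have := encList_injective encNat_injective isItem_encNat h
    rw [List.ofFn_inj] at this
    refine pb.basis.repr.injective (Finsupp.ext fun i => ?_)
    exact ZMod.val_injective p (congrFun this i)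
  | numberField pb =>
    intro a b h
    have h := congrArg (fun w => pairUp (splitItems (unbracket w))) h
    simp only [FieldPresentation.encElem] at h
    have e : encRat = fun q => encInt q.num ++ encNat q.den := rfl
    rw [e, splitItems_inner_encList_pair (fun _ _ => isItem_encInt _) fun _ _ => isItem_encNat _,
      splitItems_inner_encList_pair (fun _ _ => isItem_encInt _) fun _ _ => isItem_encNat _] at h
    have hi : Function.Injective fun q : ℚ => (encInt q.num, encNat q.den) := fun p q h => by
      simp only [Prod.mk.injEq] at h
      exact Rat.ext (encInt_injective h.1) (encNat_injective h.2)
    have := hi.list_map h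
    rw [List.ofFn_inj] at this
    exact pb.basis.repr.injective (Finsupp.ext fun i => congrFun this i)

/-! ## From circuits to systems of equations -/

/-- The variable of the system that stands for a variable of the circuit. -/
def inputVar (v : ℕ) : ℕ := Nat.bit true v

/-- The variable of the system that stands for the value of a gate. -/
def gateVar (i : ℕ) : ℕ := Nat.bit false (Nat.bit true i)

section System

variable {F : Type*}

/-- The equation for the gate at position `i`. -/
def gateEquation (one negOne : F) (i : ℕ) : Gate ℕ F → SparsePoly F
  | .var v => [(one, [(inputVar v, 1)]), (negOne, [(gateVar i, 1)])]
  | .const c => [(c, []), (negOne, [(gateVar i, 1)])]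
  | .mul j k => [(one, [(gateVar j, 1), (gateVar k, 1)]), (negOne, [(gateVar i, 1)])]
  -- The equation is `z_j² z_i = z_j` and not `z_j z_i = 1`: with `0⁻¹ = 0` it holds for `z_i =
  -- z_j⁻¹` even if `z_j = 0`, so an invalid inversion does not make the system unsolvable.
  | .inv j => [(one, [(gateVar j, 2), (gateVar i, 1)]), (negOne, [(gateVar j, 1)])]
  | .lin l => l.map (fun t => (t.1, [(gateVar t.2, 1)])) ++ [(negOne, [(gateVar i, 1)])]

/-- The arguments of the inversions. -/
def invArgs (c : Circuit ℕ F) : List ℕ := c.flatMap fun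
  | .inv j => [j]
  | _ => []

/-- The position of the last gate. -/
def lastIdx {α : Type*} (c : List α) : ℕ := (c.zipIdx.map Prod.snd).reverse.headD 0

/-- The definition takes the last index from the numbering of the list, because a stack program has
that numbering at hand. -/
theorem lastIdx_eq {α : Type*} (c : List α) : lastIdx c = c.length - 1 := by
  rcases List.eq_nil_or_concat' c with rfl | ⟨d, g, rfl⟩
  · rfl
  · simp [lastIdx, List.zipIdx_append]

/-- The equation that says that the arguments of all inversions and the output are nonzero
if it has no solution. -/
def outputEquation (one negOne : F) (c : Circuit ℕ F) : SparsePoly F :=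
  -- This is `∏ z_j · (1 - w · z_last)` multiplied out, with `w` the variable 0. The factor `∏ z_j`
  -- makes the equation hold when an inversion argument vanishes.
  [(one, (invArgs c).map fun j => (gateVar j, 1)),
    (negOne, (0, 1) :: (gateVar (lastIdx c), 1) :: (invArgs c).map fun j => (gateVar j, 1))]

/-- A system that has no solution if and only if the circuit computes zero. -/
def circuitSystem (one negOne : F) (c : Circuit ℕ F) : List (SparsePoly F) :=
  c.zipIdx.map (fun p => gateEquation one negOne p.2 p.1) ++ [outputEquation one negOne c]

theorem length_circuitSystem (one negOne : F) (c : Circuit ℕ F) :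
    (circuitSystem one negOne c).length = c.length + 1 := by simp [circuitSystem]

theorem circuitSystem_mapF {G : Type*} (φ : F → G) (one negOne : F) (c : Circuit ℕ F) :
    circuitSystem (φ one) (φ negOne) (c.map (Gate.mapF φ)) =
      (circuitSystem one negOne c).map (SparsePoly.mapF φ) := by
  have hi : invArgs (c.map (Gate.mapF φ)) = invArgs c := by
    simp only [invArgs, List.flatMap_map]
    congr 1
    funext g
    cases g <;> rfl
  have hl : lastIdx (c.map (Gate.mapF φ)) = lastIdx c := by simp [lastIdx_eq]
  simp only [circuitSystem, List.map_append, List.map_map, List.zipIdx_map, outputEquation, hi, hl]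
  congr 1
  refine List.map_congr_left fun p _ => ?_
  obtain ⟨g, i⟩ := p
  cases g <;> simp [gateEquation, Gate.mapF, SparsePoly.mapF]

/-- The coefficients of the circuit occur in the system. -/
theorem exists_mapF_of_circuitSystem [Nonempty F] {G : Type*} (φ : F → G) {one negOne : G} {c : Circuit ℕ G}
    {S : List (SparsePoly F)} (h : circuitSystem one negOne c = S.map (SparsePoly.mapF φ)) :
    ∃ d : Circuit ℕ F, c = d.map (Gate.mapF φ) := by
  have h' : ∀ f ∈ circuitSystem one negOne c, ∀ t ∈ f, ∃ a, t.1 = φ a := by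
    rw [h]
    intro f hf t ht
    obtain ⟨f, -, rfl⟩ := List.mem_map.1 hf
    obtain ⟨t, -, rfl⟩ := List.mem_map.1 ht
    exact ⟨t.1, rfl⟩
  have h2 : ∀ g ∈ c, ∀ a ∈ g.coefs, ∃ b, a = φ b := by
    intro g hg a ha
    obtain ⟨i, hi⟩ := List.mem_iff_getElem?.1 hg
    have hm : gateEquation one negOne i g ∈ circuitSystem one negOne c :=
      List.mem_append_left _ (List.mem_map.2 ⟨(g, i), List.mem_zipIdx_iff_getElem?.2 hi, rfl⟩)
    have := h' _ hm
    cases g with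
    | const b =>
      simp only [Gate.coefs, List.mem_singleton] at ha
      exact this (a, []) (by simp [gateEquation, ha])
    | lin l =>
      simp only [Gate.coefs, List.mem_map] at ha
      obtain ⟨t, ht, rfl⟩ := ha
      exact this (t.1, [(gateVar t.2, 1)]) (by
        simp only [gateEquation, List.mem_append, List.mem_map]
        exact Or.inl ⟨t, ht, rfl⟩)
    | _ => simp [Gate.coefs] at ha
  exact Circuit.exists_mapF φ h2

end System

/-! ### The syntactic conditions on circuits -/

section SynCheck

variable {V F : Type*}

def gateCheck (prev : List Bool) (g : Gate V F) : Bool :=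
  (g.args.all fun j => decide (j < prev.length)) && match g with
    | .inv j => prev.getD j false
    | _ => true

def synStep (s : Bool × List Bool) (g : Gate V F) : Bool × List Bool :=
  (s.1 && gateCheck s.2 g, s.2 ++ [g.synConst s.2])

/-- Whether the arguments of gates precede them, and inversion is applied only to syntactically
constant gates. -/
def synCheck (c : Circuit V F) : Bool := (c.foldl synStep (true, [])).1

theorem foldl_synStep (c : Circuit V F) :
    c.foldl synStep (true, []) = (synCheck c, c.synConsts) := by
  refine Prod.ext rfl ?_
  induction c using List.reverseRecOn with
  | nil => rfl
  | append_singleton c g ih =>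
    rw [List.foldl_append, List.foldl_cons, List.foldl_nil, Circuit.synConsts_concat]
    have ih : (c.foldl synStep (true, [])).2 = Circuit.synConsts c := ih
    rw [synStep, ih]

theorem synCheck_concat (c : Circuit V F) (g : Gate V F) :
    synCheck (c ++ [g]) = (synCheck c && gateCheck c.synConsts g) := by
  rw [synCheck, List.foldl_append, foldl_synStep]
  rfl

theorem gateCheck_iff {c : Circuit V F} {g : Gate V F} : gateCheck c.synConsts g = true ↔
    (∀ j ∈ g.args, j < c.length) ∧ ∀ j, g = Gate.inv j → c.synConsts.getD j false = true := by
  unfold gateCheck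
  rw [Bool.and_eq_true]
  refine and_congr (by simp [Circuit.length_synConsts]) ?_
  cases g with
  | inv j => exact ⟨fun h k hk => by obtain rfl : j = k := by { simpa using hk }; exact h, fun h => h j rfl⟩
  | _ => simp

theorem synCheck_mapF {G : Type*} (φ : F → G) (c : Circuit V F) :
    synCheck (c.map (Gate.mapF φ)) = synCheck c := by
  have : ∀ (s : Bool × List Bool) (g : Gate V F), synStep s (g.mapF φ) = synStep s g := by
    intro s g
    cases g <;> simp [synStep, gateCheck, Gate.mapF, Gate.args, Gate.synConst, Function.comp_def]
  simp only [synCheck, List.foldl_map, this]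

theorem Circuit.Valid.synCheck [Field F] {c : Circuit V F} (h : c.Valid) : synCheck c = true := by
  induction c using List.reverseRecOn with
  | nil => rfl
  | append_singleton c g ih =>
    rw [Circuit.valid_concat] at h
    rw [synCheck_concat, ih h.1, Bool.true_and, gateCheck_iff]
    exact ⟨h.2.1, fun j hj => (h.2.2 j hj).1⟩

end SynCheck

/-! ### Values of circuits -/

section Values

variable {V F K : Type*} [Field F] [Field K] [Algebra F K] (x : V → K)

/-- The value of a gate at a point. -/
def gateVal (prev : List K) : Gate V F → K
  | .var v => x v
  | .const c => algebraMap F K c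
  | .mul j k => prev.getD j 0 * prev.getD k 0
  | .inv j => (prev.getD j 0)⁻¹
  | .lin l => (l.map fun t => algebraMap F K t.1 * prev.getD t.2 0).sum

abbrev vals (c : Circuit V F) : List K := scanGates (gateVal x) c

theorem gateVal_congr {prev prev' : List K} {g : Gate V F}
    (h : ∀ j ∈ g.args, prev.getD j 0 = prev'.getD j 0) : gateVal x prev g = gateVal x prev' g := by
  cases g with
  | var v => rfl
  | const c => rfl
  | mul j k => rw [gateVal, gateVal, h j (by simp [Gate.args]), h k (by simp [Gate.args])]
  | inv j => rw [gateVal, gateVal, h j (by simp [Gate.args])]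
  | lin l =>
    rw [gateVal, gateVal]
    congr 1
    refine List.map_congr_left fun t ht => ?_
    rw [h t.2 (by simp only [Gate.args, List.mem_map]; exact ⟨t, ht, rfl⟩)]

theorem getD_vals {c : Circuit V F} (h : synCheck c = true) {i : ℕ} {g : Gate V F}
    (hg : (c)[i]? = some g) : (vals x c).getD i 0 = gateVal x (vals x c) g := by
  induction c using List.reverseRecOn with
  | nil => simp at hg
  | append_singleton c g' ih =>
    rw [synCheck_concat, Bool.and_eq_true] at h
    have key : ∀ (g : Gate V F), (∀ j ∈ g.args, j < c.length) →
        gateVal x (vals x (c ++ [g'])) g = gateVal x (vals x c) g := fun g hg =>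
      gateVal_congr x fun j hj => getD_scanGates_append _ _ _ (hg j hj) 0
    have hargs : ∀ (c : Circuit V F), synCheck c = true → ∀ g ∈ c, ∀ j ∈ g.args, j < c.length := by
      intro c
      induction c using List.reverseRecOn with
      | nil => simp
      | append_singleton c g ih =>
        intro h g' hg' j hj
        rw [synCheck_concat, Bool.and_eq_true] at h
        rw [List.length_append]
        rcases List.mem_append.1 hg' with h' | h'
        · have := ih h.1 g' h' j hj; omega
        · rw [List.mem_singleton.1 h'] at hj
          have := (gateCheck_iff.1 h.2).1 j hj; omega
    rcases lt_or_ge i c.length with hi | hi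
    · rw [List.getElem?_append_left hi] at hg
      rw [getD_scanGates_append _ _ _ hi, key g (hargs c h.1 g (List.mem_of_getElem? hg)), ih h.1 hg]
    · have hi' : i = c.length := by
        have := (List.getElem?_eq_some_iff.1 hg).1
        simp at this; omega
      subst hi'
      simp only [List.getElem?_concat_length, Option.some.injEq] at hg
      subst hg
      rw [getD_scanGates_concat, key _ (gateCheck_iff.1 h.2).1]

theorem aeval_constantCoeff_of_synConsts {c : Circuit V F} {j : ℕ}
    (h : c.synConsts.getD j false = true) : MvPolynomial.aeval x (c.polys.getD j 0) =
      algebraMap F K (MvPolynomial.constantCoeff (c.polys.getD j 0)) := by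
  obtain ⟨a, ha⟩ := Circuit.eq_C_of_synConsts c j h
  rw [ha]; simp

theorem getD_map_aeval (l : List (MvPolynomial V F)) (j : ℕ) :
    (l.map (MvPolynomial.aeval x)).getD j 0 = MvPolynomial.aeval x (l.getD j 0) := by
  rw [← map_zero (MvPolynomial.aeval (R := F) x), List.getD_map]

theorem aeval_gate_poly {c : Circuit V F} {g : Gate V F}
    (h : ∀ j, g = Gate.inv j → c.synConsts.getD j false = true) :
    MvPolynomial.aeval x (g.poly c.polys) =
      gateVal x (c.polys.map (MvPolynomial.aeval x)) g := by
  cases g with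
  | var v => simp [Gate.poly, gateVal]
  | const c => simp [Gate.poly, gateVal]
  | mul j k => simp only [Gate.poly, gateVal, map_mul, getD_map_aeval]
  | inv j =>
    rw [Gate.poly, gateVal, getD_map_aeval, aeval_constantCoeff_of_synConsts x (h j rfl)]
    simp
  | lin l =>
    simp only [Gate.poly, gateVal, getD_map_aeval, map_list_sum, List.map_map]
    congr 1
    refine List.map_congr_left fun t _ => ?_
    simp [map_mul]

/-- The syntactic check suffices, since both sides use `0⁻¹ = 0` at an inversion of zero. The lemma
is therefore available before validity is known. -/
theorem map_aeval_polys {c : Circuit V F} (h : synCheck c = true) :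
    c.polys.map (MvPolynomial.aeval x) = vals x c := by
  induction c using List.reverseRecOn with
  | nil => rfl
  | append_singleton c g ih =>
    rw [synCheck_concat, Bool.and_eq_true] at h
    rw [vals, scanGates_concat, Circuit.polys_concat, List.map_append, ih h.1, List.map_singleton,
      aeval_gate_poly x (gateCheck_iff.1 h.2).2, ih h.1]

end Values

section Soundness

variable {F K : Type*} [Field F] [Field K] [Algebra F K]

/-- An inverted gate that computes the zero polynomial would have value zero everywhere. So one
point at which no inversion argument vanishes proves validity. -/
theorem valid_of_vals_ne_zero (x : ℕ → K) {c : Circuit ℕ F} (h : synCheck c = true)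
    (hne : ∀ j ∈ invArgs c, (vals x c).getD j 0 ≠ 0) : c.Valid := by
  induction c using List.reverseRecOn with
  | nil => exact Circuit.valid_nil
  | append_singleton c g ih =>
    rw [synCheck_concat, Bool.and_eq_true] at h
    have hg := gateCheck_iff.1 h.2
    have hlt : ∀ (c : Circuit ℕ F), synCheck c = true → ∀ j ∈ invArgs c, j < c.length := by
      intro c
      induction c using List.reverseRecOn with
      | nil => simp [invArgs]
      | append_singleton c g ih =>
        intro h j hj
        rw [synCheck_concat, Bool.and_eq_true] at h
        rw [invArgs, List.flatMap_append, List.mem_append] at hj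
        rw [List.length_append]
        rcases hj with hj | hj
        · have := ih h.1 j hj; omega
        · have := (gateCheck_iff.1 h.2).1 j (by cases g <;> simp_all [Gate.args])
          omega
    have hv : Circuit.Valid c := ih h.1 fun j hj => by
      have := hne j (by rw [invArgs, List.flatMap_append]; exact List.mem_append_left _ hj)
      rwa [getD_scanGates_append _ _ _ (hlt c h.1 j hj)] at this
    refine Circuit.valid_concat.2 ⟨hv, hg.1, fun j hj => ⟨hg.2 j hj, fun h0 => ?_⟩⟩
    have := hne j (by rw [invArgs, List.flatMap_append]; subst hj; simp)
    rw [getD_scanGates_append _ _ _ (hg.1 j (by subst hj; simp [Gate.args])),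
      show scanGates (gateVal x) c = _ from (map_aeval_polys x h.1).symm, getD_map_aeval, h0,
      map_zero] at this
    exact this rfl

theorem aeval_toPoly (a : ℕ → K) (f : SparsePoly F) : MvPolynomial.aeval a f.toPoly =
    (f.map fun t => algebraMap F K t.1 * (t.2.map fun m => a m.1 ^ m.2).prod).sum := by
  rw [SparsePoly.toPoly, map_list_sum, List.map_map]
  congr 1
  refine List.map_congr_left fun t _ => ?_
  simp [map_list_prod, Function.comp_def]

/-- The assignment with the given values for inputs, gates and the inverse of the output. -/
def systemPoint (x : ℕ → K) (z : List K) (w : K) (n : ℕ) : K :=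
  -- Inputs have the numbers `2 v + 1` and gates the numbers `4 i + 2`; the number 0 is left for
  -- `w`.
  if n = 0 then w else if n % 2 = 1 then x (n / 2) else z.getD (n / 4) 0

theorem systemPoint_inputVar (x : ℕ → K) (z : List K) (w : K) (v : ℕ) :
    systemPoint x z w (inputVar v) = x v := by
  have h : inputVar v = 2 * v + 1 := Nat.bit_val _ _
  rw [systemPoint, if_neg (by omega), if_pos (by omega)]
  congr 1; omega

theorem systemPoint_gateVar (x : ℕ → K) (z : List K) (w : K) (i : ℕ) :
    systemPoint x z w (gateVar i) = z.getD i 0 := by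
  have h : gateVar i = 4 * i + 2 := by
    simp only [gateVar, Nat.bit_val, Bool.toNat_false, Bool.toNat_true]; omega
  rw [systemPoint, if_neg (by omega), if_neg (by omega)]
  congr 1; omega

theorem aeval_gateEquation {x : ℕ → K} {c : Circuit ℕ F} (h : synCheck c = true) (w : K) {i : ℕ}
    {g : Gate ℕ F} (hg : (c)[i]? = some g) :
    MvPolynomial.aeval (systemPoint x (vals x c) w) (gateEquation 1 (-1) i g).toPoly = 0 := by
  have hv := getD_vals x h hg
  rw [aeval_toPoly]
  cases g with
  | lin l =>
    rw [gateVal] at hv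
    simp only [gateEquation, List.map_append, List.map_map, Function.comp_def, List.map_cons,
      List.map_nil, List.sum_append, List.sum_cons, List.sum_nil, List.prod_cons, List.prod_nil,
      systemPoint_gateVar, pow_one, mul_one, hv, map_neg, map_one]
    ring
  | inv j =>
    rw [gateVal] at hv
    simp only [gateEquation, List.map_cons, List.map_nil, List.sum_cons, List.sum_nil,
      List.prod_cons, List.prod_nil, systemPoint_gateVar, pow_one, mul_one, hv, map_neg, map_one]
    by_cases h0 : (vals x c).getD j 0 = 0
    · rw [h0]; simp
    · field_simp; ring
  | _ =>
    rw [gateVal] at hv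
    simp only [gateEquation, List.map_cons, List.map_nil, List.sum_cons, List.sum_nil,
      List.prod_cons, List.prod_nil, systemPoint_gateVar, systemPoint_inputVar, pow_one, mul_one, hv,
      map_neg, map_one]
    ring

theorem aeval_outputEquation (x : ℕ → K) (z : List K) (w : K) (c : Circuit ℕ F) :
    MvPolynomial.aeval (systemPoint x z w) (outputEquation 1 (-1) c).toPoly =
      ((invArgs c).map fun j => z.getD j 0).prod * (1 - w * z.getD (c.length - 1) 0) := by
  rw [aeval_toPoly, outputEquation, lastIdx_eq]
  simp only [List.map_cons, List.map_nil, List.sum_cons, List.sum_nil, List.map_map,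
    List.prod_cons, systemPoint_gateVar, pow_one, Function.comp_def, map_one, map_neg, add_zero]
  rw [show systemPoint x z w 0 = w from if_pos rfl]
  ring

/-- The gate values at `x` solve the gate equations for every `w`, so the left side of the output
equation never vanishes. Hence no inversion argument is zero. A nonzero output would be refuted by
`w` equal to its inverse, so the output vanishes at all points over an infinite field and is the
zero polynomial. -/
theorem computes_zero_of_system [Infinite K] {c : Circuit ℕ F} (h : synCheck c = true)
    (hc : c ≠ []) (hS : ¬ ∃ a : ℕ → K, ∀ f ∈ circuitSystem 1 (-1) c, MvPolynomial.aeval a f.toPoly = 0) :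
    c.Computes 0 := by
  have key : ∀ (x : ℕ → K) (w : K),
      ((invArgs c).map fun j => (vals x c).getD j 0).prod *
        (1 - w * (vals x c).getD (c.length - 1) 0) ≠ 0 := by
    intro x w h0
    refine hS ⟨systemPoint x (vals x c) w, fun f hf => ?_⟩
    rcases List.mem_append.1 hf with hf | hf
    · obtain ⟨⟨g, i⟩, hp, rfl⟩ := List.mem_map.1 hf
      exact aeval_gateEquation h w (List.mem_zipIdx_iff_getElem?.1 hp)
    · rw [List.mem_singleton.1 hf, aeval_outputEquation, h0]
  have hv : c.Valid := by
    refine valid_of_vals_ne_zero (fun _ => (0 : K)) h fun j hj h0 => ?_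
    refine (mul_ne_zero_iff.1 (key (fun _ => 0) 0)).1 (List.prod_eq_zero ?_)
    exact List.mem_map.2 ⟨j, hj, h0⟩
  refine Circuit.computes_iff.2 ⟨hv, hc, ?_⟩
  have hz : ∀ x : ℕ → K, MvPolynomial.aeval x (c.polys.getD (c.length - 1) 0) = 0 := by
    intro x
    by_contra h0
    rw [← getD_map_aeval, map_aeval_polys x h] at h0
    have := key x ((vals x c).getD (c.length - 1) 0)⁻¹
    rw [inv_mul_cancel₀ h0] at this
    simp at this
  have : MvPolynomial.map (algebraMap F K) (c.polys.getD (c.length - 1) 0) = 0 := by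
    refine MvPolynomial.funext fun x => ?_
    rw [MvPolynomial.eval_map, map_zero]
    exact hz x
  exact MvPolynomial.map_injective _ (algebraMap F K).injective (by rw [this, map_zero])

end Soundness

/-! ### Certificates for the systems of circuits that compute zero -/

section Certificate

open MvPolynomial

variable {F : Type*} [Field F] {m : ℕ}

/-- Modulo the ideal generated by the `y`, every polynomial is congruent to its value at `y = 0`. -/
theorem mem_span_of_aeval_eq_zero {C : MvPolynomial (ℕ ⊕ Fin m) F}
    (h : aeval (Sum.elim X fun _ => 0 : ℕ ⊕ Fin m → MvPolynomial ℕ F) C = 0) :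
    C ∈ Ideal.span (Set.range fun j : Fin m => (X (Sum.inr j) : MvPolynomial (ℕ ⊕ Fin m) F)) := by
  set I := Ideal.span (Set.range fun j : Fin m => (X (Sum.inr j) : MvPolynomial (ℕ ⊕ Fin m) F))
  have key : Ideal.Quotient.mkₐ F I = ((Ideal.Quotient.mkₐ F I).comp (rename Sum.inl)).comp
      (aeval (Sum.elim X fun _ => 0 : ℕ ⊕ Fin m → MvPolynomial ℕ F)) := by
    refine MvPolynomial.algHom_ext fun v => ?_
    rcases v with v | j
    · simp
    · have : (X (Sum.inr j) : MvPolynomial (ℕ ⊕ Fin m) F) ∈ I := Ideal.subset_span ⟨j, rfl⟩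
      simpa using Ideal.Quotient.eq_zero_iff_mem.2 this
  have := congrArg (fun f => f C) key
  simp only [AlgHom.comp_apply, h, map_zero] at this
  exact Ideal.Quotient.eq_zero_iff_mem.1 this

theorem aeval_eq_zero_of_mem_span {C : MvPolynomial (ℕ ⊕ Fin m) F} {A : Type*} [CommRing A]
    [Algebra F A] {x : ℕ → A}
    (h : C ∈ Ideal.span (Set.range fun j : Fin m => (X (Sum.inr j) : MvPolynomial (ℕ ⊕ Fin m) F))) :
    aeval (Sum.elim x fun _ => 0 : ℕ ⊕ Fin m → A) C = 0 := by
  have : Ideal.span (Set.range fun j : Fin m => (X (Sum.inr j) : MvPolynomial (ℕ ⊕ Fin m) F)) ≤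
      RingHom.ker (aeval (Sum.elim x fun _ => 0 : ℕ ⊕ Fin m → A)) := by
    rw [Ideal.span_le]
    rintro _ ⟨j, rfl⟩
    simp
  exact this h

variable {encV : ℕ ⊕ Fin m → LWord} {encF : F → LWord}

/-- The polynomials from which a certificate is made up: the ones computed at the gates, their
modifications that turn into the variables for the gates, the product of the results of inversions
and the product of the arguments of inversions. -/
structure CertState (Fs : Fin m → MvPolynomial ℕ F) (d : Circuit ℕ F)
    (S : Set (Bool × MvPolynomial (ℕ ⊕ Fin m) F)) : Prop where
  -- The gate polynomials are recomputed, with their marks: a constant computed by a small circuit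
  -- may be exponentially long and cannot be written down.
  gate : ∀ i < d.length,
    (d.synConsts.getD i false, rename (fun v => Sum.inl (inputVar v)) (d.polys.getD i 0)) ∈ S
  ext : ∀ i < d.length, ∃ Z, (false, Z) ∈ S ∧
    aeval (Sum.elim X fun _ => 0 : ℕ ⊕ Fin m → MvPolynomial ℕ F) Z =
      rename inputVar (d.polys.getD i 0) ∧ aeval (Sum.elim X Fs) Z = X (gateVar i)
  invs : ∃ u P, (false, u) ∈ S ∧ (false, P) ∈ S ∧
    aeval (Sum.elim X fun _ => 0 : ℕ ⊕ Fin m → MvPolynomial ℕ F) (u * P) = 1 ∧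
    aeval (Sum.elim X Fs) P = ((invArgs d).map fun j => X (gateVar j)).prod

theorem certState_nil (Fs : Fin m → MvPolynomial ℕ F) {S : Set (Bool × MvPolynomial (ℕ ⊕ Fin m) F)}
    (h : (false, 1) ∈ S) : CertState Fs [] S :=
  ⟨by simp, by simp, 1, 1, h, h, by simp, by simp [invArgs]⟩

theorem CertState.concat {Fs : Fin m → MvPolynomial ℕ F} {d : Circuit ℕ F}
    {S S' : Set (Bool × MvPolynomial (ℕ ⊕ Fin m) F)} (h : CertState Fs d S) (hS : S ⊆ S')
    {g : Gate ℕ F} (hG : (g.synConst d.synConsts,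
      rename (fun v => Sum.inl (inputVar v)) (g.poly d.polys)) ∈ S')
    (hZ : ∃ Z, (false, Z) ∈ S' ∧
      aeval (Sum.elim X fun _ => 0 : ℕ ⊕ Fin m → MvPolynomial ℕ F) Z =
        rename inputVar (g.poly d.polys) ∧ aeval (Sum.elim X Fs) Z = X (gateVar d.length))
    (hP : ∃ u P, (false, u) ∈ S' ∧ (false, P) ∈ S' ∧
      aeval (Sum.elim X fun _ => 0 : ℕ ⊕ Fin m → MvPolynomial ℕ F) (u * P) = 1 ∧
      aeval (Sum.elim X Fs) P = ((invArgs (d ++ [g])).map fun j => X (gateVar j)).prod) :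
    CertState Fs (d ++ [g]) S' := by
  have hcase : ∀ i < (d ++ [g]).length, i < d.length ∨ i = d.length := fun i hi => by
    simp at hi; omega
  refine ⟨fun i hi => ?_, fun i hi => ?_, hP⟩
  · rcases hcase i hi with hi | rfl
    · rw [Circuit.getD_synConsts_append _ _ hi, Circuit.getD_polys_append _ _ hi]
      exact hS (h.gate i hi)
    · rw [Circuit.getD_synConsts_concat, Circuit.getD_polys_concat]
      exact hG
  · rcases hcase i hi with hi | rfl
    · rw [Circuit.getD_polys_append _ _ hi]
      obtain ⟨Z, h1, h2⟩ := h.ext i hi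
      exact ⟨Z, hS h1, h2⟩
    · rw [Circuit.getD_polys_concat]
      exact hZ

/-- Copies a gate into the certificate together with its mark. An inversion is reproduced as an
inversion, so its value need not be written out. -/
theorem built_gate {W n : ℕ} {S : Set (Bool × MvPolynomial (ℕ ⊕ Fin m) F)}
    {d : Circuit ℕ F} (hB : Built encV encF W n S)
    (h : ∀ i < d.length,
      (d.synConsts.getD i false, rename (fun v => Sum.inl (inputVar v)) (d.polys.getD i 0)) ∈ S)
    {g : Gate ℕ F} (hg : d.GateValid g)
    (hW : g.weight (fun v => encV (Sum.inl (inputVar v))) encF ≤ W) :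
    Built encV encF W (n + 1) (insert (g.synConst d.synConsts,
      rename (fun v => Sum.inl (inputVar v)) (g.poly d.polys)) S) := by
  cases g with
  | var v => simpa [Gate.poly, Gate.synConst] using hB.var (Sum.inl (inputVar v)) hW
  | const c => simpa [Gate.poly, Gate.synConst] using hB.const c hW
  | mul j k =>
    have := hB.mul (h j (hg.1 j (by simp [Gate.args]))) (h k (hg.1 k (by simp [Gate.args])))
    rw [← map_mul] at this
    exact this
  | inv j =>
    obtain ⟨h1, h2⟩ := hg.2 j rfl
    have hj := h j (hg.1 j (by simp [Gate.args]))
    have := hB.inv (p := rename (fun v => Sum.inl (inputVar v)) (d.polys.getD j 0))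
      (by rw [h1] at hj; exact hj) ?_
    · rw [constantCoeff_rename] at this
      simp only [Gate.synConst, Gate.poly, h1]
      rwa [rename_C]
    · obtain ⟨a, ha⟩ := Circuit.eq_C_of_synConsts d j h1
      rw [ha] at h2 ⊢
      rw [rename_C]
      intro h0
      rw [C_eq_zero] at h0
      exact h2 (by rw [h0, C_0])
  | lin l =>
    have := hB.lin (l.map fun t => (t.1, (d.synConsts.getD t.2 false,
      rename (fun v => Sum.inl (inputVar v)) (d.polys.getD t.2 0)))) ?_ ?_
    · have e : rename (fun v => (Sum.inl (inputVar v) : ℕ ⊕ Fin m)) ((Gate.lin l).poly d.polys) =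
        (List.map (fun t : F × Bool × MvPolynomial (ℕ ⊕ Fin m) F => C t.1 * t.2.2)
          (l.map fun t => (t.1, (d.synConsts.getD t.2 false,
            rename (fun v => Sum.inl (inputVar v)) (d.polys.getD t.2 0))))).sum := by
        simp only [Gate.poly, map_list_sum, List.map_map]
        congr 1
        exact List.map_congr_left fun t _ => by simp
      rw [e]
      simpa only [Gate.synConst, List.all_map, Function.comp_def] using this
    · intro t ht
      obtain ⟨t, ht', rfl⟩ := List.mem_map.1 ht
      exact h t.2 (hg.1 _ (by simp only [Gate.args, List.mem_map]; exact ⟨t, ht', rfl⟩))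
    · simpa [Gate.weight, Function.comp_def] using hW

variable {Fs : Fin m → MvPolynomial ℕ F} {d : Circuit ℕ F} {W : ℕ}
  {S : Set (Bool × MvPolynomial (ℕ ⊕ Fin m) F)}

theorem toPoly_gateEquation {g : Gate ℕ F} (hg : ∀ j, g ≠ Gate.inv j) (i : ℕ) {q : MvPolynomial ℕ F}
    (hq : q = match g with
      | .var v => X (inputVar v)
      | .const c => C c
      | .mul j k => X (gateVar j) * X (gateVar k)
      | .inv _ => 0
      | .lin l => (l.map fun t => C t.1 * X (gateVar t.2)).sum) :
    (gateEquation 1 (-1) i g).toPoly = q - X (gateVar i) := by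
  subst hq
  cases g with
  | inv j => exact absurd rfl (hg j)
  | lin l =>
    simp only [SparsePoly.toPoly, gateEquation, List.map_append, List.map_map, List.sum_append,
      Function.comp_def]
    simp [sub_eq_add_neg]
  | _ => simp [SparsePoly.toPoly, gateEquation, sub_eq_add_neg]

theorem toPoly_gateEquation_inv (i j : ℕ) :
    (gateEquation (1 : F) (-1) i (.inv j)).toPoly = X (gateVar j) ^ 2 * X (gateVar i) - X (gateVar j) := by
  simp [SparsePoly.toPoly, gateEquation, sub_eq_add_neg]

/-- `Q` is the gate applied to the polynomials `Z` of its arguments. These are the gate polynomials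
at `y = 0` and the variables of the gates at `y = F`. -/
theorem adds_gate (hd : CertState Fs d S) {g : Gate ℕ F} (hg : d.GateValid g)
    (hinv : ∀ j, g ≠ Gate.inv j)
    (hW : g.weight (fun v => encV (Sum.inl (inputVar v))) encF ≤ W) :
    ∃ Q, Adds encV encF W S 1 Q ∧
      aeval (Sum.elim X fun _ => 0 : ℕ ⊕ Fin m → MvPolynomial ℕ F) Q =
        rename inputVar (g.poly d.polys) ∧
      ∀ i, (gateEquation 1 (-1) i g).toPoly = aeval (Sum.elim X Fs) Q - X (gateVar i) := by
  cases g with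
  | var v =>
    exact ⟨X (Sum.inl (inputVar v)), Adds.var _ hW, by simp [Gate.poly],
      fun i => toPoly_gateEquation hinv i (by simp)⟩
  | const c =>
    exact ⟨C c, Adds.const _ hW, by simp [Gate.poly], fun i => toPoly_gateEquation hinv i (by simp)⟩
  | mul j k =>
    obtain ⟨Z, hZ, hZ0, hZ1⟩ := hd.ext j (hg.1 j (by simp [Gate.args]))
    obtain ⟨Z', hZ', hZ0', hZ1'⟩ := hd.ext k (hg.1 k (by simp [Gate.args]))
    refine ⟨Z * Z', (Adds.of_mem hZ).mul (Adds.of_mem hZ'), ?_,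
      fun i => toPoly_gateEquation hinv i ?_⟩
    · rw [map_mul, hZ0, hZ0', Gate.poly, map_mul]
    · rw [map_mul, hZ1, hZ1']
  | inv j => exact absurd rfl (hinv j)
  | lin l =>
    choose! Z hZ hZ0 hZ1 using hd.ext
    have hl : ∀ t ∈ l, t.2 < d.length := fun t ht =>
      hg.1 _ (by simp only [Gate.args, List.mem_map]; exact ⟨t, ht, rfl⟩)
    refine ⟨(l.map fun t => C t.1 * Z t.2).sum, fun n S' hS hB => ?_, ?_,
      fun i => toPoly_gateEquation hinv i ?_⟩
    · have := hB.lin (l.map fun t => (t.1, (false, Z t.2))) ?_ ?_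
      · simp only [List.map_map, Function.comp_def] at this
        exact Adds.weaken this
      · intro t ht
        obtain ⟨t, ht', rfl⟩ := List.mem_map.1 ht
        exact hS (hZ _ (hl t ht'))
      · simpa [Gate.weight, Function.comp_def] using hW
    · rw [Gate.poly, map_list_sum, map_list_sum, List.map_map, List.map_map]
      congr 1
      refine List.map_congr_left fun t ht => ?_
      simp only [Function.comp_apply, map_mul, hZ0 _ (hl t ht), rename_C]
      simp
    · rw [map_list_sum, List.map_map]
      congr 1
      refine List.map_congr_left fun t ht => ?_
      simp only [Function.comp_apply, map_mul, hZ1 _ (hl t ht)]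
      simp

/-- Induction on the last gate. The step is linear in the number of gates because each `Z` is a gate
of the certificate and is shared, not expanded. -/
theorem exists_certState (hd : d.Valid)
    (hFs : ∀ i g, (d)[i]? = some g → ∃ hi : i < m, Fs ⟨i, hi⟩ = (gateEquation 1 (-1) i g).toPoly)
    (hW : ∀ g ∈ d, g.weight (fun v => encV (Sum.inl (inputVar v))) encF ≤ W)
    (hz : ∀ i < d.length, (encV (Sum.inl (gateVar i))).length ≤ W)
    (hy : ∀ i, (encV (Sum.inr i)).length ≤ W)
    (h1 : 2 * ((encF 1).length + (encF (-1)).length + 2) ≤ W) :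
    ∃ S, Built encV encF W (15 * d.length + 1) S ∧ CertState Fs d S := by
  induction d using List.reverseRecOn with
  | nil => exact ⟨_, Adds.const 1 (by omega) _ _ subset_rfl Built.empty, certState_nil Fs (by simp)⟩
  | append_singleton d g ih =>
    have hW' : 2 * ((encF 1).length + 1) ≤ W ∧ (encF 1).length + (encF (-1)).length + 2 ≤ W := by
      omega
    obtain ⟨hd, hg⟩ := Circuit.valid_concat.1 hd
    obtain ⟨S, hB, hS⟩ := ih hd
      (fun i g' hg' => hFs i g' (by
        rw [List.getElem?_append_left (List.getElem?_eq_some_iff.1 hg').1, hg']))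
      (fun g' hg' => hW g' (by simp [hg'])) fun i hi => hz i (by simp; omega)
    obtain ⟨hi, hFi⟩ := hFs d.length g (by simp)
    have hB1 := built_gate hB hS.gate hg (hW g (by simp))
    obtain ⟨u, P, hu, hP, h0, h2⟩ := hS.invs
    by_cases hinv : ∃ j, g = Gate.inv j
    · obtain ⟨j, rfl⟩ := hinv
      have hj : j < d.length := hg.1 j (by simp [Gate.args])
      obtain ⟨hjs, hj0⟩ := hg.2 j rfl
      obtain ⟨a, ha⟩ := Circuit.eq_C_of_synConsts d j hjs
      have ha0 : a ≠ 0 := fun h => hj0 (by rw [ha, h, C_0])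
      obtain ⟨Z, hZS, hZ0, hZ1⟩ := hS.ext j hj
      have hGj := hS.gate j hj
      rw [ha, rename_C] at hGj hZ0
      have hpoly : (Gate.inv j : Gate ℕ F).poly (Circuit.polys d) = C a⁻¹ := by
        rw [Gate.poly, ha, constantCoeff_C]
      have hmul : (C a : MvPolynomial ℕ F) * C a⁻¹ = 1 := by
        rw [← C_mul, mul_inv_cancel₀ ha0, C_1]
      rw [hpoly, rename_C] at hB1
      set S₁ := insert ((Gate.inv j : Gate ℕ F).synConst (Circuit.synConsts d),
        (C a⁻¹ : MvPolynomial (ℕ ⊕ Fin m) F)) S with hS₁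
      have hGi : Adds encV encF W S₁ 0 (C a⁻¹) := Adds.of_mem (Set.mem_insert _ _)
      have hGj' : Adds encV encF W S₁ 0 (C a) := Adds.of_mem (Set.mem_insert_of_mem _ hGj)
      have hZ' : Adds encV encF W S₁ 0 Z := Adds.of_mem (Set.mem_insert_of_mem _ hZS)
      have hu' : Adds encV encF W S₁ 0 u := Adds.of_mem (Set.mem_insert_of_mem _ hu)
      have hP' : Adds encV encF W S₁ 0 P := Adds.of_mem (Set.mem_insert_of_mem _ hP)
      have hy' : Adds encV encF W S₁ 1 (X (Sum.inr ⟨d.length, hi⟩)) := Adds.var _ (hy _)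
      have hz' : Adds encV encF W S₁ 1 (X (Sum.inl (gateVar d.length))) :=
        Adds.var _ (hz _ (by simp))
      have hone : Adds encV encF W S₁ 1 (C 1) := Adds.const 1 (by omega)
      -- This is `Z_i = a⁻¹ + a⁻² (y_i - (Z_j - a) ((Z_j + a) z_i - 1))`. At `y = 0` one has `Z_j =
      -- a`, which leaves `a⁻¹`. At `y = F`, where `y_i` is `z_j² z_i - z_j` and `Z_j` is `z_j`, it
      -- becomes `a⁻¹ + a⁻² (a² z_i - a) = z_i`.
      have hN := hGi.add ((hGi.mul hGi).mul (hy'.sub ((hZ'.sub hGj' hW'.2).mul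
        (((hZ'.add hGj' hW'.1).mul hz').sub hone hW'.2)) hW'.2)) hW'.1
      have hB2 := hN _ _ subset_rfl hB1
      -- The new inversion multiplies `u` by `a⁻¹` and `P` by `Z_j`, which preserves `u P = 1` at `y
      -- = 0`.
      have hB3 := (hu'.mul hGi) _ _ (Set.subset_insert _ _) hB2
      have hB4 := (hP'.mul hZ') _ _
        ((Set.subset_insert _ _).trans (Set.subset_insert _ _)) hB3
      -- One gate for the copied inversion, twelve for `Z_i` and one each for `u` and `P`: this is
      -- where 15 comes from.
      refine ⟨_, hB4.mono (by simp; omega) subset_rfl, hS.concat ?_ ?_ ?_ ?_⟩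
      · exact (Set.subset_insert _ _).trans ((Set.subset_insert _ _).trans
          ((Set.subset_insert _ _).trans (Set.subset_insert _ _)))
      · rw [hpoly, rename_C]
        exact Set.mem_insert_of_mem _ (Set.mem_insert_of_mem _ (Set.mem_insert_of_mem _
          (Set.mem_insert _ _)))
      · refine ⟨_, Set.mem_insert_of_mem _ (Set.mem_insert_of_mem _ (Set.mem_insert _ _)), ?_, ?_⟩
        · simp only [map_add, map_mul, map_sub, hZ0, hpoly, rename_C, aeval_C, algebraMap_eq, aeval_X,
            Sum.elim_inr]
          ring
        · rw [toPoly_gateEquation_inv] at hFi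
          simp only [map_add, map_mul, map_sub, hZ1, aeval_X, Sum.elim_inr, Sum.elim_inl, hFi, aeval_C,
            algebraMap_eq, map_one]
          linear_combination (C a⁻¹ * C a * X (gateVar d.length) + X (gateVar d.length) - C a⁻¹) * hmul
      · refine ⟨_, _, Set.mem_insert_of_mem _ (Set.mem_insert _ _), Set.mem_insert _ _, ?_, ?_⟩
        · rw [map_mul] at h0
          simp only [map_mul, hZ0, aeval_C, algebraMap_eq]
          linear_combination (C a⁻¹ * C a) * h0 + hmul
        · rw [map_mul, h2, hZ1, invArgs, invArgs, List.flatMap_append]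
          simp
    · push Not at hinv
      obtain ⟨Q, hQ, hQ0, hQ1⟩ := adds_gate (encF := encF) (encV := encV) (W := W) hS hg hinv (hW g (by simp))
      have hy' : Adds encV encF W S 1 (X (Sum.inr ⟨d.length, hi⟩)) := Adds.var _ (hy _)
      -- Here `Z_i = Q - y_i`. At `y = F` the equation of the gate is `Q - z_i`, which leaves `z_i`.
      have hZ := (hQ.sub hy' hW'.2) _ _ (Set.subset_insert _ _) hB1
      refine ⟨_, hZ.mono (by simp; omega) subset_rfl, hS.concat ?_ ?_ ?_ ?_⟩
      · exact (Set.subset_insert _ _).trans (Set.subset_insert _ _)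
      · simp
      · refine ⟨_, Set.mem_insert _ _, ?_, ?_⟩
        · rw [map_sub, hQ0]; simp
        · rw [map_sub, aeval_X, Sum.elim_inr, hFi, hQ1]; ring
      · refine ⟨u, P, by simp [hu], by simp [hP], h0, ?_⟩
        rw [h2, invArgs, invArgs, List.flatMap_append]
        cases g <;> simp_all

/-- A circuit that computes zero gives rise to a short certificate for its system. -/
theorem exists_certificate {c : Circuit ℕ F} (hc : c.Computes 0) {T : List (SparsePoly F)}
    (hT : T = circuitSystem 1 (-1) c) {encV : ℕ ⊕ Fin T.length → LWord}
    (hW : ∀ g ∈ c, g.weight (fun v => encV (Sum.inl (inputVar v))) encF ≤ W)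
    (hz : ∀ i < c.length, (encV (Sum.inl (gateVar i))).length ≤ W)
    (hw : (encV (Sum.inl 0)).length ≤ W)
    (hy : ∀ i, (encV (Sum.inr i)).length ≤ W)
    (h1 : 2 * ((encF 1).length + (encF (-1)).length + 2) ≤ W) :
    ∃ (D : Circuit (ℕ ⊕ Fin T.length) F) (C : MvPolynomial (ℕ ⊕ Fin T.length) F),
      D.Computes C ∧ IsIPSCertificate (fun j => (T.get j).toPoly) 1 C ∧
      (D.enc encV encF).length ≤
        2 + (15 * c.length + 10 + 1) * (10 + (W + 2) * (15 * c.length + 10 + 4)) := by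
  obtain ⟨hv, hne, hlast⟩ := Circuit.computes_iff.1 hc
  have hlen : T.length = c.length + 1 := by rw [hT, length_circuitSystem]
  have hpos := List.length_pos_of_ne_nil hne
  obtain ⟨S, hB, hS⟩ := exists_certState (Fs := fun j => (T.get j).toPoly) hv (fun i g hg => by
    have hi := (List.getElem?_eq_some_iff.1 hg).1
    refine ⟨by omega, ?_⟩
    subst hT
    simp only [circuitSystem, List.get_eq_getElem]
    rw [List.getElem_append_left (by simpa using hi), List.getElem_map, List.getElem_zipIdx]
    rw [List.getElem?_eq_getElem hi, Option.some.injEq] at hg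
    simp [hg]) hW hz hy h1
  obtain ⟨u, P, hu, hP, hu0, hP1⟩ := hS.invs
  obtain ⟨Z, hZ, hZ0, hZ1⟩ := hS.ext (c.length - 1) (by omega)
  have hFlast : (T.get ⟨c.length, by omega⟩).toPoly =
      ((invArgs c).map fun j => X (gateVar j)).prod -
        X 0 * (X (gateVar (c.length - 1)) * ((invArgs c).map fun j => X (gateVar j)).prod) := by
    have : T.get ⟨c.length, by omega⟩ = outputEquation 1 (-1) c := by
      subst hT
      simp only [circuitSystem, List.get_eq_getElem]
      rw [List.getElem_append_right (by simp)]
      simp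
    rw [this, outputEquation, lastIdx_eq]
    simp [SparsePoly.toPoly, sub_eq_add_neg, Function.comp_def]
  have hone : Adds encV encF W S 1 (C 1) := Adds.const 1 (by omega)
  have hlastVar : Adds encV encF W S 1 (X (Sum.inr ⟨c.length, by omega⟩)) := Adds.var _ (hy _)
  have hwVar : Adds encV encF W S 1 (X (Sum.inl 0)) := Adds.var _ hw
  -- The certificate is `u (y_last + w Z_last P - P) + 1`. At `y = F` the bracket vanishes by the
  -- output equation. At `y = 0` both `y_last` and `Z_last` are zero and `u P = 1`, so the value is
  -- zero. It takes nine more gates.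
  have hfin := ((Adds.of_mem hu).mul ((hlastVar.add (hwVar.mul ((Adds.of_mem hZ).mul (Adds.of_mem hP)))
    (by omega)).sub (Adds.of_mem hP) (by omega))).add hone (by omega)
  have hB' := (hfin _ _ subset_rfl hB).mono (m := 15 * c.length + 10) (by omega) subset_rfl
  obtain ⟨D, hD, hDl⟩ := hB'.computes (Set.mem_insert _ _) (by omega)
  refine ⟨D, _, hD, ⟨?_, mem_span_of_aeval_eq_zero ?_⟩, hDl⟩
  · simp only [map_add, map_mul, map_sub, hZ1, hP1, aeval_X, Sum.elim_inr, Sum.elim_inl, map_one]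
    rw [hFlast]
    ring
  · rw [hlast, map_zero] at hZ0
    rw [map_mul] at hu0
    simp only [map_add, map_mul, map_sub, hZ0, aeval_X, Sum.elim_inr, Sum.elim_inl, map_one]
    linear_combination -hu0

end Certificate

/-! ### The system of a circuit in polynomial time -/

/-- The two words of a pair. -/
def unpairStep (s : Bool × (LWord × LWord)) : Option Letter → Bool × (LWord × LWord)
  | none => (true, s.2)
  | some a => bif s.1 then (true, (s.2.1, a :: s.2.2)) else (false, (a :: s.2.1, s.2.2))

def unpair (w : List (Option Letter)) : LWord × LWord :=
  ((w.foldl unpairStep (false, ([], []))).2.1.reverse,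
    (w.foldl unpairStep (false, ([], []))).2.2.reverse)

theorem unpair_encPair (a : LWord × LWord) : unpair (encPair a) = a := by
  have h1 : ∀ (x : LWord) u v, (x.map some).foldl unpairStep (false, (u, v)) =
      (false, (x.reverse ++ u, v)) := by
    intro x
    induction x with
    | nil => intros; rfl
    | cons b x ih => intro u v; simp [unpairStep, ih]
  have h2 : ∀ (x : LWord) u v, (x.map some).foldl unpairStep (true, (u, v)) =
      (true, (u, x.reverse ++ v)) := by
    intro x
    induction x with
    | nil => intros; rfl
    | cons b x ih => intro u v; simp [unpairStep, ih]
  unfold unpair encPair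
  rw [List.foldl_append, h1, List.foldl_cons, unpairStep, h2]
  simp

namespace PT

variable {E : StackEnv} {α β γ δ : Type} [TreeEnc α] [TreeEnc β] [TreeEnc γ] [TreeEnc δ]

theorem unpair {f : α → List (Option Letter)} (hf : PT E f) : PT E fun a => unpair (f a) := by
  suffices h : PT E fun w : List (Option Letter) => _root_.unpair w from h.comp hf
  have hstep : PT E fun p : (List (Option Letter) × (Bool × (LWord × LWord))) × Option Letter =>
      unpairStep p.1.2 p.2 := by
    have : PT E fun p : Option Letter × (Bool × (LWord × LWord)) => unpairStep p.2 p.1 := by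
      refine finCases fun a => ?_
      cases a with
      | none => exact (const true).pair snd
      | some a =>
        exact cond fst ((const true).pair (snd.p1.pair (cons (const a) snd.p2)))
          ((const false).pair ((cons (const a) snd.p1).pair snd.p2))
    exact this.comp (snd.pair fst.p2)
  have hs : PT E fun w : List (Option Letter) => w.foldl unpairStep (false, ([], [])) := by
    refine foldl_of_growth (step := fun _ => unpairStep) id (const _) hstep 20 fun w s a _ => ?_
    obtain ⟨b, u, v⟩ := s
    have hb := size_bool_le b
    have ht := size_bool_le true
    have hf := size_bool_le false
    simp only [Polynomial.eval_ofNat]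
    cases a with
    | none => simp only [unpairStep, size_pair]; omega
    | some a =>
      have := size_Letter_le a
      cases b <;> simp only [unpairStep, cond_true, cond_false, size_pair, size_cons] <;> omega
  exact hs.p2.p1.reverse.pair hs.p2.p2.reverse

/-- Entry `j` is true if and only if `(true, j)` occurs in the numbered list, so access by position
needs no arithmetic on indices. -/
theorem getD_false {f : α → List Bool} {j : α → ℕ} (hf : PT E f) (hj : PT E j) :
    PT E fun a => (f a).getD (j a) false := by
  refine (any (g := fun a (q : Bool × ℕ) => q.1 && decide (q.2 = j a)) hf.zipIdx
    (and snd.p1 (natEq snd.p2 (hj.comp fst)))).congr fun a => ?_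
  rw [Bool.eq_iff_iff, List.any_eq_true]
  constructor
  · intro h
    have hlt : j a < (f a).length := by
      by_contra hlt
      rw [List.getD_eq_default _ _ (by omega)] at h
      simp at h
    refine ⟨(true, j a), List.mem_zipIdx_iff_getElem?.2 ?_, by simp⟩
    rw [List.getD_eq_getElem _ _ hlt] at h
    rw [List.getElem?_eq_getElem hlt, h]
  · rintro ⟨⟨b, i⟩, hm, h⟩
    simp only [Bool.and_eq_true, decide_eq_true_eq] at h
    have := List.mem_zipIdx_iff_getElem?.1 hm
    simp only [h.1, h.2] at this
    simp [this]

theorem ltLength {f : α → List β} {j : α → ℕ} (hf : PT E f) (hj : PT E j) :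
    PT E fun a => decide (j a < (f a).length) := by
  refine (any (g := fun a (q : β × ℕ) => decide (q.2 = j a)) hf.zipIdx
    (natEq snd.p2 (hj.comp fst))).congr fun a => ?_
  rw [Bool.eq_iff_iff, List.any_eq_true, decide_eq_true_eq]
  constructor
  · intro h
    exact ⟨((f a)[j a], j a), List.mem_zipIdx_iff_getElem?.2 (by simp), by simp⟩
  · rintro ⟨⟨b, i⟩, hm, h⟩
    simp only [decide_eq_true_eq] at h
    have := List.mem_zipIdx_iff_getElem?.1 hm
    rw [← h]
    exact (List.getElem?_eq_some_iff.1 this).1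

theorem gateCheck {f : α → List Bool} {g : α → RawGate} (hf : PT E f) (hg : PT E g) :
    PT E fun a => gateCheck (f a) (g a) := by
  suffices h : PT E fun p : RawGate × List Bool => _root_.gateCheck p.2 p.1 from
    h.comp (hg.pair hf)
  refine gateCases ?_ ?_ ?_ ?_ ?_
  · exact const true
  · exact const true
  · exact (and (ltLength snd fst.p1) (ltLength snd fst.p2)).congr fun p => by
      simp [_root_.gateCheck, Gate.args]
  · exact (and (ltLength snd fst) (getD_false snd fst)).congr fun p => by
      simp [_root_.gateCheck, Gate.args]
  · exact (all (g := fun (p : List (LWord × ℕ) × List Bool) (t : LWord × ℕ) =>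
      decide (t.2 < p.2.length)) fst (ltLength fst.p2 snd.p2)).congr fun p => by
      simp [_root_.gateCheck, Gate.args, Function.comp_def]

theorem synConst {f : α → List Bool} {g : α → RawGate} (hf : PT E f) (hg : PT E g) :
    PT E fun a => (g a).synConst (f a) := by
  suffices h : PT E fun p : RawGate × List Bool => p.1.synConst p.2 from
    h.comp (hg.pair hf)
  refine gateCases ?_ ?_ ?_ ?_ ?_
  · exact const false
  · exact const true
  · exact and (getD_false snd fst.p1) (getD_false snd fst.p2)
  · exact getD_false snd fst
  · exact all (g := fun (p : List (LWord × ℕ) × List Bool) (t : LWord × ℕ) => p.2.getD t.2 false) fst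
      (getD_false fst.p2 snd.p2)

theorem synCheck {f : α → Circuit ℕ LWord} (hf : PT E f) : PT E fun a => synCheck (f a) := by
  suffices h : PT E fun c : List RawGate => _root_.synCheck c from h.comp hf
  have hs : PT E fun c : List RawGate => c.foldl synStep (true, []) := by
    refine foldl_of_growth (step := fun _ => synStep) id (const _)
      ((and fst.p2.p1 (gateCheck fst.p2.p2 snd)).pair
        (append fst.p2.p2 (cons (synConst fst.p2.p2 snd) (const [])))) 20 fun c s g _ => ?_
    obtain ⟨b, l⟩ := s
    have h1 := size_bool_le (b && _root_.gateCheck l g)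
    have h2 := size_bool_le b
    have h3 := size_bool_le (g.synConst l)
    have h4 := size_le_list_append l [g.synConst l]
    simp only [Polynomial.eval_ofNat, synStep, size_pair, size_cons, size_nil] at *
    omega
  exact hs.p1

theorem gateEquation (one negOne : LWord) {g : α → RawGate} {i : α → ℕ} (hg : PT E g)
    (hi : PT E i) : PT E fun a => gateEquation one negOne (i a) (g a) := by
  suffices h : PT E fun p : RawGate × ℕ => _root_.gateEquation one negOne p.2 p.1 from
    h.comp (hg.pair hi)
  have hG : ∀ {δ : Type} [TreeEnc δ] {f : δ → ℕ}, PT E f → PT E fun d => _root_.gateVar (f d) :=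
    fun hf => bit false (bit true hf)
  have hlast : ∀ {δ : Type} [TreeEnc δ] {f : δ → ℕ}, PT E f →
      PT E fun d => [(negOne, [(_root_.gateVar (f d), 1)])] := fun hf =>
    cons ((const negOne).pair (cons ((hG hf).pair (const 1)) (const []))) (const [])
  refine gateCases ?_ ?_ ?_ ?_ ?_
  · exact cons ((const one).pair (cons ((bit true fst).pair (const 1)) (const []))) (hlast snd)
  · exact cons (fst.pair (const [])) (hlast snd)
  · exact cons ((const one).pair (cons ((hG fst.p1).pair (const 1))
      (cons ((hG fst.p2).pair (const 1)) (const [])))) (hlast snd)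
  · exact cons ((const one).pair (cons ((hG fst).pair (const 2))
      (cons ((hG snd).pair (const 1)) (const [])))) (hlast fst)
  · exact append (map (g := fun _ (t : LWord × ℕ) => (t.1, [(_root_.gateVar t.2, 1)])) fst
      (snd.p1.pair (cons ((hG snd.p2).pair (const 1)) (const [])))) (hlast snd)

theorem circuitSystem (one negOne : LWord) {f : α → Circuit ℕ LWord} (hf : PT E f) :
    PT E fun a => circuitSystem one negOne (f a) := by
  suffices h : PT E fun c : List RawGate => _root_.circuitSystem one negOne c from h.comp hf
  have hI : PT E fun c : List RawGate => _root_.invArgs c := by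
    have h : PT E fun p : List RawGate × RawGate => (match p.2 with
        | .inv j => [j]
        | _ => [] : List ℕ) := by
      have : PT E fun p : RawGate × List RawGate => (match p.1 with
          | .inv j => [j]
          | _ => [] : List ℕ) :=
        gateCases (const []) (const []) (const []) (cons fst (const [])) (const [])
      exact this.comp (snd.pair fst)
    refine (flatMap (g := fun _ (g : RawGate) => (match g with
      | .inv j => [j]
      | _ => [] : List ℕ)) id h).congr fun c => ?_
    unfold _root_.invArgs
    congr 1
    funext g
    cases g <;> rfl
  have hinv : PT E fun c : List RawGate =>
      (_root_.invArgs c).map fun j => (_root_.gateVar j, 1) :=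
    map (g := fun _ j => (_root_.gateVar j, 1)) hI ((bit false (bit true snd)).pair (const 1))
  have hlast : PT E fun c : List RawGate => _root_.gateVar (lastIdx c) :=
    bit false (bit true (headD 0 (reverse (map (g := fun _ (p : RawGate × ℕ) => p.2) (zipIdx id)
      snd.p2))))
  refine append (map (g := fun _ (p : RawGate × ℕ) => _root_.gateEquation one negOne p.2 p.1)
    (zipIdx id) (gateEquation one negOne snd.p1 snd.p2)) (cons (cons ((const one).pair hinv)
    (cons ((const negOne).pair (cons (const (0, 1)) (cons (hlast.pair (const 1)) hinv)))
      (const []))) (const []))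

end PT

/-! ### Proof systems give witnesses for identity testing -/

theorem length_le_length_encList {α : Type*} {f : α → LWord} {l : List α} {a : α} (h : a ∈ l) :
    (f a).length ≤ (encList f l).length := by
  rw [length_encList]
  exact (List.single_le_sum (by simp) _ (List.mem_map_of_mem (f := fun a => (f a).length) h)).trans
    (Nat.le_add_right _ _)

theorem length_le_encList {α : Type*} {f : α → LWord} {l : List α} (h : ∀ a ∈ l, 1 ≤ (f a).length) :
    l.length ≤ (encList f l).length := by
  rw [length_encList]
  have := List.card_nsmul_le_sum (l.map fun a => (f a).length) 1 (by simpa using h)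
  simp at this
  omega

theorem two_le_length_encNat (n : ℕ) : 2 ≤ (encNat n).length := by simp [encNat]

section Length

variable {V F : Type*} {encV : V → LWord} {encF : F → LWord}

theorem Gate.weight_le {encV' : V → LWord} {K : ℕ} (h : ∀ v, (encV' v).length ≤ (encV v).length + K)
    (g : Gate V F) : g.weight encV' encF ≤ (g.enc encV encF).length + K := by
  cases g with
  | var v => have := h v; simp only [Gate.weight, Gate.enc, List.length_append]; omega
  | const c => simp only [Gate.weight, Gate.enc, List.length_append]; omega
  | lin l =>
    simp only [Gate.weight, Gate.enc, List.length_append, length_encList]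
    have : (l.map fun t => (encF t.1).length + 1).sum ≤
        (l.map fun t => (encF t.1).length + (encNat t.2).length).sum :=
      List.sum_le_sum fun t _ => by have := two_le_length_encNat t.2; omega
    omega
  | _ => simp [Gate.weight]

theorem Gate.one_le_length_enc (g : Gate V F) : 1 ≤ (g.enc encV encF).length := by
  cases g <;> simp only [Gate.enc, List.length_append] <;>
    first
    | (have := two_le_length_encNat 0; omega)
    | (have := two_le_length_encNat 1; omega)
    | (have := two_le_length_encNat 2; omega)
    | (have := two_le_length_encNat 3; omega)
    | (have := two_le_length_encNat 4; omega)

theorem Circuit.length_le_length_enc (c : Circuit V F) : c.length ≤ (c.enc encV encF).length :=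
  length_le_encList fun g _ => g.one_le_length_enc

end Length

/-- At a common zero `a` the identity of the certificate reads `C(a, 0) = 1`, whereas membership in
the ideal of the `y` gives `C(a, 0) = 0`. -/
theorem IsIPSCertificate.not_exists_zero {F : Type*} [Field F] {S : List (SparsePoly F)}
    {C : MvPolynomial (ℕ ⊕ Fin S.length) F}
    (h : IsIPSCertificate (fun j => (S.get j).toPoly) 1 C) (K : Type*) [Field K] [Algebra F K] :
    ¬ ∃ a : ℕ → K, ∀ f ∈ S, MvPolynomial.aeval a f.toPoly = 0 := by
  rintro ⟨a, ha⟩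
  have h1 := congrArg (MvPolynomial.aeval a) h.1
  rw [map_one, ← AlgHom.comp_apply, MvPolynomial.comp_aeval] at h1
  have e : (fun i => (MvPolynomial.aeval a) (Sum.elim (MvPolynomial.X (R := F))
      (fun j => (S.get j).toPoly) i)) = Sum.elim a fun _ => (0 : K) := by
    funext i
    rcases i with i | j
    · simp
    · exact ha _ (List.get_mem S j)
  rw [e, aeval_eq_zero_of_mem_span h.2] at h1
  exact zero_ne_one h1

theorem exists_proof_of_proofLen_le {Γ : Type} {Q : List Γ → List Γ → Prop} {x : List Γ} {n : ℕ}
    (h : proofLen Q x ≤ n) : ∃ π, Q π x ∧ π.length ≤ n := by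
  have h' : proofLen Q x < ((n + 1 : ℕ) : ℕ∞) := lt_of_le_of_lt h (by exact_mod_cast Nat.lt_succ_self n)
  obtain ⟨⟨π, hπ⟩, hl⟩ := iInf_lt_iff.1 h'
  have hl : π.length < n + 1 := by exact_mod_cast hl
  exact ⟨π, hπ, by omega⟩

theorem proofLen_le {Γ : Type} {Q : List Γ → List Γ → Prop} {x π : List Γ} (h : Q π x) :
    proofLen Q x ≤ π.length :=
  iInf_le (fun π : {π : List Γ // Q π x} => (π.1.length : ℕ∞)) ⟨π, h⟩

theorem PSimulates.exists_le {Γ : Type} {P Q : List Γ → List Γ → Prop} {L : Set (List Γ)}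
    (h : PSimulates P Q L) : ∃ p : Polynomial ℕ, ∀ x ∈ L, ∀ π, Q π x →
      ∃ π', P π' x ∧ π'.length ≤ p.eval π.length := by
  obtain ⟨p, hp⟩ := h
  refine ⟨p, fun x hx π hπ => ?_⟩
  have h1 := proofLen_le hπ
  obtain ⟨n, hn⟩ := ENat.ne_top_iff_exists.1 (ne_top_of_le_ne_top (ENat.natCast_ne_top _) h1)
  rw [← hn] at h1
  have h1 : n ≤ π.length := by exact_mod_cast h1
  obtain ⟨π', h2, h3⟩ := exists_proof_of_proofLen_le (hp x hx n hn.symm)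
  exact ⟨π', h2, h3.trans (Polynomial.eval_nat_mono p h1)⟩

/-- Length bounds for the constructed words follow from their computability. A letter has tree size
at most 9, and one more for its cell gives the factor 10. -/
theorem PT.exists_length_le {E : StackEnv} {f : LWord → LWord} (hf : PT E f) :
    ∃ q : Polynomial ℕ, ∀ w, (f w).length ≤ q.eval w.length := by
  obtain ⟨q, hq⟩ := hf.size_le
  refine ⟨q.comp (Polynomial.X * 10 + 1), fun w => ?_⟩
  refine (PT.length_lt_size (f w)).le.trans ((hq w).trans ?_)
  rw [Polynomial.eval_comp]
  refine Polynomial.eval_nat_mono q ?_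
  simpa [FinLetters.letters] using size_word_le w

section Forward

variable {F : Type*} [Field F] (pres : FieldPresentation F)

/-- The system that is assigned to a word. -/
def reduction (one negOne : LWord) (x : LWord) : LWord :=
  encRawSystem (circuitSystem one negOne (parseCircuit x))

/-- Everything about the word that can be decided without arithmetic in the field. Nonvanishing of
inverted gates and meaningfulness of constants are left to the system. -/
def circuitWordOk (x : LWord) : Bool :=
  decide (encRawCircuit (parseCircuit x) = x) && rawCircuitOk (parseCircuit x) &&
    (!(parseCircuit x).isEmpty) && synCheck (parseCircuit x)

theorem reduction_enc (c : Circuit ℕ F) :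
    reduction (pres.encElem 1) (pres.encElem (-1)) (c.enc encNat pres.encElem) =
      encSystem pres.encElem (circuitSystem 1 (-1) c) := by
  rw [reduction, Circuit.enc_eq_raw, parseCircuit_enc (rawCircuitOk_map (isItem_encElem pres) c),
    circuitSystem_mapF, ← encSystem_eq_raw]

theorem circuitWordOk_enc {c : Circuit ℕ F} (hc : c.Computes 0) :
    circuitWordOk (c.enc encNat pres.encElem) = true := by
  have hok := rawCircuitOk_map (isItem_encElem pres) c
  obtain ⟨h1, h2, -⟩ := Circuit.computes_iff.1 hc
  rw [circuitWordOk, Circuit.enc_eq_raw, parseCircuit_enc hok, synCheck_mapF, h1.synCheck, hok]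
  simp [h2]

/-- Membership in Variety Emptiness includes that the coefficients encode field elements. All
constants of the circuit are among them, so the word comes from a circuit over `F`, to which
`computes_zero_of_system` applies. -/
theorem mem_PIT_of_reduction_mem {x : LWord} (hx : circuitWordOk x = true)
    (h : reduction (pres.encElem 1) (pres.encElem (-1)) x ∈ VarietyEmptiness pres) : x ∈ PIT pres := by
  simp only [circuitWordOk, Bool.and_eq_true, decide_eq_true_eq, Bool.not_eq_true',
    List.isEmpty_eq_false_iff] at hx
  obtain ⟨⟨⟨h1, h2⟩, h3⟩, h4⟩ := hx
  obtain ⟨S, hS, hunsat⟩ := h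
  rw [reduction, encSystem_eq_raw] at hS
  have hok : rawSystemOk (circuitSystem (pres.encElem 1) (pres.encElem (-1)) (parseCircuit x)) = true := by
    have h2' : ∀ g ∈ parseCircuit x, ∀ a ∈ g.coefs, isItem a = true := by
      simpa [rawCircuitOk, rawGateOk] using h2
    simp only [rawSystemOk, List.all_eq_true, circuitSystem, List.mem_append, List.mem_map,
      List.mem_singleton]
    rintro f (⟨⟨g, i⟩, hg, rfl⟩ | rfl) t ht
    · have hg' := h2' g (List.mem_of_getElem? (List.mem_zipIdx_iff_getElem?.1 hg))
      cases g with
      | lin l =>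
        simp only [gateEquation, List.mem_append, List.mem_map, List.mem_singleton] at ht
        rcases ht with ⟨s, hs, rfl⟩ | rfl
        · exact hg' s.1 (by simp only [Gate.coefs, List.mem_map]; exact ⟨s, hs, rfl⟩)
        · exact isItem_encElem pres _
      | const a =>
        simp only [gateEquation, List.mem_cons, List.not_mem_nil, or_false] at ht
        rcases ht with rfl | rfl
        · exact hg' a (by simp [Gate.coefs])
        · exact isItem_encElem pres _
      | _ =>
        simp only [gateEquation, List.mem_cons, List.not_mem_nil, or_false] at ht
        rcases ht with rfl | rfl <;> exact isItem_encElem pres _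
    · simp only [outputEquation, List.mem_cons, List.not_mem_nil, or_false] at ht
      rcases ht with rfl | rfl <;> exact isItem_encElem pres _
  have hS' := encRawSystem_injective hok (rawSystemOk_map (isItem_encElem pres) S) hS
  obtain ⟨c, hc⟩ := exists_mapF_of_circuitSystem pres.encElem hS'
  rw [hc, circuitSystem_mapF] at hS'
  have hSc := ((SparsePoly.mapF_injective (encElem_injective pres)).list_map) hS'
  refine ⟨c, ?_, ?_⟩
  · rw [← h1, hc, Circuit.enc_eq_raw]
  · refine computes_zero_of_system (K := AlgebraicClosure F) ?_ ?_ ?_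
    · rw [hc, synCheck_mapF] at h4
      exact h4
    · rintro rfl
      exact h3 (by rw [hc]; rfl)
    · rw [hSc]
      exact hunsat

theorem length_encIPSVar_inputVar {m : ℕ} (v : ℕ) :
    (encIPSVar (Sum.inl (inputVar v) : ℕ ⊕ Fin m)).length ≤ (encNat v).length + 3 := by
  have : (inputVar v).bits = true :: v.bits := bits_bit_of_ne (by simp)
  have h0 := length_encNat_le 0
  simp only [encIPSVar, List.length_append]
  simp only [encNat, this, List.length_append, List.length_map, List.length_cons] at *
  omega

theorem exists_IPSProof {c : Circuit ℕ F} (hc : c.Computes 0) {n W : ℕ}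
    (hn : (c.enc encNat pres.encElem).length ≤ n)
    (hW : 4 * n + 10 + 2 * ((pres.encElem 1).length + (pres.encElem (-1)).length + 2) ≤ W) :
    encSystem pres.encElem (circuitSystem 1 (-1) c) ∈ VarietyEmptiness pres ∧
    ∃ π, IPSProves pres π (encSystem pres.encElem (circuitSystem 1 (-1) c)) ∧
      π.length ≤ (encSystem pres.encElem (circuitSystem 1 (-1) c)).length +
        (2 + (15 * n + 11) * (10 + (W + 2) * (15 * n + 14))) := by
  have hlen : c.length ≤ n := (Circuit.length_le_length_enc c).trans hn
  have key := exists_certificate (W := W) (encF := pres.encElem) hc rfl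
    (encV := encIPSVar) ?_ ?_ ?_ ?_ (by omega)
  · obtain ⟨D, C, hD, hC, hl⟩ := key
    refine ⟨⟨_, rfl, hC.not_exists_zero _⟩, _, ⟨_, D, C, rfl, rfl, hD, hC⟩, ?_⟩
    rw [List.length_append]
    refine Nat.add_le_add_left (hl.trans ?_) _
    have h1 : 15 * c.length + 10 + 1 ≤ 15 * n + 11 := by omega
    have h2 : 15 * c.length + 10 + 4 ≤ 15 * n + 14 := by omega
    exact Nat.add_le_add_left
      (Nat.mul_le_mul h1 (Nat.add_le_add_left (Nat.mul_le_mul_left _ h2) _)) _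
  · intro g hg
    have h1 := Gate.weight_le (encF := pres.encElem)
      (fun v => length_encIPSVar_inputVar (m := (circuitSystem (1 : F) (-1) c).length) v) g
    have h2 : (g.enc encNat pres.encElem).length ≤ (c.enc encNat pres.encElem).length :=
      length_le_length_encList hg
    omega
  · intro i hi
    have h1 := length_encNat_le (gateVar i)
    have h2 := length_encNat_le 0
    have h : gateVar i = 4 * i + 2 := by
      simp only [gateVar, Nat.bit_val, Bool.toNat_false, Bool.toNat_true]; omega
    simp only [encIPSVar, List.length_append]
    omega
  · have h2 := length_encNat_le 0
    simp only [encIPSVar, List.length_append]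
    omega
  · intro j
    have h1 := length_encNat_le j
    have h2 := length_encNat_le 1
    have h3 := j.2.trans_eq (length_circuitSystem _ _ _)
    simp only [encIPSVar, List.length_append]
    omega

/-- The witness for a circuit is a `P`-proof of its system. A short one exists because the system
has a short IPS proof, which `P` simulates. -/
theorem inNP_PIT_of_simulates {P : LWord → LWord} (hP : IsCookReckhow P (VarietyEmptiness pres))
    (hsim : PSimulates (fun π x => P π = x) (IPSProves pres) (VarietyEmptiness pres)) :
    InNP (PIT pres) := by
  obtain ⟨⟨M⟩, hrange⟩ := hP
  obtain ⟨p, hp⟩ := hsim.exists_le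
  set one := pres.encElem 1 with hone
  set negOne := pres.encElem (-1) with hnegOne
  have hred : ∀ {α : Type} [TreeEnc α] {f : α → LWord},
      PT (⟨Option Letter, Bool, M.tm⟩ : StackEnv) f → PT ⟨Option Letter, Bool, M.tm⟩ fun a =>
        reduction one negOne (f a) := fun hf => (hf.parseCircuit.circuitSystem one negOne).encRawSystem
  obtain ⟨q, hq⟩ := (hred PT.id).exists_length_le
  let W : Polynomial ℕ := 4 * .X + 10 + 2 * (one.length + negOne.length + 2 : ℕ)
  let B : Polynomial ℕ := q + (2 + (15 * .X + 11) * (10 + (W + 2) * (15 * .X + 14)))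
  -- `B` bounds the IPS proof in terms of the circuit word, and `p` bounds the simulating proof in
  -- terms of the IPS proof.
  refine ⟨fun a => circuitWordOk a.1 && decide (reduction one negOne a.1 = P a.2), p.comp B, ?_,
    fun x => ⟨?_, ?_⟩⟩
  · have hu := (PT.id (E := ⟨Option Letter, Bool, M.tm⟩) (α := List (Option Letter))).unpair
    have hc := hu.p1.parseCircuit
    have ho : PT ⟨Option Letter, Bool, M.tm⟩ fun w : List (Option Letter) => P (unpair w).2 :=
      PT.oracle (ea := fun w : LWord => w) (eb := fun w : LWord => w) (E := ⟨Option Letter, Bool, M.tm⟩)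
        M.inputAlphabet M.outputAlphabet M.time M.outputsFun hu.p2
    have hok : PT ⟨Option Letter, Bool, M.tm⟩ fun w : List (Option Letter) =>
        circuitWordOk (unpair w).1 :=
      PT.and (PT.and (PT.and (PT.wordEq hc.encRawCircuit hu.p1) hc.rawCircuitOk) hc.isEmpty.not)
        hc.synCheck
    refine PT.tm2 (g := fun w => [circuitWordOk (unpair w).1 &&
      decide (reduction one negOne (unpair w).1 = P (unpair w).2)])
      (PT.cons (hok.and (PT.wordEq (hred hu.p1) ho)) (PT.const [])) fun a => ?_
    rw [unpair_encPair]
    rfl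
  · rintro ⟨c, rfl, hc⟩
    obtain ⟨hmem, π, hπ, hl⟩ := exists_IPSProof pres hc le_rfl
      (W := W.eval (c.enc encNat pres.encElem).length) (by simp [W, hone, hnegOne])
    obtain ⟨π', h1, h2⟩ := hp _ hmem π hπ
    refine ⟨π', h2.trans ?_, ?_⟩
    · rw [Polynomial.eval_comp]
      refine Polynomial.eval_nat_mono p (hl.trans ?_)
      have := hq (c.enc encNat pres.encElem)
      rw [reduction_enc] at this
      simp only [B, Polynomial.eval_add, Polynomial.eval_mul, Polynomial.eval_ofNat,
        Polynomial.eval_X]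
      omega
    · simp only [circuitWordOk_enc pres hc, Bool.true_and, decide_eq_true_eq]
      rw [reduction_enc, h1]
  -- Soundness does not depend on the length of the witness: every value of `P` lies in Variety
  -- Emptiness.
  · rintro ⟨π, -, h⟩
    simp only [Bool.and_eq_true, decide_eq_true_eq] at h
    refine mem_PIT_of_reduction_mem pres h.1 ?_
    rw [h.2, ← hrange]
    exact ⟨π, rfl⟩

end Forward

/-! ### Completeness of the ideal proof system -/

section Completeness

open MvPolynomial

variable {F : Type*} [Field F]

/-- Only finitely many variables occur in the system. The Nullstellensatz is applied in these, and a
zero in them extends by 0 to all variables. -/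
theorem one_mem_span_of_not_exists_zero {m : ℕ} {Fs : Fin m → MvPolynomial ℕ F} {K : Type*} [Field K]
    [Algebra F K] [IsAlgClosed K] (h : ¬ ∃ a : ℕ → K, ∀ j, aeval a (Fs j) = 0) :
    (1 : MvPolynomial ℕ F) ∈ Ideal.span (Set.range Fs) := by
  classical
  let s : Finset ℕ := Finset.univ.biUnion fun j => (Fs j).vars
  have hs : ∀ j, ∃ q : MvPolynomial s F, rename (↑) q = Fs j := fun j =>
    exists_rename_eq_of_vars_subset_range (Fs j) (fun v : s => (v : ℕ)) Subtype.val_injective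
      fun v hv => ⟨⟨v, Finset.mem_biUnion.2 ⟨j, Finset.mem_univ _, hv⟩⟩, rfl⟩
  choose q hq using hs
  have hz : zeroLocus K (Ideal.span (Set.range q)) = ∅ := by
    rw [zeroLocus_span, Set.eq_empty_iff_forall_notMem]
    intro x hx
    refine h ⟨fun v => if hv : v ∈ s then x ⟨v, hv⟩ else 0, fun j => ?_⟩
    rw [← hq, aeval_rename]
    have : (fun v => if hv : v ∈ s then x ⟨v, hv⟩ else 0) ∘ (fun v : s => (v : ℕ)) = x := by
      funext v; simp
    rw [this]
    exact hx _ ⟨j, rfl⟩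
  have hr := vanishingIdeal_zeroLocus_eq_radical (K := K) (Ideal.span (Set.range q))
  rw [hz, vanishingIdeal_empty, eq_comm, Ideal.radical_eq_top] at hr
  have h1 : (1 : MvPolynomial s F) ∈ Ideal.span (Set.range q) := by rw [hr]; trivial
  have h2 := Ideal.mem_map_of_mem (rename (fun v : s => (v : ℕ))) h1
  rw [map_one, Ideal.map_span, ← Set.range_comp] at h2
  convert h2 using 3
  funext j
  exact (hq j).symm

/-- The cofactors `g_j` in a representation of 1 give the certificate `∑ g_j y_j`, linear in the
`y`. -/
theorem exists_isIPSCertificate {m : ℕ} {Fs : Fin m → MvPolynomial ℕ F}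
    (h : (1 : MvPolynomial ℕ F) ∈ Ideal.span (Set.range Fs)) :
    ∃ C, IsIPSCertificate Fs 1 C := by
  obtain ⟨g, hg⟩ := Ideal.mem_span_range_iff_exists_fun.1 h
  refine ⟨∑ j, rename Sum.inl (g j) * X (Sum.inr j), ?_, ?_⟩
  · rw [map_sum, ← hg]
    refine Finset.sum_congr rfl fun j _ => ?_
    rw [map_mul, aeval_rename, aeval_X, Sum.elim_inr, Sum.elim_comp_inl, aeval_X_left, AlgHom.id_apply]
  · exact Ideal.sum_mem _ fun j _ => Ideal.mul_mem_left _ _ (Ideal.subset_span ⟨j, rfl⟩)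

theorem exists_adds {V : Type*} (encV : V → LWord) (encF : F → LWord) (p : MvPolynomial V F) :
    ∃ W k, ∀ W' ≥ W, ∀ S, Adds encV encF W' S k p := by
  induction p using MvPolynomial.induction_on with
  | C a => exact ⟨(encF a).length, 1, fun W' hW' S => Adds.const a hW'⟩
  | add p q hp hq =>
    obtain ⟨W, k, hp⟩ := hp
    obtain ⟨W', k', hq⟩ := hq
    exact ⟨W + W' + 2 * ((encF 1).length + 1), k + k' + 1, fun V hV S =>
      (hp V (by omega) S).add (hq V (by omega) S) (by omega)⟩
  | mul_X p v hp =>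
    obtain ⟨W, k, hp⟩ := hp
    exact ⟨W + (encV v).length, k + 1 + 1, fun V hV S =>
      (hp V (by omega) S).mul (Adds.var v (by omega))⟩

theorem exists_circuit {V : Type*} (p : MvPolynomial V F) : ∃ D : Circuit V F, D.Computes p := by
  -- Only existence matters here, so empty words serve as encodings of variables and constants.
  obtain ⟨W, k, h⟩ := exists_adds (fun _ => []) (fun _ => []) p
  obtain ⟨D, hD, -⟩ := (h (W + 1) (by omega) ∅ _ _ subset_rfl Built.empty).computes
    (Set.mem_insert _ _) (by simp)
  exact ⟨D, hD⟩

/-- Completeness of IPS, which makes the image of the constructed proof system the whole of Variety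
Emptiness. -/
theorem exists_IPSProves (pres : FieldPresentation F) {x : LWord} (hx : x ∈ VarietyEmptiness pres) :
    ∃ π, IPSProves pres π x := by
  obtain ⟨S, rfl, h⟩ := hx
  obtain ⟨C, hC⟩ := exists_isIPSCertificate (one_mem_span_of_not_exists_zero
    (Fs := fun j => (S.get j).toPoly) (K := AlgebraicClosure F) fun ⟨a, ha⟩ => h ⟨a, fun f hf => by
      obtain ⟨j, rfl⟩ := List.get_of_mem hf
      exact ha j⟩)
  obtain ⟨D, hD⟩ := exists_circuit C
  exact ⟨_, S, D, C, rfl, rfl, hD, hC⟩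

end Completeness

/-! ## Circuits for systems of polynomials -/

/-- The position of gate `r` in the block at position `4 * i`. -/
def blockPos (i r : ℕ) : ℕ :=
  -- For `r < 3` this is `4 * i + r`, formed by prepending binary digits, so that no addition has to
  -- be programmed.
  if r = 0 then Nat.bit false (Nat.bit false i) else if r = 1 then Nat.bit true (Nat.bit false i)
  else Nat.bit false (Nat.bit true i)

theorem blockPos_eq {r : ℕ} (hr : r < 3) (i : ℕ) : blockPos i r = 4 * i + r := by
  match r, hr with
  | 0, _ => simp [blockPos, Nat.bit_val]; omega
  | 1, _ => simp [blockPos, Nat.bit_val]; omega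
  | 2, _ => simp [blockPos, Nat.bit_val]; omega

namespace Gate

variable {V F : Type*}

/-- The gate with its arguments, given relative to a block, in the block at position `4 * i`. -/
def shift (i : ℕ) : Gate V F → Gate V F
  | var v => var v
  | const c => const c
  | mul j k => mul (blockPos i j) (blockPos i k)
  | inv j => inv (blockPos i j)
  | lin l => lin (l.map fun t => (t.1, blockPos i t.2))

theorem args_shift (i : ℕ) (g : Gate V F) : (g.shift i).args = g.args.map (blockPos i) := by
  cases g <;> simp [shift, args]

theorem mapF_shift {G : Type*} (φ : F → G) (n : ℕ) (g : Gate V F) :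
    (g.shift n).mapF φ = (g.mapF φ).shift n := by
  cases g <;> simp [shift, mapF]

end Gate

/-! A block of four gates computes a sum, a product, a power and the constant one from the values of
the preceding block. The arguments of its gates are given relative to the preceding block. -/

section Blocks

variable {F : Type*} (one : F)

abbrev Block (F : Type*) := List (Gate ℕ F)

def keepGate (r : ℕ) : Gate ℕ F := .lin [(one, r)]

/-- The fourth gate pads blocks to length four. Only the one in `initBlock`, at position 3, serves
later, as the constant one in the tests. -/
def keepBlock : Block F := [keepGate one 0, keepGate one 1, keepGate one 2, .const one]

def clearBlock : Block F := [.lin [], keepGate one 1, keepGate one 2, .const one]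

def coefBlock (c : F) : Block F := [keepGate one 0, .const c, keepGate one 2, .const one]

def varBlock (v : ℕ) : Block F := [keepGate one 0, keepGate one 1, .var v, .const one]

/-- Repeated squaring along the digits of an exponent, least significant first: the product takes up
the current power if the digit is 1, and the power is squared. -/
def bitBlock (b : Bool) : Block F :=
  [keepGate one 0, bif b then .mul 1 2 else keepGate one 1, .mul 2 2, .const one]

def addBlock : Block F := [.lin [(one, 0), (one, 1)], keepGate one 1, keepGate one 2, .const one]

def factorBlocks (m : ℕ × ℕ) : List (Block F) := varBlock one m.1 :: m.2.bits.map (bitBlock one)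

def termBlocks (t : F × List (ℕ × ℕ)) : List (Block F) :=
  coefBlock one t.1 :: (t.2.flatMap (factorBlocks one) ++ [addBlock one])

/-- The blocks that compute a polynomial. -/
def polyBlocks (f : SparsePoly F) : List (Block F) := clearBlock one :: f.flatMap (termBlocks one)

/-- The block that presents the value of a polynomial, or zero instead of it. -/
def outBlock (b : Bool) : Block F := bif b then keepBlock one else clearBlock one

def systemBlocks (b : Bool) (S : List (SparsePoly F)) : List (Block F) :=
  S.flatMap fun f => polyBlocks one f ++ [outBlock one b]

/-- Blocks one after the other, the first one with arguments in the block at position `4 * i`. -/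
def placeBlocks (i : ℕ) (l : List (Block F)) : Circuit ℕ F :=
  (l.zipIdx i).flatMap fun p => p.1.map (Gate.shift p.2)

def initBlock : Block F := [.lin [], .const one, .const one, .const one]

/-- The circuit that computes all polynomials of a system. -/
def systemCircuit (b : Bool) (S : List (SparsePoly F)) : Circuit ℕ F :=
  initBlock one ++ placeBlocks 0 (systemBlocks one b S)

theorem placeBlocks_cons (i : ℕ) (d : Block F) (l : List (Block F)) :
    placeBlocks i (d :: l) = d.map (Gate.shift i) ++ placeBlocks (i + 1) l := by
  simp only [placeBlocks, List.zipIdx_cons, List.flatMap_cons]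

theorem placeBlocks_append (i : ℕ) (l l' : List (Block F)) :
    placeBlocks i (l ++ l') = placeBlocks i l ++ placeBlocks (i + l.length) l' := by
  simp [placeBlocks, List.zipIdx_append]

theorem length_systemBlocks (b b' : Bool) (S : List (SparsePoly F)) :
    (systemBlocks one b S).length = (systemBlocks one b' S).length := by
  simp [systemBlocks, List.length_flatMap]

theorem systemCircuit_concat (b : Bool) (S : List (SparsePoly F)) (f : SparsePoly F) :
    systemCircuit one b (S ++ [f]) = systemCircuit one b S ++
      placeBlocks (systemBlocks one true S).length (polyBlocks one f) ++
      (outBlock one b).map (Gate.shift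
        ((systemBlocks one true S).length + (polyBlocks one f).length)) := by
  have h : systemBlocks one b (S ++ [f]) =
      systemBlocks one b S ++ (polyBlocks one f ++ [outBlock one b]) := by
    simp [systemBlocks]
  rw [systemCircuit, h, placeBlocks_append, placeBlocks_append, placeBlocks_cons,
    length_systemBlocks one b true, zero_add, systemCircuit]
  simp [placeBlocks]

end Blocks

section Semantics

open MvPolynomial

variable {F : Type*} [Field F]

/-- The values at the first three gates of a block. -/
noncomputable def runBlock (v : List (MvPolynomial ℕ F)) (d : Block F) : List (MvPolynomial ℕ F) :=
  (d.take 3).map fun g => g.poly v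

/-- Three simple gates, followed by the constant one. -/
def BlockOk (d : Block F) : Prop :=
  ∃ g₀ g₁ g₂ : Gate ℕ F, d = [g₀, g₁, g₂, .const 1] ∧
    ∀ g ∈ [g₀, g₁, g₂], (∀ j ∈ g.args, j < 3) ∧ ∀ j, g ≠ .inv j

/-- The circuit consists of `i + 1` blocks; the last of them computes `v`. -/
structure BlockState (A : Circuit ℕ F) (i : ℕ) (v : List (MvPolynomial ℕ F)) : Prop where
  length : A.length = 4 * i + 4
  valid : A.Valid
  eval : ∀ r < 3, A.polys.getD (4 * i + r) 0 = v.getD r 0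

theorem poly_shift {w v : List (MvPolynomial ℕ F)} {i : ℕ} {g : Gate ℕ F}
    (h : ∀ r < 3, w.getD (4 * i + r) 0 = v.getD r 0) (hg : (∀ j ∈ g.args, j < 3) ∧ ∀ j, g ≠ .inv j) :
    (g.shift i).poly w = g.poly v := by
  cases g with
  | var => rfl
  | const => rfl
  | mul j k =>
    have hj := hg.1 j (by simp [Gate.args])
    have hk := hg.1 k (by simp [Gate.args])
    rw [Gate.shift, Gate.poly, Gate.poly, blockPos_eq hj, blockPos_eq hk, h j hj, h k hk]
  | inv j => exact absurd rfl (hg.2 j)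
  | lin l =>
    rw [Gate.shift, Gate.poly, Gate.poly, List.map_map]
    congr 1
    refine List.map_congr_left fun t ht => ?_
    have ht' := hg.1 t.2 (by simp only [Gate.args, List.mem_map]; exact ⟨t, ht, rfl⟩)
    rw [Function.comp_apply, blockPos_eq ht', h t.2 ht']

/-- A block reads only the first three gates of its predecessor, so its effect is a map on triples
of polynomials. The circuit of a system can then be analysed as a fold of `runBlock`. -/
theorem BlockState.append_block {A : Circuit ℕ F} {i : ℕ} {v : List (MvPolynomial ℕ F)}
    (hA : BlockState A i v) {d : Block F} (hd : BlockOk d) :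
    BlockState (A ++ d.map (Gate.shift i)) (i + 1) (runBlock v d) := by
  obtain ⟨g₀, g₁, g₂, rfl, hg⟩ := hd
  have hlen := hA.length
  have hval : ∀ (B : Circuit ℕ F) (g : Gate ℕ F), Circuit.Valid (A ++ B) →
      ((∀ j ∈ g.args, j < 3) ∧ ∀ j, g ≠ .inv j) → Circuit.Valid (A ++ (B ++ [g.shift i])) := by
    intro B g hB hg
    rw [← List.append_assoc, Circuit.valid_concat]
    refine ⟨hB, fun j hj => ?_, fun j hj => ?_⟩
    · rw [Gate.args_shift, List.mem_map] at hj
      obtain ⟨j, hj, rfl⟩ := hj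
      have := hg.1 j hj
      rw [List.length_append, blockPos_eq this]
      omega
    · cases g <;> simp [Gate.shift] at hj
      exact absurd rfl (hg.2 _)
  have hpoly : ∀ (B : Circuit ℕ F) (g : Gate ℕ F),
      ((∀ j ∈ g.args, j < 3) ∧ ∀ j, g ≠ .inv j) →
      (Circuit.polys (A ++ (B ++ [g.shift i]))).getD (4 * (i + 1) + B.length) 0 = g.poly v := by
    intro B g hg
    rw [← List.append_assoc]
    have := Circuit.getD_polys_concat (A ++ B) (g.shift i)
    rw [List.length_append, hlen] at this
    rw [show 4 * (i + 1) + B.length = 4 * i + 4 + B.length by ring, this]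
    refine poly_shift (fun r hr => ?_) hg
    rw [Circuit.getD_polys_append _ _ (by omega), hA.eval r hr]
  have h₀ := hg g₀ (by simp)
  have h₁ := hg g₁ (by simp)
  have h₂ := hg g₂ (by simp)
  have h₃ : (∀ j ∈ (Gate.const 1 : Gate ℕ F).args, j < 3) ∧ ∀ j, (Gate.const 1 : Gate ℕ F) ≠ .inv j := by
    simp [Gate.args]
  refine ⟨by simp; omega, ?_, ?_⟩
  · exact hval [_, _, _] _ (hval [_, _] _ (hval [_] _ (hval [] _ (by simpa using hA.valid) h₀) h₁) h₂) h₃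
  · intro r hr
    have hext : ∀ B B' : Circuit ℕ F, r < B.length →
        (Circuit.polys (A ++ (B ++ B'))).getD (4 * (i + 1) + r) 0 =
          (Circuit.polys (A ++ B)).getD (4 * (i + 1) + r) 0 := by
      intro B B' hB
      rw [← List.append_assoc, Circuit.getD_polys_append _ _ (by rw [List.length_append]; omega)]
    match r, hr with
    | 0, _ => exact (hext [_] [_, _, _] (by simp)).trans (hpoly [] g₀ h₀)
    | 1, _ => exact (hext [_, _] [_, _] (by simp)).trans (hpoly [_] g₁ h₁)
    | 2, _ => exact (hext [_, _, _] [_] (by simp)).trans (hpoly [_, _] g₂ h₂)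

theorem BlockState.append_blocks {l : List (Block F)} (hl : ∀ d ∈ l, BlockOk d) :
    ∀ {A : Circuit ℕ F} {i : ℕ} {v : List (MvPolynomial ℕ F)}, BlockState A i v →
      BlockState (A ++ placeBlocks i l) (i + l.length) (l.foldl runBlock v) := by
  induction l with
  | nil => intro A i v h; simpa [placeBlocks] using h
  | cons d l ih =>
    intro A i v h
    have := ih (fun d hd => hl d (by simp [hd])) (h.append_block (hl d (by simp)))
    rw [placeBlocks_cons, ← List.append_assoc, List.foldl_cons, List.length_cons,
      show i + (l.length + 1) = i + 1 + l.length by ring]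
    exact this

theorem runBlock_clear (s p w : MvPolynomial ℕ F) : runBlock [s, p, w] (clearBlock 1) = [0, p, w] := by
  simp [runBlock, clearBlock, keepGate, Gate.poly]

theorem runBlock_keep (s p w : MvPolynomial ℕ F) : runBlock [s, p, w] (keepBlock 1) = [s, p, w] := by
  simp [runBlock, keepBlock, keepGate, Gate.poly]

theorem runBlock_coef (s p w : MvPolynomial ℕ F) (c : F) :
    runBlock [s, p, w] (coefBlock 1 c) = [s, C c, w] := by
  simp [runBlock, coefBlock, keepGate, Gate.poly]

theorem runBlock_var (s p w : MvPolynomial ℕ F) (v : ℕ) :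
    runBlock [s, p, w] (varBlock 1 v) = [s, p, X v] := by
  simp [runBlock, varBlock, keepGate, Gate.poly]

theorem runBlock_bit (s p w : MvPolynomial ℕ F) (b : Bool) :
    runBlock [s, p, w] (bitBlock 1 b) = [s, p * w ^ b.toNat, w * w] := by
  cases b <;> simp [runBlock, bitBlock, keepGate, Gate.poly]

theorem runBlock_add (s p w : MvPolynomial ℕ F) :
    runBlock [s, p, w] (addBlock 1) = [s + p, p, w] := by
  simp [runBlock, addBlock, keepGate, Gate.poly]

theorem foldl_runBlock_bits (l : List Bool) : ∀ s p w : MvPolynomial ℕ F,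
    ∃ w', (l.map (bitBlock 1)).foldl runBlock [s, p, w] = [s, p * w ^ ofBits l, w'] := by
  induction l with
  | nil => intro s p w; exact ⟨w, by simp [ofBits]⟩
  | cons b l ih =>
    intro s p w
    obtain ⟨w', h⟩ := ih s (p * w ^ b.toNat) (w * w)
    refine ⟨w', ?_⟩
    rw [List.map_cons, List.foldl_cons, runBlock_bit, h]
    have : ofBits (b :: l) = 2 * ofBits l + b.toNat := Nat.bit_val _ _
    rw [this, pow_add, pow_mul, sq, mul_assoc, mul_comm (w ^ b.toNat)]

theorem foldl_runBlock_factors (l : List (ℕ × ℕ)) : ∀ s p w : MvPolynomial ℕ F,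
    ∃ w', (l.flatMap (factorBlocks 1)).foldl runBlock [s, p, w] =
      [s, p * (l.map fun m => X m.1 ^ m.2).prod, w'] := by
  induction l with
  | nil => intro s p w; exact ⟨w, by simp⟩
  | cons m l ih =>
    intro s p w
    obtain ⟨w₁, h₁⟩ := foldl_runBlock_bits m.2.bits s p (X m.1)
    obtain ⟨w₂, h₂⟩ := ih s (p * X m.1 ^ m.2) w₁
    refine ⟨w₂, ?_⟩
    rw [List.flatMap_cons, List.foldl_append, factorBlocks, List.foldl_cons, runBlock_var, h₁,
      ofBits_bits, h₂, List.map_cons, List.prod_cons, mul_assoc]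

theorem foldl_runBlock_terms (f : SparsePoly F) : ∀ s p w : MvPolynomial ℕ F,
    ∃ p' w', (f.flatMap (termBlocks 1)).foldl runBlock [s, p, w] = [s + f.toPoly, p', w'] := by
  induction f with
  | nil => intro s p w; exact ⟨p, w, by simp [SparsePoly.toPoly]⟩
  | cons t f ih =>
    intro s p w
    obtain ⟨w₁, h₁⟩ := foldl_runBlock_factors t.2 s (C t.1) w
    obtain ⟨p₂, w₂, h₂⟩ := ih (s + C t.1 * (t.2.map fun m => X m.1 ^ m.2).prod)
      (C t.1 * (t.2.map fun m => X m.1 ^ m.2).prod) w₁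
    refine ⟨p₂, w₂, ?_⟩
    rw [List.flatMap_cons, List.foldl_append, termBlocks, List.foldl_cons, runBlock_coef,
      List.foldl_append, h₁, List.foldl_cons, List.foldl_nil, runBlock_add, h₂]
    simp [SparsePoly.toPoly, add_assoc]

theorem foldl_runBlock_poly (f : SparsePoly F) (s p w : MvPolynomial ℕ F) :
    ∃ p' w', (polyBlocks 1 f).foldl runBlock [s, p, w] = [f.toPoly, p', w'] := by
  obtain ⟨p', w', h⟩ := foldl_runBlock_terms f 0 p w
  exact ⟨p', w', by rw [polyBlocks, List.foldl_cons, runBlock_clear, h, zero_add]⟩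

theorem blockOk_of_mem_polyBlocks {f : SparsePoly F} {d : Block F} (h : d ∈ polyBlocks 1 f) :
    BlockOk d := by
  simp only [polyBlocks, termBlocks, factorBlocks, List.mem_cons, List.mem_flatMap, List.mem_append,
    List.mem_map, List.not_mem_nil, or_false] at h
  rcases h with rfl | ⟨t, -, rfl | ⟨m, -, rfl | ⟨b, -, rfl⟩⟩ | rfl⟩
  · exact ⟨_, _, _, rfl, by simp [Gate.args, keepGate]⟩
  · exact ⟨_, _, _, rfl, by simp [Gate.args, keepGate]⟩
  · exact ⟨_, _, _, rfl, by simp [Gate.args, keepGate]⟩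
  · cases b <;> exact ⟨_, _, _, rfl, by simp [Gate.args, keepGate]⟩
  · exact ⟨_, _, _, rfl, by simp [Gate.args, keepGate]⟩

theorem blockOk_outBlock (b : Bool) : BlockOk (outBlock (1 : F) b) := by
  cases b <;> exact ⟨_, _, _, rfl, by simp [Gate.args, keepGate]⟩

theorem blockState_init : BlockState (initBlock (1 : F)) 0 [0, 1, 1] := by
  refine ⟨rfl, ?_, ?_⟩
  · rw [show initBlock (1 : F) = [] ++ [Gate.lin []] ++ [Gate.const 1] ++ [Gate.const 1] ++
      [Gate.const 1] from rfl]
    simp only [Circuit.valid_concat, Circuit.GateValid]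
    simp [Gate.args, Circuit.valid_nil]
  · intro r hr
    match r, hr with
    | 0, _ => simp [initBlock, Circuit.polys, Gate.poly]
    | 1, _ => simp [initBlock, Circuit.polys, Gate.poly]
    | 2, _ => simp [initBlock, Circuit.polys, Gate.poly]

theorem exists_blockState_concat {b : Bool} {S : List (SparsePoly F)} {s p w : MvPolynomial ℕ F}
    (h : BlockState (systemCircuit 1 b S) (systemBlocks (1 : F) true S).length [s, p, w])
    (f : SparsePoly F) :
    ∃ p' w', BlockState (systemCircuit 1 b (S ++ [f])) (systemBlocks (1 : F) true (S ++ [f])).length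
      [bif b then f.toPoly else 0, p', w'] := by
  have h1 := h.append_blocks (l := polyBlocks 1 f) fun d hd => blockOk_of_mem_polyBlocks hd
  obtain ⟨p', w', e⟩ := foldl_runBlock_poly f s p w
  have h2 := h1.append_block (blockOk_outBlock b)
  rw [← systemCircuit_concat, e] at h2
  have hl : (systemBlocks (1 : F) true (S ++ [f])).length =
      (systemBlocks (1 : F) true S).length + (polyBlocks 1 f).length + 1 := by
    simp [systemBlocks]; ring
  rw [hl]
  cases b with
  | true => rw [outBlock, cond_true, runBlock_keep] at h2; exact ⟨_, _, h2⟩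
  | false => rw [outBlock, cond_false, runBlock_clear] at h2; exact ⟨_, _, h2⟩

theorem exists_blockState_system (b : Bool) (S : List (SparsePoly F)) :
    ∃ s p w, BlockState (systemCircuit 1 b S) (systemBlocks (1 : F) true S).length [s, p, w] := by
  induction S using List.reverseRecOn with
  | nil => exact ⟨0, 1, 1, by simpa [systemCircuit, placeBlocks, systemBlocks] using blockState_init⟩
  | append_singleton S f ih =>
    obtain ⟨s, p, w, h⟩ := ih
    exact ⟨_, exists_blockState_concat h f⟩

theorem valid_systemCircuit (b : Bool) (S : List (SparsePoly F)) : (systemCircuit 1 b S).Valid := by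
  obtain ⟨s, p, w, h⟩ := exists_blockState_system b S
  exact h.valid

theorem length_systemCircuit (b : Bool) (S : List (SparsePoly F)) :
    (systemCircuit 1 b S).length = 4 * (systemBlocks (1 : F) true S).length + 4 := by
  obtain ⟨s, p, w, h⟩ := exists_blockState_system b S
  exact h.length

theorem systemCircuit_prefix (b : Bool) (S S' : List (SparsePoly F)) :
    ∃ D, systemCircuit 1 b (S ++ S') = systemCircuit (1 : F) b S ++ D := by
  simp only [systemCircuit, systemBlocks, List.flatMap_append, placeBlocks_append]
  exact ⟨_, (List.append_assoc _ _ _).symm⟩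

/-- The position of the value of a polynomial of the system. -/
def outPos (S : List (SparsePoly F)) (j : ℕ) : ℕ :=
  4 * (systemBlocks (1 : F) true (S.take (j + 1))).length

/-- Since `initBlock` is block 0, the number of blocks used for the first `j + 1` polynomials is the
index of the last of them. This is the `outBlock` of polynomial `j`, with the value at its first
gate. -/
theorem getD_polys_outPos (b : Bool) {S : List (SparsePoly F)} (j : Fin S.length) :
    outPos S j < (systemCircuit 1 b S).length ∧ (systemCircuit 1 b S).polys.getD (outPos S j) 0 =
      bif b then (S.get j).toPoly else 0 := by
  obtain ⟨s, p, w, h⟩ := exists_blockState_system b (S.take j)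
  obtain ⟨p', w', h'⟩ := exists_blockState_concat h (S.get j)
  have e : S.take j ++ [S.get j] = S.take (j + 1) := by
    rw [List.get_eq_getElem, List.take_concat_get']
  rw [e] at h'
  obtain ⟨D, hD⟩ := systemCircuit_prefix b (S.take (j + 1)) (S.drop (j + 1))
  rw [List.take_append_drop] at hD
  have hlt : outPos S j < (systemCircuit 1 b (S.take (j + 1))).length := by
    rw [h'.length, outPos]; omega
  rw [hD]
  refine ⟨by rw [List.length_append]; omega, ?_⟩
  rw [Circuit.getD_polys_append _ _ hlt]
  exact h'.eval 0 (by omega)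

theorem getD_polys_three (b : Bool) (S : List (SparsePoly F)) :
    (systemCircuit 1 b S).polys.getD 3 0 = 1 := by
  rw [systemCircuit, Circuit.getD_polys_append _ _ (by simp [initBlock])]
  simp [initBlock, Circuit.polys, Gate.poly]

variable {K : Type*} [Field K] [Algebra F K]

theorem scanGates_append_congr {G R : Type*} {step : List R → G → R} {c c' : List G}
    (h : scanGates step c = scanGates step c') (d : List G) :
    scanGates step (c ++ d) = scanGates step (c' ++ d) := by
  induction d using List.reverseRecOn with
  | nil => simpa using h
  | append_singleton d g ih =>
    rw [← List.append_assoc, ← List.append_assoc, scanGates_concat, scanGates_concat, ih]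

/-- At a common zero of the system, its polynomials may be replaced by zero. -/
theorem vals_systemCircuit (a : ℕ → K) {S : List (SparsePoly F)}
    (ha : ∀ f ∈ S, aeval a f.toPoly = 0) :
    vals a (systemCircuit 1 true S) = vals a (systemCircuit 1 false S) := by
  induction S using List.reverseRecOn with
  | nil => rfl
  | append_singleton S f ih =>
    have ih := ih fun f hf => ha f (by simp [hf])
    obtain ⟨s, p, w, h⟩ := exists_blockState_system true S
    have h1 := h.append_blocks (l := polyBlocks 1 f) fun d hd => blockOk_of_mem_polyBlocks hd
    obtain ⟨p', w', e⟩ := foldl_runBlock_poly f s p w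
    rw [e] at h1
    rw [systemCircuit_concat, systemCircuit_concat]
    set n := (systemBlocks (1 : F) true S).length + (polyBlocks 1 f).length
    set A := systemCircuit 1 true S ++ placeBlocks (systemBlocks (1 : F) true S).length (polyBlocks 1 f)
    set A' := systemCircuit 1 false S ++ placeBlocks (systemBlocks (1 : F) true S).length (polyBlocks 1 f)
    have hA : vals a A = vals a A' := scanGates_append_congr ih _
    have h0 : (vals a A).getD (4 * n) 0 = 0 := by
      rw [← map_aeval_polys a h1.valid.synCheck, getD_map_aeval]
      have := h1.eval 0 (by omega)
      simp only [add_zero] at this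
      rw [this]
      exact ha f (by simp)
    -- Only the first gate of the closing block differs: one circuit copies the value of `f` at `a`,
    -- which is zero, and the other has an empty sum.
    have key : vals a (A ++ [(keepGate 1 0).shift n]) =
        vals a (A' ++ [(Gate.lin []).shift n]) := by
      rw [vals, scanGates_concat, vals, scanGates_concat, ← show vals a A = scanGates (gateVal a) A' from hA]
      congr 2
      simp only [keepGate, Gate.shift, gateVal, List.map_cons, List.map_nil, List.sum_cons,
        List.sum_nil, add_zero]
      rw [blockPos_eq (by omega), add_zero,
        show (scanGates (gateVal a) A).getD (4 * n) 0 = 0 from h0, mul_zero]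
    have := scanGates_append_congr key ([keepGate 1 1, keepGate 1 2, .const 1].map
      (Gate.shift n))
    simpa [outBlock, keepBlock, clearBlock] using this

end Semantics

/-! ### Tests for certificates -/

section Tests

open MvPolynomial

variable {F : Type*}

/-- The circuit `B` on top of the circuit for a system (or zeros instead of the system). Its output
is gate `k`, minus one in the first case. -/
def testCircuit (one negOne : F) (b : Bool) (S : List (SparsePoly F)) (B : Circuit ℕ F) (k : ℕ) :
    Circuit ℕ F :=
  systemCircuit one b S ++ (B ++ [.lin (bif b then [(one, k), (negOne, 3)] else [(one, k)])])

variable [Field F]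

theorem Circuit.Computes.vals_last {K : Type*} [Field K] [Algebra F K] (a : ℕ → K) {c : Circuit ℕ F}
    {g : Gate ℕ F} (h : Circuit.Computes (c ++ [g]) 0) : gateVal a (vals a c) g = 0 := by
  obtain ⟨h1, -, h2⟩ := Circuit.computes_iff.1 h
  have h3 := congrArg (aeval a) h2
  rw [← getD_map_aeval, map_aeval_polys a h1.synCheck, map_zero] at h3
  simp only [List.length_append, List.length_singleton, Nat.add_sub_cancel] at h3
  rwa [getD_scanGates_concat] at h3

/-- At a common zero the two circuits agree at all gates below the output, so gate `k` has a single
value, which is 1 by the one test and 0 by the other. Nothing is assumed about how `B` uses the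
gates of the system. -/
theorem not_exists_zero_of_tests {S : List (SparsePoly F)} {B : Circuit ℕ F} {k : ℕ}
    (h1 : (testCircuit 1 (-1) true S B k).Computes 0)
    (h2 : (testCircuit 1 (-1) false S B k).Computes 0) (K : Type*) [Field K] [Algebra F K] :
    ¬ ∃ a : ℕ → K, ∀ f ∈ S, aeval a f.toPoly = 0 := by
  rintro ⟨a, ha⟩
  rw [testCircuit, ← List.append_assoc] at h1 h2
  have hv : vals a (systemCircuit 1 true S ++ B) = vals a (systemCircuit 1 false S ++ B) :=
    scanGates_append_congr (vals_systemCircuit a ha) B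
  have e1 := Circuit.Computes.vals_last a h1
  have e2 := Circuit.Computes.vals_last a h2
  rw [← hv] at e2
  have h3 : (vals a (systemCircuit 1 true S ++ B)).getD 3 0 = 1 := by
    rw [getD_scanGates_append _ _ _ (by rw [length_systemCircuit]; omega)]
    have := map_aeval_polys a (valid_systemCircuit true S).synCheck
    rw [show scanGates (gateVal a) (systemCircuit 1 true S) = _ from this.symm, getD_map_aeval,
      getD_polys_three, map_one]
  simp only [gateVal, cond_true, cond_false, List.map_cons, List.map_nil, List.sum_cons, List.sum_nil,
    h3, map_one, map_neg, one_mul, add_zero, mul_one] at e1 e2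
  rw [e2] at e1
  simp at e1

/-- A certificate as a circuit on top of another one, with gates instead of the variables `y`. -/
def Gate.embed {m : ℕ} (N : ℕ) (o : Fin m → ℕ) : Gate (ℕ ⊕ Fin m) F → Gate ℕ F
  | .var (.inl v) => .var v
  | .var (.inr j) => .lin [(1, o j)]
  | .const c => .const c
  | .mul j k => .mul (N + j) (N + k)
  | .inv j => .inv (N + j)
  | .lin l => .lin (l.map fun t => (t.1, N + t.2))

variable {m : ℕ} {A : Circuit ℕ F} {o : Fin m → ℕ}

theorem getD_append_map {R T : Type*} {l : List R} {l' : List T} {f : T → R} {N : ℕ} (hN : l.length = N)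
    {i : ℕ} (hi : i < l'.length) (x : R) (y : T) : (l ++ l'.map f).getD (N + i) x = f (l'.getD i y) := by
  rw [List.getD_append_right _ _ _ _ (by omega), hN, Nat.add_sub_cancel_left,
    List.getD_eq_getElem _ _ (by simpa using hi), List.getElem_map, List.getD_eq_getElem _ _ hi]

/-- Substitution for the `y` is an algebra homomorphism and commutes with all gates; at inversions
this uses that it fixes constants. Syntactic constancy need only be preserved in one direction, to
keep inversions valid. -/
theorem embed_spec (hA : A.Valid) (ho : ∀ j, o j < A.length) {c : Circuit (ℕ ⊕ Fin m) F}
    (hc : c.Valid) :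
    Circuit.Valid (A ++ c.map (Gate.embed A.length o)) ∧
    Circuit.polys (A ++ c.map (Gate.embed A.length o)) =
      A.polys ++ c.polys.map (aeval (Sum.elim X fun j => A.polys.getD (o j) 0)) ∧
    ∀ i, c.synConsts.getD i false = true →
      (Circuit.synConsts (A ++ c.map (Gate.embed A.length o))).getD (A.length + i) false = true := by
  induction c using List.reverseRecOn with
  | nil => simp [hA, Circuit.polys, Circuit.synConsts]
  | append_singleton c g ih =>
    obtain ⟨hc, hg⟩ := Circuit.valid_concat.1 hc
    obtain ⟨h1, h2, h3⟩ := ih hc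
    set σ : MvPolynomial (ℕ ⊕ Fin m) F →ₐ[F] MvPolynomial ℕ F :=
      aeval (Sum.elim X fun j => A.polys.getD (o j) 0) with hσ
    set D := A ++ c.map (Gate.embed A.length o) with hD
    have hDl : D.length = A.length + c.length := by simp [hD]
    have hget : ∀ j < c.length, (Circuit.polys D).getD (A.length + j) 0 =
        σ ((Circuit.polys c).getD j 0) := fun j hj => by
      rw [h2]
      exact getD_append_map (Circuit.length_polys A) (by rwa [Circuit.length_polys]) _ _
    rw [List.map_append, List.map_singleton, ← List.append_assoc, Circuit.valid_concat,
      Circuit.polys_concat, Circuit.polys_concat, h2, List.map_append, List.map_singleton,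
      List.append_assoc]
    rw [← h2]
    have hpoly : (g.embed A.length o).poly (Circuit.polys D) = σ (g.poly (Circuit.polys c)) := by
      cases g with
      | var v =>
        rcases v with v | j
        · simp [Gate.embed, Gate.poly, hσ]
        · simp only [Gate.embed, Gate.poly, hσ, List.map_cons, List.map_nil, List.sum_cons,
            List.sum_nil, C_1, one_mul, add_zero, aeval_X, Sum.elim_inr]
          exact Circuit.getD_polys_append _ _ (ho j)
      | const a => simp [Gate.embed, Gate.poly, hσ, algebraMap_eq]
      | mul j k =>
        rw [Gate.embed, Gate.poly, Gate.poly, hget j (hg.1 j (by simp [Gate.args])),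
          hget k (hg.1 k (by simp [Gate.args])), map_mul]
      | inv j =>
        obtain ⟨a, ha⟩ := Circuit.eq_C_of_synConsts c j (hg.2 j rfl).1
        rw [Gate.embed, Gate.poly, Gate.poly, hget j (hg.1 j (by simp [Gate.args])), ha]
        simp [hσ, algebraMap_eq]
      | lin l =>
        simp only [Gate.embed, Gate.poly, map_list_sum, List.map_map]
        congr 1
        refine List.map_congr_left fun t ht => ?_
        simp only [Function.comp_apply, map_mul]
        rw [hget t.2 (hg.1 _ (by simp only [Gate.args, List.mem_map]; exact ⟨t, ht, rfl⟩))]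
        simp [hσ, algebraMap_eq]
    refine ⟨⟨h1, fun j hj => ?_, fun j hj => ?_⟩, by rw [hpoly], fun i hi => ?_⟩
    · rw [hDl]
      cases g with
      | var v =>
        rcases v with v | i
        · simp [Gate.embed, Gate.args] at hj
        · simp only [Gate.embed, Gate.args, List.map_cons, List.map_nil, List.mem_singleton] at hj
          have := ho i
          omega
      | const a => simp [Gate.embed, Gate.args] at hj
      | mul i k =>
        have := hg.1 i (by simp [Gate.args])
        have := hg.1 k (by simp [Gate.args])
        simp only [Gate.embed, Gate.args, List.mem_cons, List.not_mem_nil, or_false] at hj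
        omega
      | inv i =>
        have := hg.1 i (by simp [Gate.args])
        simp only [Gate.embed, Gate.args, List.mem_cons, List.not_mem_nil, or_false] at hj
        omega
      | lin l =>
        simp only [Gate.embed, Gate.args, List.map_map, List.mem_map] at hj
        obtain ⟨t, ht, rfl⟩ := hj
        have := hg.1 t.2 (by simp only [Gate.args, List.mem_map]; exact ⟨t, ht, rfl⟩)
        simp only [Function.comp_apply]
        omega
    · cases g with
      | inv i =>
        obtain rfl : A.length + i = j := by simpa [Gate.embed] using hj
        obtain ⟨h4, h5⟩ := hg.2 i rfl
        refine ⟨h3 i h4, ?_⟩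
        rw [hget i (hg.1 i (by simp [Gate.args]))]
        obtain ⟨a, ha⟩ := Circuit.eq_C_of_synConsts c i h4
        rw [ha] at h5 ⊢
        simpa [hσ, algebraMap_eq] using h5
      | var v => rcases v with v | i <;> simp [Gate.embed] at hj
      | _ => simp [Gate.embed] at hj
    · rcases lt_or_ge i c.length with hlt | hge
      · rw [Circuit.getD_synConsts_append _ _ hlt] at hi
        rw [Circuit.getD_synConsts_append _ _ (by rw [List.length_append, List.length_map]; omega)]
        exact h3 i hi
      · obtain rfl : i = c.length := by
          have := Circuit.lt_length_of_synConsts hi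
          simp at this; omega
        rw [Circuit.getD_synConsts_concat] at hi
        rw [← hDl, Circuit.getD_synConsts_concat]
        cases g with
        | var v => simp [Gate.synConst] at hi
        | const a => rfl
        | mul j k =>
          simp only [Gate.synConst, Bool.and_eq_true] at hi
          simp only [Gate.embed, Gate.synConst, Bool.and_eq_true]
          exact ⟨h3 j hi.1, h3 k hi.2⟩
        | inv j => exact h3 j hi
        | lin l =>
          simp only [Gate.synConst, List.all_eq_true] at hi
          simp only [Gate.embed, Gate.synConst, List.all_map, List.all_eq_true, Function.comp_apply]
          exact fun t ht => h3 t.2 (hi t ht)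

/-- The two tests express `C(x, F) = 1` and `C(x, 0) = 0`; the latter follows from membership of `C`
in the ideal of the `y`. -/
theorem computes_test {S : List (SparsePoly F)} {c : Circuit (ℕ ⊕ Fin S.length) F}
    {C : MvPolynomial (ℕ ⊕ Fin S.length) F} (hc : c.Computes C)
    (hC : IsIPSCertificate (fun j => (S.get j).toPoly) 1 C) {N : ℕ}
    (hN : N = 4 * (systemBlocks (1 : F) true S).length + 4) (b : Bool) :
    (testCircuit 1 (-1) b S (c.map (Gate.embed N fun j => outPos S j)) (N + (c.length - 1))).Computes
      0 := by
  obtain ⟨hv, hne, hlast⟩ := Circuit.computes_iff.1 hc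
  have hpos := List.length_pos_of_ne_nil hne
  have hN' : N = (systemCircuit 1 b S).length := by rw [length_systemCircuit, hN]
  obtain ⟨h1, h2, -⟩ := embed_spec (valid_systemCircuit b S)
    (o := fun j : Fin S.length => outPos S j) (fun j => (getD_polys_outPos b j).1) hv
  rw [← hN'] at h1 h2
  set D := systemCircuit 1 b S ++ c.map (Gate.embed N fun j => outPos S j) with hD
  have hDl : D.length = N + c.length := by rw [hD, List.length_append, List.length_map, hN']
  have hk : (Circuit.polys D).getD (N + (c.length - 1)) 0 = bif b then 1 else 0 := by
    rw [h2, getD_append_map (by rw [Circuit.length_polys, hN']) (by rw [Circuit.length_polys]; omega) _ 0,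
      hlast]
    cases b with
    | true =>
      have : (fun j : Fin S.length => (systemCircuit 1 true S).polys.getD (outPos S j) 0) =
          fun j => (S.get j).toPoly := funext fun j => (getD_polys_outPos true j).2
      rw [this, hC.1, cond_true]
    | false =>
      have : (fun j : Fin S.length => (systemCircuit 1 false S).polys.getD (outPos S j) 0) =
          fun j => 0 := funext fun j => (getD_polys_outPos false j).2
      rw [this, aeval_eq_zero_of_mem_span hC.2, cond_false]
  have h3 : (Circuit.polys D).getD 3 0 = 1 := by
    rw [hD, Circuit.getD_polys_append _ _ (by omega), getD_polys_three]
  rw [testCircuit, ← List.append_assoc]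
  refine Circuit.computes_iff.2 ⟨Circuit.valid_concat.2 ⟨h1, fun j hj => ?_, by simp⟩, by simp, ?_⟩
  · rw [hDl]
    cases b with
    | true =>
      simp only [Gate.args, cond_true, List.map_cons, List.map_nil, List.mem_cons, List.not_mem_nil,
        or_false] at hj
      omega
    | false =>
      simp only [Gate.args, cond_false, List.map_cons, List.map_nil, List.mem_cons, List.not_mem_nil,
        or_false] at hj
      omega
  · rw [List.length_append, List.length_singleton, Nat.add_sub_cancel, Circuit.getD_polys_concat,
      Gate.poly]
    cases b with
    | true =>
      simp only [cond_true, List.map_cons, List.map_nil, List.sum_cons, List.sum_nil] at hk ⊢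
      rw [hk, h3]
      simp
    | false =>
      simp only [cond_false, List.map_cons, List.map_nil, List.sum_cons, List.sum_nil] at hk ⊢
      rw [hk]
      simp

end Tests

/-! ### Tests on words -/

section Naturality

variable {F G : Type*} (φ : F → G) (one negOne : F)

theorem map_mapF_map_shift (i : ℕ) (d : Block F) :
    (d.map (Gate.shift i)).map (Gate.mapF φ) = (d.map (Gate.mapF φ)).map (Gate.shift i) := by
  simp [Gate.mapF_shift, Function.comp_def]

theorem systemBlocks_mapF (b : Bool) (S : List (SparsePoly F)) :
    (systemBlocks one b S).map (List.map (Gate.mapF φ)) =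
      systemBlocks (φ one) b (S.map (SparsePoly.mapF φ)) := by
  have hbit : ∀ b, (bitBlock one b).map (Gate.mapF φ) = bitBlock (φ one) b := fun b => by
    cases b <;> rfl
  have hfac : ∀ m, (factorBlocks one m).map (List.map (Gate.mapF φ)) = factorBlocks (φ one) m := by
    intro m
    rw [factorBlocks, List.map_cons, List.map_map, factorBlocks]
    congr 1
    exact List.map_congr_left fun b _ => hbit b
  have hterm : ∀ t : F × List (ℕ × ℕ), (termBlocks one t).map (List.map (Gate.mapF φ)) =
      termBlocks (φ one) (φ t.1, t.2) := by
    intro t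
    simp only [termBlocks, List.map_cons, List.map_append, List.map_flatMap, hfac]
    rfl
  have hpoly : ∀ f : SparsePoly F, (polyBlocks one f).map (List.map (Gate.mapF φ)) =
      polyBlocks (φ one) (SparsePoly.mapF φ f) := by
    intro f
    simp only [polyBlocks, List.map_cons, List.map_flatMap, hterm, SparsePoly.mapF, List.flatMap_map]
    rfl
  have hout : (outBlock one b).map (Gate.mapF φ) = outBlock (φ one) b := by cases b <;> rfl
  simp only [systemBlocks, List.map_flatMap, List.map_append, hpoly, List.flatMap_map,
    List.map_cons, List.map_nil, hout]

theorem systemCircuit_mapF (b : Bool) (S : List (SparsePoly F)) :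
    (systemCircuit one b S).map (Gate.mapF φ) =
      systemCircuit (φ one) b (S.map (SparsePoly.mapF φ)) := by
  have hplace : ∀ i (l : List (Block F)), (placeBlocks i l).map (Gate.mapF φ) =
      placeBlocks i (l.map (List.map (Gate.mapF φ))) := by
    intro i l
    induction l generalizing i with
    | nil => rfl
    | cons d l ih =>
      rw [placeBlocks_cons, List.map_append, ih, List.map_cons, placeBlocks_cons, map_mapF_map_shift]
  rw [systemCircuit, List.map_append, hplace, systemBlocks_mapF]
  rfl

theorem testCircuit_mapF (b : Bool) (S : List (SparsePoly F)) (B : Circuit ℕ F) (k : ℕ) :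
    (testCircuit one negOne b S B k).map (Gate.mapF φ) =
      testCircuit (φ one) (φ negOne) b (S.map (SparsePoly.mapF φ)) (B.map (Gate.mapF φ)) k := by
  rw [testCircuit, List.map_append, List.map_append, systemCircuit_mapF, testCircuit]
  cases b <;> rfl

/-- Every coefficient of the system is a constant of the test circuit, so membership of the test in
PIT shows that these words encode field elements. -/
theorem const_mem_systemCircuit (b : Bool) {S : List (SparsePoly F)} {f : SparsePoly F}
    (hf : f ∈ S) {t : F × List (ℕ × ℕ)} (ht : t ∈ f) : Gate.const t.1 ∈ systemCircuit one b S := by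
  have h1 : coefBlock one t.1 ∈ systemBlocks one b S := by
    simp only [systemBlocks, List.mem_flatMap, List.mem_append]
    refine ⟨f, hf, Or.inl ?_⟩
    simp only [polyBlocks, List.mem_cons, List.mem_flatMap]
    exact Or.inr ⟨t, ht, by simp [termBlocks]⟩
  obtain ⟨i, hi⟩ := List.mem_iff_getElem?.1 h1
  refine List.mem_append_right _ (List.mem_flatMap.2 ⟨(_, i), List.mem_zipIdx_iff_getElem?.2 hi, ?_⟩)
  exact List.mem_map.2 ⟨.const t.1, by simp, rfl⟩

theorem SparsePoly.exists_map_mapF [Nonempty F] {S : List (SparsePoly G)}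
    (h : ∀ f ∈ S, ∀ t ∈ f, ∃ a, t.1 = φ a) : ∃ S' : List (SparsePoly F), S = S'.map (SparsePoly.mapF φ) := by
  choose! g hg using h
  refine ⟨S.map fun f => f.map fun t => (g f t, t.2), ?_⟩
  rw [List.map_map]
  conv_lhs => rw [← List.map_id S]
  refine List.map_congr_left fun f hf => ?_
  rw [Function.comp_apply, SparsePoly.mapF, List.map_map]
  conv_lhs => rw [id, ← List.map_id f]
  exact List.map_congr_left fun t ht => Prod.ext (hg f hf t ht) rfl

end Naturality

section Words

variable {F : Type*} [Field F] (pres : FieldPresentation F)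

/-- The encoding of a test circuit. -/
def testWord (one negOne : LWord) (b : Bool) (X : List (SparsePoly LWord)) (B : Circuit ℕ LWord)
    (k : ℕ) : LWord := encRawCircuit (testCircuit one negOne b X B k)

theorem testWord_mapF (b : Bool) (S : List (SparsePoly F)) (B : Circuit ℕ F) (k : ℕ) :
    testWord (pres.encElem 1) (pres.encElem (-1)) b (S.map (SparsePoly.mapF pres.encElem))
      (B.map (Gate.mapF pres.encElem)) k =
      (testCircuit 1 (-1) b S B k).enc encNat pres.encElem := by
  rw [testWord, ← testCircuit_mapF, ← Circuit.enc_eq_raw]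

/-- The construction is natural in the coefficients. Carried out over the subtype of bracketed
expressions, it visibly produces only such expressions. -/
theorem rawCircuitOk_testCircuit {one negOne : LWord} (h1 : isItem one = true)
    (h2 : isItem negOne = true) (b : Bool) {X : List (SparsePoly LWord)} (hX : rawSystemOk X = true)
    {B : Circuit ℕ LWord} (hB : rawCircuitOk B = true) (k : ℕ) :
    rawCircuitOk (testCircuit one negOne b X B k) = true := by
  let F' := {w : LWord // isItem w = true}
  have hX' : ∀ f ∈ X, ∀ t ∈ f, isItem t.1 = true := by simpa [rawSystemOk] using hX
  have hB' : ∀ g ∈ B, ∀ a ∈ g.coefs, isItem a = true := by simpa [rawCircuitOk, rawGateOk] using hB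
  have : Nonempty F' := ⟨⟨one, h1⟩⟩
  obtain ⟨S, rfl⟩ := SparsePoly.exists_map_mapF (F := F') Subtype.val fun f hf t ht =>
    ⟨⟨t.1, hX' f hf t ht⟩, rfl⟩
  obtain ⟨C, rfl⟩ := Circuit.exists_mapF (F := F') Subtype.val fun g hg a ha =>
    ⟨⟨a, hB' g hg a ha⟩, rfl⟩
  have := testCircuit_mapF (Subtype.val : F' → LWord) ⟨one, h1⟩ ⟨negOne, h2⟩ b S C k
  rw [← this]
  exact rawCircuitOk_map (fun a => a.2) _

/-- Two successful tests show that a system has no common zero. -/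
theorem mem_varietyEmptiness_of_tests {X : List (SparsePoly LWord)} (hX : rawSystemOk X = true)
    {B : Circuit ℕ LWord} (hB : rawCircuitOk B = true) {k : ℕ}
    (h1 : testWord (pres.encElem 1) (pres.encElem (-1)) true X B k ∈ PIT pres)
    (h2 : testWord (pres.encElem 1) (pres.encElem (-1)) false X B k ∈ PIT pres) :
    encRawSystem X ∈ VarietyEmptiness pres := by
  have hraw : ∀ b, testWord (pres.encElem 1) (pres.encElem (-1)) b X B k ∈ PIT pres →
      ∃ c : Circuit ℕ F, testCircuit (pres.encElem 1) (pres.encElem (-1)) b X B k =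
        c.map (Gate.mapF pres.encElem) ∧ c.Computes 0 := by
    rintro b ⟨c, hc, h⟩
    refine ⟨c, encRawCircuit_injective (rawCircuitOk_testCircuit (isItem_encElem pres _)
      (isItem_encElem pres _) b hX hB k) (rawCircuitOk_map (isItem_encElem pres) c) ?_, h⟩
    rw [← Circuit.enc_eq_raw]
    exact hc
  obtain ⟨c₁, e₁, hc₁⟩ := hraw true h1
  obtain ⟨c₂, e₂, hc₂⟩ := hraw false h2
  have hcoef : ∀ g ∈ testCircuit (pres.encElem 1) (pres.encElem (-1)) true X B k, ∀ a ∈ g.coefs,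
      ∃ b, a = pres.encElem b := by
    rw [e₁]
    intro g hg a ha
    obtain ⟨g, -, rfl⟩ := List.mem_map.1 hg
    rw [Gate.coefs_mapF] at ha
    obtain ⟨b, -, rfl⟩ := List.mem_map.1 ha
    exact ⟨b, rfl⟩
  obtain ⟨S, rfl⟩ := SparsePoly.exists_map_mapF pres.encElem (S := X) fun f hf t ht =>
    hcoef (.const t.1) (List.mem_append_left _ (const_mem_systemCircuit _ _ hf ht)) t.1
      (by simp [Gate.coefs])
  obtain ⟨C, rfl⟩ := Circuit.exists_mapF pres.encElem (c := B) fun g hg =>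
    hcoef g (List.mem_append_right _ (List.mem_append_left _ hg))
  have hinj := (Gate.mapF_injective (V := ℕ) (encElem_injective pres)).list_map
  rw [← testCircuit_mapF] at e₁ e₂
  rw [← hinj e₁] at hc₁
  rw [← hinj e₂] at hc₂
  exact ⟨S, (encSystem_eq_raw _ _).symm, not_exists_zero_of_tests hc₁ hc₂ _⟩

end Words

/-! ### Lists of words -/

/-- A list of words as a single word. -/
def encWords (l : List LWord) : LWord :=
  l.flatMap fun w => w.flatMap (fun a => [Letter.b0, a]) ++ [Letter.b1, Letter.b1]

def decStep (s : LWord × List LWord) (p : Letter × Letter) : LWord × List LWord :=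
  if p.1 = Letter.b0 then (p.2 :: s.1, s.2) else ([], s.1.reverse :: s.2)

def decWords (w : LWord) : List LWord := ((pairUp w).foldl decStep ([], [])).2.reverse

theorem decWords_encWords (l : List LWord) : decWords (encWords l) = l := by
  have h1 : ∀ (w : LWord) (r : LWord) cur done,
      (pairUp (w.flatMap (fun a => [Letter.b0, a]) ++ r)).foldl decStep (cur, done) =
        (pairUp r).foldl decStep (w.reverse ++ cur, done) := by
    intro w
    induction w with
    | nil => intros; rfl
    | cons a w ih => intro r cur done; simp [pairUp, decStep, ih]
  have h2 : ∀ (l : List LWord) done, (pairUp (encWords l)).foldl decStep ([], done) =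
      ([], l.reverse ++ done) := by
    intro l
    induction l with
    | nil => intro done; rfl
    | cons w l ih =>
      intro done
      rw [encWords, List.flatMap_cons, List.append_assoc, h1]
      simp only [List.cons_append, List.nil_append, pairUp, List.foldl_cons, List.append_nil]
      have : decStep (w.reverse, done) (Letter.b1, Letter.b1) = ([], w :: done) := by
        simp [decStep]
      rw [this]
      have := ih (w :: done)
      rw [encWords] at this
      rw [this]
      simp
  rw [decWords, h2]; simp

theorem length_encWords (l : List LWord) :
    (encWords l).length = (l.map fun w => 2 * w.length + 2).sum := by
  simp [encWords, List.length_flatMap, mul_comm]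

namespace PT

variable {E : StackEnv} {α : Type} [TreeEnc α]

theorem decWords {f : α → LWord} (hf : PT E f) : PT E fun a => decWords (f a) := by
  suffices h : PT E fun w : LWord => _root_.decWords w from h.comp hf
  have hs : PT E fun w : LWord => (_root_.pairUp w).foldl decStep ([], []) := by
    refine foldl_of_growth (step := fun _ => decStep) (pairUp id) (const _)
      (ite (letterEq snd.p1 (const Letter.b0)) ((cons snd.p2 fst.p2.p1).pair fst.p2.p2)
        ((const []).pair (cons (reverse fst.p2.p1) fst.p2.p2))) 20 fun w s p _ => ?_
    obtain ⟨cur, done⟩ := s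
    have h1 := size_Letter_le p.2
    have h2 := size_reverse cur
    simp only [Polynomial.eval_ofNat, decStep]
    split <;> simp only [size_pair, size_cons, size_nil] <;> omega
  exact hs.p2.reverse

theorem blockPos {i r : α → ℕ} (hi : PT E i) (hr : PT E r) : PT E fun a => blockPos (i a) (r a) :=
  ite (natEq hr (const 0)) (bit false (bit false hi)) (ite (natEq hr (const 1))
    (bit true (bit false hi)) (bit false (bit true hi)))

theorem shift {g : α → RawGate} {i : α → ℕ} (hg : PT E g) (hi : PT E i) :
    PT E fun a => (g a).shift (i a) := by
  suffices h : PT E fun p : RawGate × ℕ => p.1.shift p.2 from h.comp (hg.pair hi)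
  refine gateCases fst.gateVar fst.gateConst (gateMul (blockPos snd fst.p1) (blockPos snd fst.p2))
    (blockPos snd fst).gateInv ?_
  exact (map (g := fun (p : List (LWord × ℕ) × ℕ) (t : LWord × ℕ) => (t.1, _root_.blockPos p.2 t.2))
    fst (snd.p1.pair (blockPos fst.p2 snd.p2))).gateLin

theorem systemCircuit (one : LWord) (b : Bool) {f : α → List (SparsePoly LWord)} (hf : PT E f) :
    PT E fun a => systemCircuit one b (f a) := by
  suffices h : PT E fun X : List (SparsePoly LWord) => _root_.systemCircuit one b X from h.comp hf
  have hk : ∀ (β : Type) [TreeEnc β] r, PT E fun _ : β => keepGate one r := fun β _ r => const _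
  have h1 : ∀ (β : Type) [TreeEnc β], PT E fun _ : β => (Gate.const one : RawGate) := fun β _ => const _
  have hfac : PT E fun m : ℕ × ℕ => factorBlocks one m :=
    cons (cons (hk _ 0) (cons (hk _ 1) (cons fst.gateVar (cons (h1 _) (const [])))))
      (map (g := fun _ b => bitBlock one b) snd.bits ((finFun (bitBlock one)).comp snd))
  have hterm : PT E fun t : LWord × List (ℕ × ℕ) => termBlocks one t :=
    cons (cons (hk _ 0) (cons fst.gateConst (cons (hk _ 2) (cons (h1 _) (const [])))))
      (append (flatMap (g := fun _ m => factorBlocks one m) snd (hfac.comp snd))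
        (const [addBlock one]))
  have hpoly : PT E fun f : SparsePoly LWord => polyBlocks one f :=
    cons (const (clearBlock one)) (flatMap (g := fun _ t => termBlocks one t) id (hterm.comp snd))
  have hsys : PT E fun X : List (SparsePoly LWord) => systemBlocks one b X :=
    flatMap (g := fun _ f => polyBlocks one f ++ [outBlock one b]) id
      (append (hpoly.comp snd) (const [outBlock one b]))
  exact append (const (initBlock one)) (flatMap
    (g := fun _ (p : List RawGate × ℕ) => p.1.map (Gate.shift p.2)) hsys.zipIdx
    (map (g := fun (p : List (SparsePoly LWord) × (List RawGate × ℕ)) g => Gate.shift p.2.2 g) snd.p1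
      (shift snd fst.p2.p2)))

theorem testWord (one negOne : LWord) (b : Bool) {f : α → List (SparsePoly LWord)}
    {g : α → Circuit ℕ LWord} {k : α → ℕ} (hf : PT E f) (hg : PT E g) (hk : PT E k) :
    PT E fun a => testWord one negOne b (f a) (g a) (k a) := by
  refine encRawCircuit (append (hf.systemCircuit one b) (append hg (cons (gateLin ?_) (const []))))
  cases b with
  | true => exact cons ((const one).pair hk) (const [(negOne, 3)])
  | false => exact cons ((const one).pair hk) (const [])

end PT

/-! ## Witnesses for identity testing give a proof system -/

section Backward

/-- The test circuit for a proof, which is a list of words for a system, a circuit and the position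
of its output, and for two witnesses. -/
def proofTest (one negOne : LWord) (b : Bool) (l : List LWord) : LWord :=
  testWord one negOne b (parseSystem (l.headD [])) (parseCircuit (l.tail.headD []))
    (decNat (l.tail.tail.headD []))

/-- The word for the system has to be the encoding of what is parsed from it, because it is the
theorem proved. For the circuit only the parsed result matters. -/
def proofCheck (one negOne : LWord) (V : LWord × LWord → Bool) (l : List LWord) : Bool :=
  decide (encRawSystem (parseSystem (l.headD [])) = l.headD []) &&
    rawSystemOk (parseSystem (l.headD [])) && rawCircuitOk (parseCircuit (l.tail.headD [])) &&
    V (proofTest one negOne true l, l.tail.tail.tail.headD []) &&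
    V (proofTest one negOne false l, l.tail.tail.tail.tail.headD [])

variable {F : Type*} [Field F] (pres : FieldPresentation F)

/-- The proof system that belongs to a verifier for identity testing. -/
noncomputable def proofSystem (V : LWord × LWord → Bool) (w : LWord) : LWord :=
  bif proofCheck (pres.encElem 1) (pres.encElem (-1)) V (decWords w) then (decWords w).headD []
  -- A word that fails the check proves a fixed member of Variety Emptiness, the system consisting
  -- of the constant 1.
  else encSystem pres.encElem [[(1, [])]]

theorem PT.proofTest (one negOne : LWord) (b : Bool) {E : StackEnv} {α : Type} [TreeEnc α]
    {f : α → List LWord} (hf : PT E f) : PT E fun a => proofTest one negOne b (f a) :=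
  PT.testWord one negOne b (PT.headD [] hf).parseSystem (PT.headD [] hf.tail).parseCircuit
    (PT.headD [] hf.tail.tail).decNat

/-- A verifier that accepts only witnesses of bounded length. -/
def boundedVerifier (p : Polynomial ℕ) (V : LWord × LWord → Bool) (a : LWord × LWord) : Bool :=
  decide (a.2.length ≤ p.eval a.1.length) && V a

namespace PT

variable {E : StackEnv} {α β γ : Type} [TreeEnc α] [TreeEnc β] [TreeEnc γ]

/-- Polynomials of the length of a list in unary. -/
theorem exists_unary (p : Polynomial ℕ) :
    ∃ u : List β → List Unit, PT E u ∧ ∀ w, (u w).length = p.eval w.length := by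
  induction p using Polynomial.induction_on with
  | C a => exact ⟨fun _ => List.replicate a (), const _, fun w => by simp⟩
  | add p q hp hq =>
    obtain ⟨u, hu, hu'⟩ := hp
    obtain ⟨v, hv, hv'⟩ := hq
    exact ⟨fun w => u w ++ v w, append hu hv, fun w => by simp [hu', hv']⟩
  | monomial n a ih =>
    obtain ⟨u, hu, hu'⟩ := ih
    refine ⟨fun w => w.flatMap fun _ => u w, flatMap (g := fun w _ => u w) id (hu.comp fst), fun w => ?_⟩
    simp only [List.length_flatMap, hu', List.map_const', List.sum_replicate, smul_eq_mul,
      Polynomial.eval_mul, Polynomial.eval_C, Polynomial.eval_pow, Polynomial.eval_X]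
    ring

theorem lengthLe {f : α → List β} {u : α → List γ} (hf : PT E f) (hu : PT E u) :
    PT E fun a => decide ((f a).length ≤ (u a).length) := by
  have h : PT E fun a => (u a).foldl (fun l _ => l.tail) (f a) := by
    refine foldl_of_growth (step := fun _ l _ => l.tail) hu hf (tail fst.p2) 0 fun c l _ _ => ?_
    cases l with
    | nil => simp
    | cons b l => simp only [List.tail_cons, size_cons]; omega
  refine h.isEmpty.congr fun a => ?_
  have key : ∀ (v : List γ) (l : List β), v.foldl (fun l _ => l.tail) l = l.drop v.length := by
    intro v
    induction v with
    | nil => intro l; rfl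
    | cons x v ih => intro l; rw [List.foldl_cons, ih, List.length_cons, ← List.drop_one, List.drop_drop, add_comm]
  rw [key, Bool.eq_iff_iff]
  simp

end PT

theorem polyTimeFun_proofSystem (p : Polynomial ℕ) {V : LWord × LWord → Bool}
    (M : TM2ComputableInPolyTime encPair Computability.encodeBool V) :
    PolyTimeFun (proofSystem pres (boundedVerifier p V)) := by
  set E : StackEnv := ⟨Letter, Letter, M.tm⟩ with hE
  have hl : PT E fun w : LWord => decWords w := PT.id.decWords
  have hs : PT E fun w : LWord => (decWords w).headD [] := PT.headD [] hl
  have hV : ∀ {f g : LWord → LWord}, PT E f → PT E g →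
      PT E fun w => boundedVerifier p V (f w, g w) := by
    intro f g hf hg
    have hp : PT E fun w => encPair (f w, g w) :=
      PT.append (PT.map (g := fun _ (a : Letter) => some a) hf ((PT.finFun some).comp PT.snd))
        (PT.cons (PT.const none) (PT.map (g := fun _ (a : Letter) => some a) hg
          ((PT.finFun some).comp PT.snd)))
    have ho : PT E fun w => Computability.encodeBool (V (f w, g w)) :=
      PT.oracle (E := E) (ea := encPair) (eb := Computability.encodeBool) M.inputAlphabet M.outputAlphabet
        M.time M.outputsFun hp
    obtain ⟨u, hu, hu'⟩ := PT.exists_unary (E := E) (β := Letter) p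
    refine ((PT.lengthLe hg (hu.comp hf)).and (PT.headD false ho)).congr fun w => ?_
    rw [boundedVerifier, hu']
    rfl
  have hc : PT E fun w : LWord => 
      proofCheck (pres.encElem 1) (pres.encElem (-1)) (boundedVerifier p V) (decWords w) :=
    PT.and (PT.and (PT.and (PT.and (PT.wordEq hs.parseSystem.encRawSystem hs)
      hs.parseSystem.rawSystemOk) (PT.headD [] hl.tail).parseCircuit.rawCircuitOk)
      (hV (hl.proofTest _ _ true) (PT.headD [] hl.tail.tail.tail)))
      (hV (hl.proofTest _ _ false) (PT.headD [] hl.tail.tail.tail.tail))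
  exact PT.tm2 (PT.cond hc hs (PT.const (encSystem pres.encElem [[(1, [])]]))) fun w => rfl

theorem proofSystem_mem {V : LWord × LWord → Bool}
    (hV : ∀ x w, V (x, w) = true → x ∈ PIT pres) (w : LWord) :
    proofSystem pres V w ∈ VarietyEmptiness pres := by
  rw [proofSystem]
  cases h : proofCheck (pres.encElem 1) (pres.encElem (-1)) V (decWords w) with
  | false =>
    refine ⟨[[(1, [])]], rfl, fun ⟨a, ha⟩ => ?_⟩
    have := ha [(1, [])] (by simp)
    simp [SparsePoly.toPoly] at this
  | true =>
    simp only [proofCheck, Bool.and_eq_true, decide_eq_true_eq] at h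
    obtain ⟨⟨⟨⟨h1, h2⟩, h3⟩, h4⟩, h5⟩ := h
    rw [cond_true, ← h1]
    exact mem_varietyEmptiness_of_tests pres h2 h3 (hV _ _ h4) (hV _ _ h5)

theorem length_embed_le {m : ℕ} {c : Circuit (ℕ ⊕ Fin m) F} {N n : ℕ} {o : Fin m → ℕ}
    (hargs : ∀ g ∈ c, ∀ j ∈ (g.embed N o).args, j < N + n)
    (hn : (c.enc encIPSVar pres.encElem).length ≤ n) :
    (Circuit.enc encNat pres.encElem (c.map (Gate.embed N o))).length ≤
      2 + n * (10 + (n + ((pres.encElem 1).length + 3)) * (N + n + 3)) := by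
  have hlen : c.length ≤ n := (Circuit.length_le_length_enc c).trans hn
  rw [Circuit.enc, length_encList, add_comm]
  refine Nat.add_le_add_left ?_ 2
  have hb : ∀ k ∈ (c.map (Gate.embed N o)).map fun g : Gate ℕ F => (g.enc encNat pres.encElem).length,
      k ≤ 10 + (n + ((pres.encElem 1).length + 3)) * (N + n + 3) := by
    intro k hk
    rw [List.map_map] at hk
    obtain ⟨g, hg, rfl⟩ := List.mem_map.1 hk
    refine (Gate.length_enc_le encNat pres.encElem (hargs g hg)).trans
      (Nat.add_le_add_left (Nat.mul_le_mul_right _ ?_) _)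
    have h1 : (g.enc encIPSVar pres.encElem).length ≤ n := (length_le_length_encList hg).trans hn
    have h2 : (g.embed N o).weight encNat pres.encElem ≤
        (g.enc encIPSVar pres.encElem).length + ((pres.encElem 1).length + 1) := by
      cases g with
      | var v =>
        rcases v with v | j
        · simp only [Gate.embed, Gate.weight, Gate.enc, encIPSVar, List.length_append]; omega
        · simp only [Gate.embed, Gate.weight, List.map_cons, List.map_nil, List.sum_cons,
            List.sum_nil]
          omega
      | const a => simp only [Gate.embed, Gate.weight, Gate.enc, List.length_append]; omega
      | lin l =>
        have := Gate.weight_le (encV := encIPSVar (m := m)) (encV' := encIPSVar)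
          (encF := pres.encElem) (K := 0) (fun _ => le_rfl) (.lin l)
        simp only [Gate.weight] at this
        simp only [Gate.embed, Gate.weight, List.map_map, Function.comp_def]
        omega
      | _ => simp [Gate.embed, Gate.weight]
    omega
  refine (List.sum_le_card_nsmul _ _ hb).trans ?_
  simp only [List.length_map, smul_eq_mul]
  exact Nat.mul_le_mul_right _ hlen

/-- The proof lists the system, the embedded certificate circuit, its output position and two
witnesses. Embedding and position are supplied by the proof, so the checking machine need not
compute with positions. -/
theorem exists_proofSystem_proof {V : LWord × LWord → Bool} {p : Polynomial ℕ}
    (hV : ∀ x, x ∈ PIT pres → ∃ w : LWord, w.length ≤ p.eval x.length ∧ V (x, w) = true) :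
    ∃ q : Polynomial ℕ, ∀ π x, IPSProves pres π x →
      ∃ π', proofSystem pres V π' = x ∧ π'.length ≤ q.eval π.length := by
  -- Computability is used only for length bounds here, so any callable machine will do.
  let E : StackEnv := ⟨Letter, Letter, idComputer Letter⟩
  have hA : PT E fun w : LWord => encRawCircuit (systemCircuit (pres.encElem 1) true (parseSystem w)) :=
    (PT.id.parseSystem.systemCircuit _ true).encRawCircuit
  obtain ⟨qA, hqA⟩ := hA.exists_length_le
  have hT : ∀ b, PT E fun w : LWord =>
      proofTest (pres.encElem 1) (pres.encElem (-1)) b (decWords w) :=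
    fun b => PT.id.decWords.proofTest _ _ b
  obtain ⟨q₁, hq₁⟩ := (hT true).exists_length_le
  obtain ⟨q₂, hq₂⟩ := (hT false).exists_length_le
  let qB : Polynomial ℕ := 2 + .X * (10 + (.X + ((pres.encElem 1).length + 3 : ℕ)) * (qA + .X + 3))
  let qK : Polynomial ℕ := qA + .X + 2
  let qU : Polynomial ℕ := 2 * (.X + qB + qK + p.comp (q₁.comp (2 * (.X + qB + qK) + 6)) +
    p.comp (q₂.comp (2 * (.X + qB + qK) + 6))) + 10
  refine ⟨qU, ?_⟩
  rintro π x ⟨S, c, C, rfl, rfl, hc, hC⟩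
  set s := encSystem pres.encElem S with hs
  set n := (s ++ Circuit.enc encIPSVar pres.encElem c).length with hn
  have hsn : s.length ≤ n := by rw [hn, List.length_append]; omega
  have hcn : (Circuit.enc encIPSVar pres.encElem c).length ≤ n := by
    rw [hn, List.length_append]; omega
  set N := 4 * (systemBlocks (1 : F) true S).length + 4 with hN
  set B := c.map (Gate.embed N fun j => outPos S j) with hB
  set k := N + (c.length - 1) with hk
  set b := Circuit.enc encNat pres.encElem B with hb
  have hparse : parseSystem s = S.map (SparsePoly.mapF pres.encElem) := by
    rw [hs, encSystem_eq_raw, parseSystem_enc (rawSystemOk_map (isItem_encElem pres) S)]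
  have hparseB : parseCircuit b = B.map (Gate.mapF pres.encElem) := by
    rw [hb, Circuit.enc_eq_raw, parseCircuit_enc (rawCircuitOk_map (isItem_encElem pres) B)]
  -- A circuit has no more gates than letters in its encoding, and this encoding is the output of a
  -- polynomial-time function of the system.
  have hNn : N ≤ qA.eval n := by
    have h1 := hqA s
    rw [hparse, ← systemCircuit_mapF, ← Circuit.enc_eq_raw] at h1
    have h2 := (Circuit.length_le_length_enc (encV := encNat) (encF := pres.encElem)
      (systemCircuit 1 true S)).trans h1
    rw [length_systemCircuit, ← hN] at h2
    exact h2.trans (Polynomial.eval_nat_mono qA hsn)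
  have hcl : c.length ≤ n := (Circuit.length_le_length_enc c).trans hcn
  have hbn : b.length ≤ qB.eval n := by
    refine (length_embed_le pres (n := n) (fun g hg j hj => ?_) hcn).trans ?_
    -- Validity of the test circuit bounds all positions that occur in the embedded gates.
    · have hv := (Circuit.computes_iff.1 (computes_test hc hC hN true)).1
      rw [testCircuit, ← List.append_assoc] at hv
      have hv := (Circuit.valid_concat.1 hv).1
      have hmem : g.embed N (fun j => outPos S j) ∈ systemCircuit 1 true S ++ B :=
        List.mem_append_right _ (List.mem_map_of_mem hg)
      obtain ⟨i, hi⟩ := List.mem_iff_getElem?.1 hmem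
      have h1 := (hv i _ hi).1 j hj
      have h2 := (List.getElem?_eq_some_iff.1 hi).1
      rw [List.length_append, length_systemCircuit, ← hN, hB, List.length_map] at h2
      omega
    · simp only [qB, Polynomial.eval_add, Polynomial.eval_mul, Polynomial.eval_ofNat,
        Polynomial.eval_X, Polynomial.eval_natCast]
      have : N + n + 3 ≤ qA.eval n + n + 3 := by omega
      exact Nat.add_le_add_left (Nat.mul_le_mul_left _ (Nat.add_le_add_left
        (Nat.mul_le_mul_left _ this) _)) _
  have hkn : (encNat k).length ≤ qK.eval n := by
    have := length_encNat_le k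
    simp only [qK, Polynomial.eval_add, Polynomial.eval_ofNat, Polynomial.eval_X]
    omega
  have htest : ∀ b' l, proofTest (pres.encElem 1) (pres.encElem (-1)) b' (s :: b :: encNat k :: l) =
      (testCircuit 1 (-1) b' S B k).enc encNat pres.encElem := by
    intro b' l
    rw [← testWord_mapF]
    simp only [proofTest, List.headD_cons, List.tail_cons, hparse, hparseB, decNat_encNat]
  have hwit : ∀ b', ∃ w : LWord,
      w.length ≤ p.eval ((testCircuit 1 (-1) b' S B k).enc encNat pres.encElem).length ∧
      V ((testCircuit 1 (-1) b' S B k).enc encNat pres.encElem, w) = true := fun b' =>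
    hV _ ⟨_, rfl, computes_test hc hC hN b'⟩
  obtain ⟨w₁, hw₁, hVw₁⟩ := hwit true
  obtain ⟨w₂, hw₂, hVw₂⟩ := hwit false
  have hlen3 : (encWords [s, b, encNat k]).length ≤ (2 * (.X + qB + qK) + 6 : Polynomial ℕ).eval n := by
    rw [length_encWords]
    simp only [List.map_cons, List.map_nil, List.sum_cons, List.sum_nil, Polynomial.eval_add,
      Polynomial.eval_mul, Polynomial.eval_ofNat, Polynomial.eval_X]
    omega
  have hl₁ : w₁.length ≤ (p.comp (q₁.comp (2 * (.X + qB + qK) + 6))).eval n := by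
    rw [Polynomial.eval_comp, Polynomial.eval_comp]
    refine hw₁.trans (Polynomial.eval_nat_mono p ?_)
    have := hq₁ (encWords [s, b, encNat k])
    rw [decWords_encWords, htest] at this
    exact this.trans (Polynomial.eval_nat_mono q₁ hlen3)
  have hl₂ : w₂.length ≤ (p.comp (q₂.comp (2 * (.X + qB + qK) + 6))).eval n := by
    rw [Polynomial.eval_comp, Polynomial.eval_comp]
    refine hw₂.trans (Polynomial.eval_nat_mono p ?_)
    have := hq₂ (encWords [s, b, encNat k])
    rw [decWords_encWords, htest] at this
    exact this.trans (Polynomial.eval_nat_mono q₂ hlen3)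
  refine ⟨encWords [s, b, encNat k, w₁, w₂], ?_, ?_⟩
  · have hcheck : proofCheck (pres.encElem 1) (pres.encElem (-1)) V [s, b, encNat k, w₁, w₂] = true := by
      rw [proofCheck, htest, htest]
      simp only [List.headD_cons, List.tail_cons, hparse, hparseB, hVw₁, hVw₂, ← encSystem_eq_raw, ← hs,
        rawSystemOk_map (isItem_encElem pres), rawCircuitOk_map (isItem_encElem pres), decide_true,
        Bool.and_self]
    rw [proofSystem, decWords_encWords, hcheck]
    rfl
  · rw [length_encWords]
    simp only [List.map_cons, List.map_nil, List.sum_cons, List.sum_nil]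
    have : qU.eval n = 2 * (n + qB.eval n + qK.eval n +
        (p.comp (q₁.comp (2 * (.X + qB + qK) + 6))).eval n +
        (p.comp (q₂.comp (2 * (.X + qB + qK) + 6))).eval n) + 10 := by
      simp only [qU, Polynomial.eval_add, Polynomial.eval_mul, Polynomial.eval_ofNat,
        Polynomial.eval_X]
    rw [this]
    omega

/-- The verifier given by `InNP` may accept overlong witnesses for words outside PIT, so it is
replaced by `boundedVerifier`, whose acceptance alone implies membership. -/
theorem exists_simulates_of_inNP_PIT (h : InNP (PIT pres)) :
    ∃ P : LWord → LWord, IsCookReckhow P (VarietyEmptiness pres) ∧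
      PSimulates (fun π x => P π = x) (IPSProves pres) (VarietyEmptiness pres) := by
  obtain ⟨V, p, ⟨M⟩, hV⟩ := h
  obtain ⟨q, hq⟩ := exists_proofSystem_proof pres (V := boundedVerifier p V) (p := p) fun x hx => by
    obtain ⟨w, h1, h2⟩ := (hV x).1 hx
    exact ⟨w, h1, by simp [boundedVerifier, h1, h2]⟩
  refine ⟨proofSystem pres (boundedVerifier p V), ⟨polyTimeFun_proofSystem pres p M,
    Set.Subset.antisymm ?_ ?_⟩, q, ?_⟩
  · rintro _ ⟨w, rfl⟩
    refine proofSystem_mem pres (fun x w h => (hV x).2 ⟨w, ?_⟩) w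
    simpa [boundedVerifier] using h
  · intro x hx
    obtain ⟨π, hπ⟩ := exists_IPSProves pres hx
    obtain ⟨π', h, -⟩ := hq π x hπ
    exact ⟨π', h⟩
  · intro x _ n hn
    obtain ⟨π, hπ, hl⟩ := exists_proof_of_proofLen_le hn.le
    obtain ⟨π', h, hl'⟩ := hq π x hπ
    refine (proofLen_le (Q := fun π x => proofSystem pres (boundedVerifier p V) π = x) h).trans ?_
    exact_mod_cast hl'.trans (Polynomial.eval_nat_mono q hl)

end Backward

end

/-- Over a finite field or a number field, some Cook–Reckhow proof system p-simulates IPS for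
Variety Emptiness if and only if PIT is in NP. -/
theorem mainTheorem2 {F : Type*} [Field F] (hF : Finite F ∨ NumberField F)
    (pres : FieldPresentation F) :
    (∃ P : List Letter → List Letter,
      IsCookReckhow P (VarietyEmptiness pres) ∧
      PSimulates (fun π x => P π = x) (IPSProves pres) (VarietyEmptiness pres)) ↔
    InNP (PIT pres) := by
  exact ⟨fun ⟨_, hP, hsim⟩ => inNP_PIT_of_simulates pres hP hsim, exists_simulates_of_inNP_PIT pres⟩
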